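/- **Proposition 2.1 (open book as cut).** Let $\Sigma$ be a compact smooth surface with boundary, let $\psi$ be a diffeomorphism of $\Sigma$ that is the identity on a neighbourhood of $\partial\Sigma$, and let $$V:=\Sigma\times\mathbb R/\bigl((x,s+2\pi)\sim(\psi(x),s)\bigr)\;=\;\Sigma\times[0,2\pi]/\bigl((x,2\pi)\sim(\psi(x),0)\bigr)$$ be the mapping torus, with circle-valued coordinate $s\in S^1=\mathbb R/2\pi\mathbb Z$. Let $\partial_1\Sigma,\dots,\partial_k\Sigma$ be the components of $\partial\Sigma$, with smooth angular coordinates $\theta\in\mathbb R/2\pi\mathbb Z$, and write $\partial_iV=\partial_i\Sigma\times S^1$. Let $h_1,\dots,h_k\in\mathbb Z$, and let $M:=V/\!\!\sim$ be the quotient space (with the quotient topology) obtained by identifying points of $\partial_iV$ that lie on the same orbit of the $S^1$-action generated by $\partial_s-h_i\partial_\theta$, $i=1,\dots,k$. There are $\varepsilon>0$ and disjoint collar neighbourhoods of the $\partial_i\Sigma$ in $\Sigma$ with coordinates $(\tau,\theta)\in(-\varepsilon,0]\times\mathbb R/2\pi\mathbb Z$, extending the given coordinate $\theta$ on $\partial_i\Sigma=\{\tau=0\}$,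 on which $\psi$ is the identity. For every choice of such $\varepsilon$ and such collars, the following holds. 1. $M$ is a smooth closed $3$-manifold: it is compact and Hausdorff and carries a smooth structure (without boundary) for which the quotient map restricts to a diffeomorphism from $\mathrm{Int}(V)$ onto $M\setminus B$, where $B:=\partial V/\!\!\sim$, and for which the maps $$T_i\colon S^1\times\{z\in\mathbb C:|z|<\sqrt\varepsilon\}\to M,\qquad T_i(b,\rho e^{i\vartheta})=\bigl[(\tau,\theta,s)=(-\rho^2,\,b-h_i\vartheta,\,\vartheta)\bigr],$$ are diffeomorphisms onto disjoint open subsets of $M$, with $B=\bigcup_iT_i(S^1\times\{0\})$. 2. The map $\mathfrak p\colon M\setminus B=\mathrm{Int}(V)\to S^1$ given by the $s$-coordinate is a smooth, locally trivial fibration, and on the tubular neighbourhood of $B$ formed by the $T_i$ it equals the angular coordinate $\vartheta$ of the disc factor. So $(B,\mathfrak p)$ is an open book decomposition of $M$. The map $x\mapsto[(x,0)]$ is a homeomorphism from $\Sigma$ onto the page $\overline{\mathfrak p^{-1}(0)}$, and it maps $\partial\Sigma$ onto the binding $B$. 3. The monodromy of the open book is $\psi$ composed with $h_i$-fold right-handed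 Dehn twists along curves parallel to $\partial_i\Sigma$, $i=1,\dots,k$. In detail, let $\chi_i\colon\mathbb R\to\mathbb R$ be smooth functions that equal $0$ on $(-\infty,-\varepsilon+\delta]$ and $-h_i$ on $[-\delta,\infty)$ for some $\delta>0$, and let $D$ be the diffeomorphism of $\Sigma$ that equals $(\tau,\theta)\mapsto(\tau,\theta+2\pi\chi_i(\tau))$ on the $i$-th collar and the identity outside the collars; this is the $h_i$-fold Dehn twist parallel to $\partial_i\Sigma$ for all $i$, right-handed with respect to the orientation $(\partial_\tau,\partial_\theta)$ (which is the given orientation if $\Sigma$ is oriented and $\theta$ is chosen positive for the boundary orientation). Consider smooth vector fields $X$ on $M$ that lift $\partial_s$ on $M\setminus B$ and coincide near $B$ with the angular vector field $\partial_\vartheta$ of the disc factor in the neighbourhoods $T_i$. There is such an $X$ whose time $2\pi$ flow on the page over $s=0$, identified with $\Sigma$ as in 2, is exactly $\psi\circ D$; and for every such $X$ with smooth global flow the time $2\pi$ flow on that page is smoothly isotopic to $\psi\circ D$ through diffeomorphisms of $\Sigma$ that are the identity on a fixed neighbourhood of $\partial\Sigma$. -/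

import Mathlib

open Set Filter Topology Manifold
open scoped ContDiff Real

universe u

/-! Smooth surfaces with boundary are modelled on `𝓡∂ 2`, smooth closed 3-manifolds on `𝓡 3`.
The circle `ℝ / 2πℤ` is Mathlib's `Circle`, with angular coordinate `t ↦ Circle.exp t`. -/

section Surface

variable {S : Type u} [TopologicalSpace S] [ChartedSpace (EuclideanHalfSpace 2) S]

/-- Angular coordinates on the boundary of a surface: `∂S` is the disjoint union of `k` circles
`γ i`, each of them smoothly embedded. If `z = e^{iθ}`, then `θ` is the coordinate of `γ i z`. -/
structure IsBoundaryCoordinates {k : ℕ} (γ : Fin k → Circle → S) : Prop where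
  contMDiff : ∀ i, ContMDiff (𝓡 1) (𝓡∂ 2) ∞ (γ i)
  immersion : ∀ i z, Function.Injective (mfderiv (𝓡 1) (𝓡∂ 2) (γ i) z)
  injective : ∀ i j z w, γ i z = γ j w → i = j ∧ z = w
  iUnion_range : ⋃ i, range (γ i) = (𝓡∂ 2).boundary S

/-- Coordinates `(τ, θ) ∈ (-ε, 0] × ℝ/2πℤ` on disjoint collars of the boundary circles, extending
the boundary coordinates `γ`: each `c i` is a diffeomorphism of `(-ε, 0] × Circle` onto an open
subset of `S`, and `τ = 0` is the boundary. The values of `c i` elsewhere are irrelevant. -/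
structure IsCollar {k : ℕ} (γ : Fin k → Circle → S) (ε : ℝ) (c : Fin k → ℝ × Circle → S) :
    Prop where
  pos : 0 < ε
  boundary : ∀ i z, c i (0, z) = γ i z
  contMDiffOn : ∀ i, ContMDiffOn (𝓘(ℝ, ℝ).prod (𝓡 1)) (𝓡∂ 2) ∞ (c i) (Ioc (-ε) 0 ×ˢ univ)
  isOpen_image : ∀ i, IsOpen (c i '' (Ioc (-ε) 0 ×ˢ univ))
  smooth_inverse : ∀ i, ∃ d : S → ℝ × Circle,
    ContMDiffOn (𝓡∂ 2) (𝓘(ℝ, ℝ).prod (𝓡 1)) ∞ d (c i '' (Ioc (-ε) 0 ×ˢ univ)) ∧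
      ∀ y ∈ Ioc (-ε) 0 ×ˢ univ, d (c i y) = y
  disjoint : ∀ i j, i ≠ j →
    Disjoint (c i '' (Ioc (-ε) 0 ×ˢ univ)) (c j '' (Ioc (-ε) 0 ×ˢ univ))

/-- A smooth function that interpolates between `0` near `τ = -ε` and `-h` near `τ = 0`. -/
structure IsTwistProfile (ε : ℝ) (h : ℤ) (χ : ℝ → ℝ) : Prop where
  contDiff : ContDiff ℝ ∞ χ
  eq_zero : ∃ δ > 0, ∀ τ ≤ -ε + δ, χ τ = 0
  eq_neg : ∃ δ > 0, ∀ τ ≥ -δ, χ τ = -(h : ℝ)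

open Classical in
/-- The map equal to `(τ, θ) ↦ (τ, θ + 2π χ_i(τ))` on the `i`-th collar and to the identity outside
the collars. If `χ_i` interpolates between `0` (inner end) and `-h_i` (boundary), this is the
composition of the `h_i`-fold Dehn twists along the circles parallel to the boundary circles.
These are right-handed for the orientation `(∂_τ, ∂_θ)`: a path that crosses the collar towards
the boundary is turned to the right, i.e. in the direction `-∂_θ`, when `h_i > 0`. -/
noncomputable def boundaryTwist {k : ℕ} (ε : ℝ) (c : Fin k → ℝ × Circle → S)
    (χ : Fin k → ℝ → ℝ) (x : S) : S :=
  if H : ∃ y : Fin k × ℝ × Circle, y.2.1 ∈ Ioc (-ε) 0 ∧ c y.1 y.2 = x then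
    c H.choose.1 (H.choose.2.1,
      H.choose.2.2 * Circle.exp (2 * π * χ H.choose.1 H.choose.2.1))
  else x

/-- `f` and `g` are smoothly isotopic through diffeomorphisms that are the identity on a fixed
neighbourhood of the boundary. -/
def IsotopicRelBoundary (f g : S → S) : Prop :=
  ∃ F : ℝ → S → S,
    ContMDiff (𝓘(ℝ, ℝ).prod (𝓡∂ 2)) (𝓡∂ 2) ∞ (fun y : ℝ × S => F y.1 y.2) ∧
    (∀ t, ∃ d : Diffeomorph (𝓡∂ 2) (𝓡∂ 2) S S ∞, ⇑d = F t) ∧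
    F 0 = f ∧ F 1 = g ∧
    ∃ U ∈ 𝓝ˢ ((𝓡∂ 2).boundary S), ∀ t, ∀ x ∈ U, F t x = x

end Surface

section Cut

variable {S : Type u} [TopologicalSpace S]

/-- The mapping torus of `(S, ψ)`: the quotient of `S × ℝ` by `(x, s + 2π) ∼ (ψ x, s)`. -/
def MappingTorus (ψ : S → S) : Type u :=
  Quot fun a b : S × ℝ => ∃ x s, a = (x, s + 2 * π) ∧ b = (ψ x, s)

instance (ψ : S → S) : TopologicalSpace (MappingTorus ψ) :=
  inferInstanceAs (TopologicalSpace (Quot _))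

/-- The point `[(x, s)]` of the mapping torus. -/
def MappingTorus.mk (ψ : S → S) (y : S × ℝ) : MappingTorus ψ := Quot.mk _ y

/-- The quotient `M = V/∼` of the mapping torus `V` that collapses the orbits of the flow
`(θ, s) ↦ (θ - h_i t, s + t)` of `∂_s - h_i ∂_θ` on the boundary tori `∂_i V`. -/
def OpenBookCut (ψ : S → S) {k : ℕ} (γ : Fin k → Circle → S) (h : Fin k → ℤ) : Type u :=
  Quot fun a b : MappingTorus ψ => ∃ (i : Fin k) (z : Circle) (s t : ℝ),
    a = MappingTorus.mk ψ (γ i z, s) ∧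
      b = MappingTorus.mk ψ (γ i (z * Circle.exp (-(h i : ℝ) * t)), s + t)

variable (ψ : S → S) {k : ℕ} (γ : Fin k → Circle → S) (h : Fin k → ℤ)

instance : TopologicalSpace (OpenBookCut ψ γ h) :=
  inferInstanceAs (TopologicalSpace (Quot _))

/-- The quotient map `V → M`. -/
def OpenBookCut.proj (v : MappingTorus ψ) : OpenBookCut ψ γ h := Quot.mk _ v

/-- The class in `M` of the point `[(x, s)]` of the mapping torus. -/
def OpenBookCut.mk (y : S × ℝ) : OpenBookCut ψ γ h :=
  OpenBookCut.proj ψ γ h (MappingTorus.mk ψ y)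

/-- The map `x ↦ [(x, 0)]` from `S` to the page over `s = 0`. -/
def OpenBookCut.page (x : S) : OpenBookCut ψ γ h := OpenBookCut.mk ψ γ h (x, 0)

/-- The map `(b, ρ e^{iϑ}) ↦ [(-ρ², b - h_i ϑ, ϑ)]` in collar coordinates `(τ, θ)`, defining the
smooth structure of the cut near the image of `∂_i V`. -/
noncomputable def OpenBookCut.tube (c : Fin k → ℝ × Circle → S) (i : Fin k) (y : Circle × ℂ) :
    OpenBookCut ψ γ h :=
  OpenBookCut.mk ψ γ h
    (c i (-‖y.2‖ ^ 2, y.1 * Circle.exp (-(h i : ℝ) * y.2.arg)), y.2.arg)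

end Cut

section OpenBook

variable {M : Type u} [TopologicalSpace M] [ChartedSpace (EuclideanSpace ℝ (Fin 3)) M]

/-- `T` is a tubular neighbourhood `B × D²` (with `D²` the open disc of radius `r`) of the link
`B = B_1 ⊔ … ⊔ B_k`, each `B_i` being a circle, on which `p` is the angular coordinate of the
`D²`-factor. -/
structure IsAdaptedTube (B : Set M) (p : M → Circle) {k : ℕ} (T : Fin k → Circle × ℂ → M)
    (r : ℝ) : Prop where
  pos : 0 < r
  localDiffeo : ∀ i, IsLocalDiffeomorphOn ((𝓡 1).prod 𝓘(ℝ, ℂ)) (𝓡 3) ∞ (T i)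
    (univ ×ˢ Metric.ball 0 r)
  injective : ∀ i j, ∀ y ∈ univ ×ˢ Metric.ball (0 : ℂ) r, ∀ y' ∈ univ ×ˢ Metric.ball (0 : ℂ) r,
    T i y = T j y' → i = j ∧ y = y'
  binding : B = {x | ∃ i b, T i (b, 0) = x}
  angular : ∀ i b (ρ ϑ : ℝ), 0 < ρ → ρ < r → p (T i (b, ρ * Circle.exp ϑ)) = Circle.exp ϑ

/-- `p` restricts to a smooth, locally trivial fibration `M \ B → Circle` (values of `p` on `B` are
irrelevant): over a neighbourhood `W` of any point of the circle there is a diffeomorphism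
`W × F ≅ p⁻¹(W)`, compatible with `p`, where `F` is a smooth surface. -/
structure IsSmoothFibrationOff (B : Set M) (p : M → Circle) : Prop where
  isClosed : IsClosed B
  contMDiffOn : ContMDiffOn (𝓡 3) (𝓡 1) ∞ p Bᶜ
  locally_trivial : ∀ w : Circle, ∃ W : Set Circle, IsOpen W ∧ w ∈ W ∧
    ∃ (F : Type u) (_ : TopologicalSpace F) (_ : ChartedSpace (EuclideanSpace ℝ (Fin 2)) F)
      (_ : IsManifold (𝓡 2) ∞ F) (φ : Circle × F → M),
      IsLocalDiffeomorphOn ((𝓡 1).prod (𝓡 2)) (𝓡 3) ∞ φ (W ×ˢ univ) ∧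
      InjOn φ (W ×ˢ univ) ∧
      φ '' (W ×ˢ univ) = Bᶜ ∩ p ⁻¹' W ∧
      ∀ y ∈ W ×ˢ univ, p (φ y) = y.1

/-- An open book decomposition of `M` with binding `B` and projection `p : M \ B → Circle`. -/
structure IsOpenBook (B : Set M) (p : M → Circle) : Prop where
  fibration : IsSmoothFibrationOff B p
  tube : ∃ (k : ℕ) (T : Fin k → Circle × ℂ → M) (r : ℝ), IsAdaptedTube B p T r

/-- The vector field `∂_s` on the circle. -/
noncomputable def circleField (w : Circle) : TangentSpace (𝓡 1) w :=
  mfderiv 𝓘(ℝ, ℝ) (𝓡 1) (fun t : ℝ => w * Circle.exp t) 0 (1 : ℝ)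

/-- `X` is a smooth lift of `∂_s` along `p` that coincides near the binding with the angular vector
field on the `D²`-factor of the tubular neighbourhood `T` (so it vanishes on `B`). -/
structure IsAngularLift [IsManifold (𝓡 3) ∞ M] (B : Set M) (p : M → Circle) {k : ℕ}
    (T : Fin k → Circle × ℂ → M)
    (X : ∀ x : M, TangentSpace (𝓡 3) x) : Prop where
  contMDiff : ContMDiff (𝓡 3) (𝓡 3).tangent ∞ fun x => (⟨x, X x⟩ : TangentBundle (𝓡 3) M)
  lift : ∀ x, x ∉ B → mfderiv (𝓡 3) (𝓡 1) p x (X x) = circleField (p x)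
  angular : ∃ δ > 0, ∀ i b (z : ℂ), ‖z‖ < δ →
    IsMIntegralCurve (fun t : ℝ => T i (b, Circle.exp t * z)) X

/-- `Φ` is the (global, smooth) flow of a lift `X` of `∂_s` as in `IsAngularLift`. The monodromy of
an open book is the diffeomorphism of a page given by the time `2π` map of such a flow. -/
def IsMonodromyFlow [IsManifold (𝓡 3) ∞ M] (B : Set M) (p : M → Circle) {k : ℕ}
    (T : Fin k → Circle × ℂ → M)
    (Φ : ℝ → M → M) : Prop :=
  ContMDiff (𝓘(ℝ, ℝ).prod (𝓡 3)) (𝓡 3) ∞ (fun y : ℝ × M => Φ y.1 y.2) ∧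
  (∀ x, Φ 0 x = x) ∧
  ∃ X : ∀ x : M, TangentSpace (𝓡 3) x,
    IsAngularLift B p T X ∧ ∀ x, IsMIntegralCurve (fun t => Φ t x) X

end OpenBook

/-! The collars come from the boundary: a boundary defining function `σ` and a smooth extension `ϑ` of
the angle of a boundary circle form a coordinate system `(-σ, ϑ)` near that circle, by an inverse
function theorem on the half-plane (`exists_local_inverse_halfPlane`, `exists_isCollar`).

The points of the cut `M` are the classes of an explicit equivalence relation on `S × ℝ`
(`OpenBookCut.mk_eq_mk_iff`), because the boundary orbits that are collapsed are closed and `ψ` fixes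
the boundary. So `M` is covered by two kinds of parametrizations: the quotient map on the interior of
`S × ℝ`, which is open and locally injective (`OpenBookCut.isOpen_mk_image`, `OpenBookCut.injOn_mk`),
and the tubes, which are open embeddings (`OpenBookCut.tube_injective`,
`OpenBookCut.continuousOn_tube`, `OpenBookCut.isOpen_tube_image`). The changes between them are
iterates of the deck transformation and polar coordinates away from the core, hence smooth, and they
define the smooth structure (`exists_isManifold_of_parametrizations`, `OpenBookCut.exists_isManifold`).
Compactness and the Hausdorff property are seen in the same parametrizations. The function `s` is the
angle of the discs in the tubes, and it is locally a product projection on the mapping torus of the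
interior, which gives the open book (`OpenBookCut.isOpenBook`).

For the monodromy, let `D_t` be the flow of `χ_i(τ) ∂_θ` on the collars (`twistFlow`), with `D_{2π}`
the given composition of Dehn twists. It commutes with `ψ`, and on the boundary it is the rotation by
`-h_i t`. So `[(x, s)] ↦ [(D_t x, s + t)]` is well defined on `M`, and in a tube it is
`(b, z) ↦ (b e^{it (χ_i + h_i)}, e^{it} z)` (`OpenBookCut.flow_tube`), a smooth flow that rotates the
discs near the core, where `χ_i = -h_i`. Its time `2π` map on the page is `ψ ∘ D_{2π}`.

Any other flow of the kind considered moves the pages with unit speed, and near the binding it is the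
rotation of the discs, by uniqueness of integral curves (`OpenBookCut.exists_isPageFlow`). So it
induces diffeomorphisms `G_{s,t}` of the surface (`OpenBookCut.pageMap`), which agree with `D_t` near
the boundary, and its time `2π` map on the page is `ψ ∘ G_{0,2π}`. The isotopy is
`r ↦ ψ ∘ G_{0,2πr} ∘ D_{-2πr} ∘ D_{2π}` (`OpenBookCut.isotopic_pageMap`): near the boundary it is
constantly `ψ ∘ D_{2π}`, which is the identity there as the `h_i` are integers. -/

/-! ### The inverse function theorem on a half-plane -/

section HalfPlane

/-- A map of a half-disc into the half-plane that preserves the boundary line and has derivative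
close to the identity is injective, and it has a smooth inverse near the image of the centre. A
preimage of `v` is the fixed point of `y ↦ y + (v - F y) / 2`; the factor `1 / 2` makes this
contraction preserve the half-plane. -/
theorem exists_inverse_of_fderivWithin_near_id {F : ℝ × ℝ → ℝ × ℝ} {p : ℝ × ℝ} {r : ℝ}
    (hr : 0 < r) (hp : p.1 = 0)
    (hF : ContDiffOn ℝ ∞ F ({y | 0 ≤ y.1} ∩ Metric.closedBall p r))
    (hclose : ∀ y ∈ {y : ℝ × ℝ | 0 ≤ y.1} ∩ Metric.closedBall p r,
      ‖fderivWithin ℝ F ({y | 0 ≤ y.1} ∩ Metric.closedBall p r) y -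
        ContinuousLinearMap.id ℝ (ℝ × ℝ)‖ ≤ 1 / 2)
    (hmaps : ∀ y ∈ {y : ℝ × ℝ | 0 ≤ y.1} ∩ Metric.closedBall p r, 0 ≤ (F y).1)
    (hbd : ∀ y ∈ {y : ℝ × ℝ | 0 ≤ y.1} ∩ Metric.closedBall p r, y.1 = 0 → (F y).1 = 0) :
    InjOn F ({y | 0 ≤ y.1} ∩ Metric.closedBall p r) ∧
      ∃ g : ℝ × ℝ → ℝ × ℝ, ContDiffOn ℝ ∞ g ({y | 0 ≤ y.1} ∩ Metric.ball (F p) (r / 4)) ∧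
        ∀ v ∈ {y : ℝ × ℝ | 0 ≤ y.1} ∩ Metric.ball (F p) (r / 4),
          g v ∈ {y : ℝ × ℝ | 0 ≤ y.1} ∩ Metric.closedBall p r ∧ F (g v) = v := by
  have hHconv : Convex ℝ {y : ℝ × ℝ | 0 ≤ y.1} :=
    convex_halfSpace_ge (f := Prod.fst) ⟨fun _ _ => rfl, fun _ _ => rfl⟩ 0
  have hHcl : IsClosed {y : ℝ × ℝ | 0 ≤ y.1} := isClosed_le continuous_const continuous_fst
  have hint : ∀ (q : ℝ × ℝ) (R : ℝ), 0 ≤ q.1 → 0 < R →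
      (interior ({y : ℝ × ℝ | 0 ≤ y.1} ∩ Metric.ball q R)).Nonempty := by
    intro q R hq hR
    refine ⟨(q.1 + R / 2, q.2), ?_⟩
    rw [interior_inter, Metric.isOpen_ball.interior_eq]
    constructor
    · rw [mem_interior]
      exact ⟨{y | 0 < y.1}, fun y (hy : 0 < y.1) => hy.le,
        isOpen_lt continuous_const continuous_fst, by simp only [mem_ofPred_eq]; positivity⟩
    · rw [Metric.mem_ball, Prod.dist_eq]
      simp [abs_of_pos hR, hR]
  set s := {y : ℝ × ℝ | 0 ≤ y.1} ∩ Metric.closedBall p r with hs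
  have hsconv : Convex ℝ s := hHconv.inter (convex_closedBall p r)
  have hps : p ∈ s := ⟨hp.ge, Metric.mem_closedBall_self hr.le⟩
  have hsu : UniqueDiffOn ℝ s := by
    refine uniqueDiffOn_convex hsconv ((hint p r hp.ge hr).mono (interior_mono ?_))
    exact inter_subset_inter_right _ Metric.ball_subset_closedBall
  have hder : ∀ y ∈ s, HasFDerivWithinAt F (fderivWithin ℝ F s y) s y := fun y hy =>
    ((hF y hy).differentiableWithinAt (by simp)).hasFDerivWithinAt
  have happ : ∀ x ∈ s, ∀ y ∈ s, ‖F y - F x - (y - x)‖ ≤ 1 / 2 * ‖y - x‖ := by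
    intro x hx y hy
    exact hsconv.norm_image_sub_le_of_norm_hasFDerivWithin_le' hder hclose hx hy
  have hanti : ∀ x ∈ s, ∀ y ∈ s, ‖y - x‖ ≤ 2 * ‖F y - F x‖ := by
    intro x hx y hy
    have h1 := happ x hx y hy
    have h2 : ‖y - x‖ ≤ ‖F y - F x‖ + ‖F y - F x - (y - x)‖ := by
      have := norm_sub_le (F y - F x) (F y - F x - (y - x))
      simpa using this
    linarith
  refine ⟨fun x hx y hy hxy => ?_, ?_⟩
  · have := hanti x hx y hy
    rw [hxy, sub_self, norm_zero, mul_zero] at this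
    exact (sub_eq_zero.1 (norm_le_zero_iff.1 this)).symm
  have hsol : ∀ v ∈ {y : ℝ × ℝ | 0 ≤ y.1} ∩ Metric.ball (F p) (r / 4), ∃ y ∈ s, F y = v := by
    rintro v ⟨hv0, hv⟩
    let Φ : ℝ × ℝ → ℝ × ℝ := fun y => y + (1 / 2 : ℝ) • (v - F y)
    have hlip : ∀ x ∈ s, ∀ y ∈ s, ‖Φ y - Φ x‖ ≤ 3 / 4 * ‖y - x‖ := by
      intro x hx y hy
      have h1 : Φ y - Φ x = (1 / 2 : ℝ) • (y - x) - (1 / 2 : ℝ) • (F y - F x - (y - x)) := by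
        simp only [Φ]; module
      have h2 := happ x hx y hy
      rw [h1]
      refine (norm_sub_le _ _).trans ?_
      rw [norm_smul, norm_smul]
      norm_num
      linarith
    have hmap : MapsTo Φ s s := by
      intro y hy
      constructor
      · -- compare `y` with its projection to the boundary line
        have hy' : ((0 : ℝ), y.2) ∈ s := by
          refine ⟨le_refl (0 : ℝ), ?_⟩
          have h1 := hy.2
          rw [Metric.mem_closedBall, Prod.dist_eq] at h1 ⊢
          refine max_le ?_ ((le_max_right _ _).trans h1)
          simp [hp, hr.le]
        have h1 := happ _ hy' y hy
        have h2 : ‖y - ((0 : ℝ), y.2)‖ = y.1 := by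
          rw [Prod.norm_def]
          have : (0 : ℝ) ≤ y.1 := hy.1
          simp [abs_of_nonneg this, this]
        rw [h2] at h1
        have h3 := (norm_fst_le _).trans h1
        simp only [Prod.fst_sub, hbd _ hy' rfl, Real.norm_eq_abs] at h3
        have h4 := (abs_le.1 h3).2
        have h5 : (0 : ℝ) ≤ y.1 := hy.1
        have h6 : (0 : ℝ) ≤ v.1 := hv0
        change 0 ≤ (y + (1 / 2 : ℝ) • (v - F y)).1
        simp only [Prod.fst_add, Prod.smul_fst, Prod.fst_sub, smul_eq_mul]
        linarith
      · have h1 := hlip p hps y hy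
        have h2 : ‖Φ p - p‖ ≤ r / 8 := by
          have : Φ p - p = (1 / 2 : ℝ) • (v - F p) := by simp [Φ]
          rw [this, norm_smul]
          rw [Metric.mem_ball, dist_eq_norm] at hv
          norm_num
          linarith
        have h3 := hy.2
        rw [Metric.mem_closedBall, dist_eq_norm] at h3 ⊢
        calc ‖Φ y - p‖ ≤ ‖Φ y - Φ p‖ + ‖Φ p - p‖ := norm_sub_le_norm_sub_add_norm_sub _ _ _
          _ ≤ r := by linarith
    have hcontr : ContractingWith (3 / 4) (hmap.restrict Φ s s) := by
      refine ⟨by rw [← NNReal.coe_lt_coe]; norm_num, LipschitzWith.of_dist_le_mul ?_⟩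
      intro x y
      rw [Subtype.dist_eq, Subtype.dist_eq, dist_eq_norm, dist_eq_norm]
      simpa using hlip _ y.2 _ x.2
    obtain ⟨y, hy, hfix, -⟩ := hcontr.exists_fixedPoint'
      ((hHcl.inter Metric.isClosed_closedBall).isComplete) hmap hps (edist_ne_top _ _)
    refine ⟨y, hy, ?_⟩
    have h1 : (1 / 2 : ℝ) • (v - F y) = 0 := by simpa [Φ, Function.IsFixedPt] using hfix
    have h2 := (smul_eq_zero.1 h1).resolve_left (by norm_num)
    exact (sub_eq_zero.1 h2).symm
  choose! g hgs hFg using hsol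
  refine ⟨g, ?_, fun v hv => ⟨hgs v hv, hFg v hv⟩⟩
  set t := {y : ℝ × ℝ | 0 ≤ y.1} ∩ Metric.ball (F p) (r / 4) with ht
  have htu : UniqueDiffOn ℝ t :=
    uniqueDiffOn_convex (hHconv.inter (convex_ball _ _)) (hint _ _ (hmaps p hps) (by positivity))
  have hgc : ContinuousOn g t := by
    refine LipschitzOnWith.continuousOn (K := 2) (LipschitzOnWith.of_dist_le_mul ?_)
    intro x hx y hy
    have := hanti _ (hgs y hy) _ (hgs x hx)
    rw [hFg y hy, hFg x hx] at this
    simpa [dist_eq_norm] using this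
  have hinv : ∀ y ∈ s, ∃ A : (ℝ × ℝ) ≃L[ℝ] ℝ × ℝ, (A : ℝ × ℝ →L[ℝ] ℝ × ℝ) = fderivWithin ℝ F s y := by
    intro y hy
    have h1 : ‖ContinuousLinearMap.id ℝ (ℝ × ℝ) - fderivWithin ℝ F s y‖ < 1 := by
      rw [norm_sub_rev]
      exact (hclose y hy).trans_lt (by norm_num)
    exact ⟨ContinuousLinearEquiv.ofUnit (Units.oneSub _ h1),
      ContinuousLinearMap.ext fun z => by simp [ContinuousLinearEquiv.ofUnit, Units.oneSub]⟩
  have hgder : ∀ v ∈ t,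
      HasFDerivWithinAt g (ContinuousLinearMap.inverse (fderivWithin ℝ F s (g v))) t v := by
    intro v hv
    obtain ⟨A, hA⟩ := hinv _ (hgs v hv)
    have h1 := hder _ (hgs v hv)
    rw [← hA] at h1
    rw [← hA, ContinuousLinearMap.inverse_equiv]
    refine HasFDerivWithinAt.of_local_left_inverse ?_ h1 hv ?_
    · exact (hgc v hv).tendsto_nhdsWithin hgs
    · filter_upwards [self_mem_nhdsWithin] with w hw using hFg w hw
  have hF' : ContDiffOn ℝ ∞ (fderivWithin ℝ F s) s := ((contDiffOn_infty_iff_fderivWithin hsu).1 hF).2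
  rw [contDiffOn_infty]
  intro n
  induction n with
  | zero => exact contDiffOn_zero.2 hgc
  | succ n ih =>
    push_cast
    rw [contDiffOn_succ_iff_hasFDerivWithinAt_of_uniqueDiffOn htu]
    refine ⟨by simp, _, ?_, hgder⟩
    intro v hv
    obtain ⟨A, hA⟩ := hinv _ (hgs v hv)
    have h1 : ContDiffWithinAt ℝ n (fun w => fderivWithin ℝ F s (g w)) t v :=
      ContDiffWithinAt.comp v ((hF' (g v) (hgs v hv)).of_le (mod_cast le_top)) (ih v hv) hgs
    exact ContDiffAt.comp_contDiffWithinAt v (hA ▸ contDiffAt_map_inverse A) h1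

/-- The inverse function theorem at a boundary point of a half-plane, for maps that preserve the
half-plane and its boundary line. -/
theorem exists_local_inverse_halfPlane {f : ℝ × ℝ → ℝ × ℝ} {A : (ℝ × ℝ) ≃L[ℝ] ℝ × ℝ} {p : ℝ × ℝ}
    {U : Set (ℝ × ℝ)} (hp : p.1 = 0) (hU : U ∈ 𝓝 p)
    (hf : ContDiffOn ℝ ∞ f ({y | 0 ≤ y.1} ∩ U))
    (hA : HasFDerivWithinAt f (A : ℝ × ℝ →L[ℝ] ℝ × ℝ) {y | 0 ≤ y.1} p)
    (hA1 : ∃ a > 0, ∀ y, (A y).1 = a * y.1)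
    (hmaps : ∀ y ∈ {y : ℝ × ℝ | 0 ≤ y.1} ∩ U, 0 ≤ (f y).1)
    (hbd : ∀ y ∈ U, y.1 = 0 → (f y).1 = 0) :
    ∃ U' ∈ 𝓝 p, U' ⊆ U ∧ InjOn f ({y | 0 ≤ y.1} ∩ U') ∧
      ∃ V ∈ 𝓝 (f p), ∃ g : ℝ × ℝ → ℝ × ℝ, ContDiffOn ℝ ∞ g ({y | 0 ≤ y.1} ∩ V) ∧
        ∀ v ∈ {y : ℝ × ℝ | 0 ≤ y.1} ∩ V,
          g v ∈ {y : ℝ × ℝ | 0 ≤ y.1} ∩ U' ∧ f (g v) = v := by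
  obtain ⟨a, ha, hA1⟩ := hA1
  have hAs : ∀ y, (A.symm y).1 = a⁻¹ * y.1 := by
    intro y
    have := hA1 (A.symm y)
    rw [A.apply_symm_apply] at this
    rw [this]; field_simp
  set H := {y : ℝ × ℝ | 0 ≤ y.1} with hH
  have hHconv : Convex ℝ H :=
    convex_halfSpace_ge (f := Prod.fst) ⟨fun _ _ => rfl, fun _ _ => rfl⟩ 0
  have hHint : (interior H).Nonempty := by
    refine ⟨(1, 0), mem_interior.2 ⟨{y | 0 < y.1}, fun y (hy : 0 < y.1) => hy.le,
      isOpen_lt continuous_const continuous_fst, by simp⟩⟩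
  have hHu : UniqueDiffOn ℝ H := uniqueDiffOn_convex hHconv hHint
  let F : ℝ × ℝ → ℝ × ℝ := fun y => A.symm (f y)
  obtain ⟨R, hR, hRU⟩ := Metric.mem_nhds_iff.1 hU
  have hFR : ContDiffOn ℝ ∞ F (H ∩ Metric.ball p R) :=
    A.symm.contDiff.comp_contDiffOn (hf.mono (inter_subset_inter_right _ hRU))
  have hpH : p ∈ H := hp.ge
  have hFp : HasFDerivWithinAt F (ContinuousLinearMap.id ℝ (ℝ × ℝ)) H p := by
    refine (A.symm.hasFDerivAt.comp_hasFDerivWithinAt p hA).congr_fderiv ?_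
    exact ContinuousLinearMap.ext fun z => A.symm_apply_apply z
  have hcont : ContinuousWithinAt (fderivWithin ℝ F (H ∩ Metric.ball p R)) (H ∩ Metric.ball p R) p :=
    ((contDiffOn_infty_iff_fderivWithin (hHu.inter Metric.isOpen_ball)).1 hFR).2.continuousOn p
      ⟨hpH, Metric.mem_ball_self hR⟩
  have heq : fderivWithin ℝ F (H ∩ Metric.ball p R) p = ContinuousLinearMap.id ℝ (ℝ × ℝ) := by
    rw [fderivWithin_inter (Metric.isOpen_ball.mem_nhds (Metric.mem_ball_self hR))]
    exact hFp.fderivWithin (hHu p hpH)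
  have hev := hcont (Metric.closedBall_mem_nhds _ (by norm_num : (0 : ℝ) < 1 / 2))
  rw [heq] at hev
  obtain ⟨r', hr', hsub⟩ := Metric.mem_nhdsWithin_iff.1 hev
  set r := min (r' / 2) (R / 2) with hrdef
  have hr : 0 < r := by positivity
  have hrr' : Metric.closedBall p r ⊆ Metric.ball p r' :=
    Metric.closedBall_subset_ball ((min_le_left _ _).trans_lt (by linarith))
  have hrR : Metric.closedBall p r ⊆ Metric.ball p R :=
    Metric.closedBall_subset_ball ((min_le_right _ _).trans_lt (by linarith))
  have hsu : UniqueDiffOn ℝ (H ∩ Metric.closedBall p r) := by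
    refine uniqueDiffOn_convex (hHconv.inter (convex_closedBall p r)) ?_
    refine ⟨(p.1 + r / 2, p.2), ?_⟩
    rw [interior_inter]
    constructor
    · rw [mem_interior]
      exact ⟨{y | 0 < y.1}, fun y (hy : 0 < y.1) => hy.le,
        isOpen_lt continuous_const continuous_fst, by
          simp only [mem_ofPred_eq, hp, zero_add]; positivity⟩
    · refine interior_mono Metric.ball_subset_closedBall ?_
      rw [Metric.isOpen_ball.interior_eq, Metric.mem_ball, Prod.dist_eq]
      simp [abs_of_pos hr, hr]
  obtain ⟨hinj, g, hg, hgF⟩ := exists_inverse_of_fderivWithin_near_id (F := F) hr hp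
    (hFR.mono (inter_subset_inter_right _ hrR)) (by
      intro y hy
      have h1 : fderivWithin ℝ F (H ∩ Metric.closedBall p r) y =
          fderivWithin ℝ F (H ∩ Metric.ball p R) y :=
        fderivWithin_subset (inter_subset_inter_right _ hrR) (hsu y hy)
          ((hFR y ⟨hy.1, hrR hy.2⟩).differentiableWithinAt (by simp))
      have h2 := hsub ⟨hrr' hy.2, hy.1, hrR hy.2⟩
      rw [mem_preimage, Metric.mem_closedBall, dist_eq_norm] at h2
      rw [h1]; exact h2) (by
      intro y hy
      rw [hAs]
      exact mul_nonneg (by positivity) (hmaps y ⟨hy.1, hRU (hrR hy.2)⟩)) (by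
      intro y hy h0
      rw [hAs, hbd y (hRU (hrR hy.2)) h0, mul_zero])
  refine ⟨Metric.closedBall p r, Metric.closedBall_mem_nhds p hr, hrR.trans hRU, ?_,
    A.symm ⁻¹' Metric.ball (F p) (r / 4),
    A.symm.continuous.continuousAt.preimage_mem_nhds (Metric.ball_mem_nhds _ (by positivity)),
    g ∘ A.symm, ?_, ?_⟩
  · intro x hx y hy hxy
    exact hinj hx hy (congrArg A.symm hxy)
  · refine hg.comp A.symm.contDiff.contDiffOn ?_
    intro v hv
    refine ⟨?_, hv.2⟩
    change 0 ≤ (A.symm v).1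
    rw [hAs]; exact mul_nonneg (by positivity) hv.1
  · intro v hv
    have h1 := hgF (A.symm v) ⟨by
      change 0 ≤ (A.symm v).1
      rw [hAs]; exact mul_nonneg (by positivity) hv.1, hv.2⟩
    exact ⟨h1.1, A.symm.injective h1.2⟩

end HalfPlane

/-! ### The angle on the circle -/

theorem Circle.contMDiff_coe : ContMDiff (𝓡 1) 𝓘(ℝ, ℂ) ∞ (fun w : Circle => (w : ℂ)) := by
  have := finrank_real_complex_fact'
  exact contMDiff_coe_sphere (E := ℂ) (n := 1)

theorem Circle.contMDiffAt_arg {w : Circle} (hw : (w : ℂ) ∈ Complex.slitPlane) :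
    ContMDiffAt (𝓡 1) 𝓘(ℝ, ℝ) ∞ (fun w : Circle => Complex.arg w) w := by
  have h1 : ContDiffAt ℝ ∞ (fun z : ℂ => (Complex.log z).im) (w : ℂ) :=
    Complex.imCLM.contDiff.contDiffAt.comp (w : ℂ) ((Complex.contDiffAt_log hw).restrict_scalars ℝ)
  simp only [Complex.log_im] at h1
  exact h1.contMDiffAt.comp w (Circle.contMDiff_coe w)

/-- The branch of the angle on the circle that takes values in `(t - π, t + π]`. -/
noncomputable def Circle.angle (t : ℝ) (w : Circle) : ℝ :=
  t + Complex.arg ((w / Circle.exp t : Circle) : ℂ)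

@[simp] theorem Circle.exp_angle (t : ℝ) (w : Circle) : Circle.exp (Circle.angle t w) = w := by
  rw [Circle.angle, Circle.exp_add, Circle.exp_arg]; simp

@[simp] theorem Circle.angle_exp_self (t : ℝ) : Circle.angle t (Circle.exp t) = t := by
  simp [Circle.angle]

theorem Circle.angle_exp {t s : ℝ} (h : |s - t| < π) : Circle.angle t (Circle.exp s) = s := by
  rw [abs_lt] at h
  rw [Circle.angle, ← Circle.exp_sub, Circle.arg_exp h.1 h.2.le]; ring

theorem Circle.contMDiffAt_angle {t : ℝ} {w : Circle}
    (hw : ((w / Circle.exp t : Circle) : ℂ) ∈ Complex.slitPlane) :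
    ContMDiffAt (𝓡 1) 𝓘(ℝ, ℝ) ∞ (Circle.angle t) w := by
  have h1 : ContMDiffAt (𝓡 1) (𝓡 1) ∞ (fun w : Circle => w / Circle.exp t) w :=
    contMDiffAt_id.div contMDiffAt_const
  have h2 := (Circle.contMDiffAt_arg hw).comp w h1
  have h3 : ContDiff ℝ ∞ (fun x : ℝ => t + x) := contDiff_const.add contDiff_id
  exact h3.contMDiff.contMDiffAt.comp w h2

theorem Circle.isOpen_slitPlane_div (t : ℝ) :
    IsOpen {w : Circle | ((w / Circle.exp t : Circle) : ℂ) ∈ Complex.slitPlane} :=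
  Complex.isOpen_slitPlane.preimage (by fun_prop)

theorem Circle.exp_mem_slitPlane_div (t : ℝ) :
    ((Circle.exp t / Circle.exp t : Circle) : ℂ) ∈ Complex.slitPlane := by
  simp

theorem Circle.contMDiffAt_angle_exp (t : ℝ) :
    ContMDiffAt (𝓡 1) 𝓘(ℝ, ℝ) ∞ (Circle.angle t) (Circle.exp t) :=
  Circle.contMDiffAt_angle (Circle.exp_mem_slitPlane_div t)

/-- Coordinates of the plane as a pair of real numbers. -/
noncomputable def euclideanPair : EuclideanSpace ℝ (Fin 2) ≃L[ℝ] ℝ × ℝ :=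
  (EuclideanSpace.equiv (Fin 2) ℝ).trans (ContinuousLinearEquiv.finTwoArrow ℝ ℝ)

@[simp] theorem euclideanPair_fst (y : EuclideanSpace ℝ (Fin 2)) : (euclideanPair y).1 = y 0 := rfl
@[simp] theorem euclideanPair_symm_zero (y : ℝ × ℝ) : (euclideanPair.symm y) 0 = y.1 := by
  rw [← euclideanPair_fst, ContinuousLinearEquiv.apply_symm_apply]

/-! ### Charts of a surface at a boundary point -/

section Charts

variable {S : Type u} [TopologicalSpace S] [ChartedSpace (EuclideanHalfSpace 2) S]

theorem extChartAt_zero_nonneg (p : S) {x : S} (hx : x ∈ (chartAt (EuclideanHalfSpace 2) p).source) :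
    0 ≤ extChartAt (𝓡∂ 2) p x 0 := by
  have : extChartAt (𝓡∂ 2) p x ∈ range (𝓡∂ 2) :=
    extChartAt_target_subset_range p ((extChartAt (𝓡∂ 2) p).map_source (by simpa using hx))
  rwa [range_modelWithCornersEuclideanHalfSpace] at this

theorem extChartAt_zero_pos_iff [IsManifold (𝓡∂ 2) ∞ S] (p : S) {x : S}
    (hx : x ∈ (chartAt (EuclideanHalfSpace 2) p).source) :
    0 < extChartAt (𝓡∂ 2) p x 0 ↔ x ∈ (𝓡∂ 2).interior S := by
  have h := (𝓡∂ 2).isInteriorPoint_iff_of_mem_atlas (n := ∞) (by simp)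
    (chart_mem_atlas (EuclideanHalfSpace 2) p) hx
  change _ ↔ (𝓡∂ 2).IsInteriorPoint x
  rw [h]
  constructor
  · intro h0
    refine (chartAt (EuclideanHalfSpace 2) p).mem_interior_extend_target
      ((chartAt (EuclideanHalfSpace 2) p).map_source hx) ?_
    rw [interior_range_modelWithCornersEuclideanHalfSpace]
    exact h0
  · intro h0
    have := interior_mono ((chartAt (EuclideanHalfSpace 2) p).extend_target_subset_range) h0
    rwa [interior_range_modelWithCornersEuclideanHalfSpace] at this

theorem extChartAt_zero_eq_zero_iff [IsManifold (𝓡∂ 2) ∞ S] (p : S) {x : S}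
    (hx : x ∈ (chartAt (EuclideanHalfSpace 2) p).source) :
    extChartAt (𝓡∂ 2) p x 0 = 0 ↔ x ∈ (𝓡∂ 2).boundary S := by
  rw [← (𝓡∂ 2).compl_interior, mem_compl_iff, ← extChartAt_zero_pos_iff p hx]
  have := extChartAt_zero_nonneg p hx
  constructor
  · intro h; rw [h]; exact lt_irrefl _
  · intro h; linarith

/-- If `0 ≤ f ≤ C g` with equality at `x`, then `dg = 0` at `x` implies `df = 0` at `x`. -/
theorem mfderiv_eq_zero_of_le {f g : S → ℝ} {x : S} {C : ℝ}
    (hC : 0 ≤ C) (hf : MDifferentiableAt (𝓡∂ 2) 𝓘(ℝ, ℝ) f x) (hg : MDifferentiableAt (𝓡∂ 2) 𝓘(ℝ, ℝ) g x)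
    (hle : ∀ᶠ y in 𝓝 x, 0 ≤ f y ∧ f y ≤ C * g y) (hx : g x = 0)
    (h0 : mfderiv (𝓡∂ 2) 𝓘(ℝ, ℝ) g x = 0) : mfderiv (𝓡∂ 2) 𝓘(ℝ, ℝ) f x = 0 := by
  have hfx : f x = 0 := by
    have := hle.self_of_nhds
    rw [hx] at this
    linarith
  set φ := extChartAt (𝓡∂ 2) x with hφ
  have hφx : φ.symm (φ x) = x := extChartAt_to_inv x
  have hg' : HasFDerivWithinAt (fun y => g (φ.symm y)) (0 : EuclideanSpace ℝ (Fin 2) →L[ℝ] ℝ)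
      (range (𝓡∂ 2)) (φ x) := by
    have := hg.hasMFDerivAt.2
    rw [h0] at this
    exact this
  suffices hf' : HasFDerivWithinAt (fun y => f (φ.symm y)) (0 : EuclideanSpace ℝ (Fin 2) →L[ℝ] ℝ)
      (range (𝓡∂ 2)) (φ x) from HasMFDerivAt.mfderiv ⟨hf.continuousAt, hf'⟩
  have hev : ∀ᶠ y in 𝓝[range (𝓡∂ 2)] (φ x),
      0 ≤ f (φ.symm y) ∧ f (φ.symm y) ≤ C * g (φ.symm y) := by
    have h1 : Tendsto φ.symm (𝓝[range (𝓡∂ 2)] (φ x)) (𝓝 x) := by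
      have := (continuousAt_extChartAt_symm (I := 𝓡∂ 2) x).tendsto
      rw [extChartAt_to_inv] at this
      exact this.mono_left nhdsWithin_le_nhds
    exact h1.eventually hle
  rw [hasFDerivWithinAt_iff_isLittleO] at hg' ⊢
  simp only [hφx, hx, hfx, sub_zero, zero_apply] at hg' ⊢
  refine (Asymptotics.IsBigO.of_bound C ?_).trans_isLittleO hg'
  filter_upwards [hev] with y hy
  rw [Real.norm_of_nonneg hy.1, Real.norm_eq_abs]
  exact hy.2.trans (mul_le_mul_of_nonneg_left (le_abs_self _) hC)

/-- A smooth boundary defining function of a compact surface: the sum of finitely many chart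
coordinates, cut off by bump functions. -/
theorem exists_boundary_defining_function [IsManifold (𝓡∂ 2) ∞ S] [CompactSpace S] [T2Space S] :
    ∃ σ : S → ℝ, ContMDiff (𝓡∂ 2) 𝓘(ℝ, ℝ) ∞ σ ∧ (∀ x, 0 ≤ σ x) ∧
      ∀ x ∈ (𝓡∂ 2).boundary S, σ x = 0 ∧ mfderiv (𝓡∂ 2) 𝓘(ℝ, ℝ) σ x ≠ 0 := by
  let f : ∀ q : S, SmoothBumpFunction (𝓡∂ 2) q := fun q => Classical.arbitrary _
  let κ : S → S → ℝ := fun q x => f q x • extChartAt (𝓡∂ 2) q x 0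
  have hcoord : ∀ q : S, ContMDiffOn (𝓡∂ 2) 𝓘(ℝ, ℝ) ∞ (fun x => extChartAt (𝓡∂ 2) q x 0)
      (chartAt (EuclideanHalfSpace 2) q).source := by
    intro q
    have h1 : ContDiff ℝ ∞ (fun y : EuclideanSpace ℝ (Fin 2) => y 0) := by fun_prop
    exact h1.contMDiff.comp_contMDiffOn (contMDiffOn_extChartAt (I := 𝓡∂ 2) (n := ∞) (x := q))
  have hκ : ∀ q, ContMDiff (𝓡∂ 2) 𝓘(ℝ, ℝ) ∞ (κ q) := fun q => (f q).contMDiff_smul (hcoord q)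
  have hnn : ∀ q x, 0 ≤ κ q x := by
    intro q x
    by_cases hx : x ∈ (chartAt (EuclideanHalfSpace 2) q).source
    · exact mul_nonneg (f q).nonneg (extChartAt_zero_nonneg q hx)
    · have : f q x = 0 := by
        by_contra h
        exact hx ((f q).support_subset_source h)
      simp [κ, this]
  have hbd : ∀ q, ∀ x ∈ (𝓡∂ 2).boundary S, κ q x = 0 := by
    intro q x hb
    by_cases hx : x ∈ (chartAt (EuclideanHalfSpace 2) q).source
    · simp only [κ, (extChartAt_zero_eq_zero_iff q hx).2 hb, smul_zero]
    · have : f q x = 0 := by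
        by_contra h
        exact hx ((f q).support_subset_source h)
      simp [κ, this]
  obtain ⟨P, -, hP⟩ := ((𝓡∂ 2).isClosed_boundary (M := S) (n := ∞) (by simp)).isCompact.elim_nhds_subcover
    (fun q => {x | f q x > 1 / 2} ∩ (chartAt (EuclideanHalfSpace 2) q).source) (fun q _ => by
      refine inter_mem ?_ (chart_source_mem_nhds _ q)
      exact (f q).continuous.continuousAt.eventually (lt_mem_nhds (by rw [(f q).eq_one]; norm_num)))
  refine ⟨fun x => ∑ q ∈ P, κ q x, contMDiff_finsetSum fun q _ => hκ q,
    fun x => Finset.sum_nonneg fun q _ => hnn q x, fun x hx =>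
      ⟨Finset.sum_eq_zero fun q _ => hbd q x hx, fun h0 => ?_⟩⟩
  obtain ⟨q, hq, hqx⟩ := mem_iUnion₂.1 (hP hx)
  have hsrc : (chartAt (EuclideanHalfSpace 2) q).source ∈ 𝓝 x :=
    (chartAt (EuclideanHalfSpace 2) q).open_source.mem_nhds hqx.2
  -- the coordinate function of the chart at `q` is at most `2 κ q ≤ 2 σ` near `x`
  have h1 := mfderiv_eq_zero_of_le (f := fun x => extChartAt (𝓡∂ 2) q x 0) (C := 2) (by norm_num)
    (((hcoord q).contMDiffAt hsrc).mdifferentiableAt (by simp))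
    ((contMDiff_finsetSum fun q _ => hκ q).contMDiffAt.mdifferentiableAt (by simp)) (by
      filter_upwards [hsrc, (f q).continuous.continuousAt.eventually (lt_mem_nhds hqx.1)] with y hy hy'
      refine ⟨extChartAt_zero_nonneg q hy, ?_⟩
      have h2 : κ q y ≤ ∑ q ∈ P, κ q y := Finset.single_le_sum (fun q _ => hnn q y) hq
      have h3 : 1 / 2 * extChartAt (𝓡∂ 2) q y 0 ≤ κ q y :=
        mul_le_mul_of_nonneg_right hy'.le (extChartAt_zero_nonneg q hy)
      linarith) (Finset.sum_eq_zero fun q _ => hbd q x hx) h0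
  -- but the differential of the chart is invertible
  obtain ⟨A, hA⟩ := isInvertible_mfderiv_extChartAt (I := 𝓡∂ 2) (x := q) (y := x) (by
    simpa using hqx.2)
  have h2 : HasMFDerivAt (𝓡∂ 2) 𝓘(ℝ, EuclideanSpace ℝ (Fin 2)) (extChartAt (𝓡∂ 2) q) x A := by
    rw [hA]
    exact (mdifferentiableAt_extChartAt hqx.2).hasMFDerivAt
  let π0 : EuclideanSpace ℝ (Fin 2) →L[ℝ] ℝ := (ContinuousLinearMap.fst ℝ ℝ ℝ).comp
    (euclideanPair : EuclideanSpace ℝ (Fin 2) →L[ℝ] ℝ × ℝ)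
  have h3 := (π0.hasMFDerivAt (x := extChartAt (𝓡∂ 2) q x)).comp x h2
  have h4 := h3.mfderiv
  have h5 : (π0 ∘ extChartAt (𝓡∂ 2) q) = fun x => extChartAt (𝓡∂ 2) q x 0 := rfl
  rw [h5, h1] at h4
  have h6 := DFunLike.congr_fun h4 (A.symm (euclideanPair.symm (1, 0)))
  have h7 : A (A.symm (euclideanPair.symm (1, 0))) = euclideanPair.symm (1, 0) :=
    A.apply_symm_apply _
  have h8 : (0 : ℝ) = π0 (A (A.symm (euclideanPair.symm (1, 0)))) := h6
  rw [h7] at h8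
  have h9 : π0 (euclideanPair.symm (1, 0)) = 1 := euclideanPair_symm_zero (1, 0)
  rw [h9] at h8
  norm_num at h8

end Charts

/-! ### The angle near a boundary circle -/

section BoundaryAngle

variable {S : Type u} [TopologicalSpace S] [ChartedSpace (EuclideanHalfSpace 2) S]

/-- A chart at `p`, as a map to `ℝ × ℝ`. Its image lies in the half-plane `0 ≤ y.1`. -/
noncomputable def pairChart (p x : S) : ℝ × ℝ := euclideanPair (extChartAt (𝓡∂ 2) p x)

/-- The inverse of `pairChart`. -/
noncomputable def pairChartSymm (p : S) (y : ℝ × ℝ) : S :=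
  (extChartAt (𝓡∂ 2) p).symm (euclideanPair.symm y)

theorem pairChartSymm_pairChart (p : S) {x : S}
    (hx : x ∈ (chartAt (EuclideanHalfSpace 2) p).source) : pairChartSymm p (pairChart p x) = x := by
  rw [pairChartSymm, pairChart, ContinuousLinearEquiv.symm_apply_apply]
  exact (extChartAt (𝓡∂ 2) p).left_inv (by simpa using hx)

theorem contMDiffAt_pairChart [IsManifold (𝓡∂ 2) ∞ S] (p : S) {x : S}
    (hx : x ∈ (chartAt (EuclideanHalfSpace 2) p).source) :
    ContMDiffAt (𝓡∂ 2) 𝓘(ℝ, ℝ × ℝ) ∞ (pairChart p) x :=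
  euclideanPair.contDiff.contMDiff.contMDiffAt.comp x (contMDiffAt_extChartAt' hx)

theorem pairChart_fst_nonneg (p : S) {x : S}
    (hx : x ∈ (chartAt (EuclideanHalfSpace 2) p).source) : 0 ≤ (pairChart p x).1 :=
  extChartAt_zero_nonneg p hx

theorem pairChart_fst_eq_zero_iff [IsManifold (𝓡∂ 2) ∞ S] (p : S) {x : S}
    (hx : x ∈ (chartAt (EuclideanHalfSpace 2) p).source) :
    (pairChart p x).1 = 0 ↔ x ∈ (𝓡∂ 2).boundary S :=
  extChartAt_zero_eq_zero_iff p hx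

/-- Near the image of the centre, `pairChartSymm` is smooth on the half-plane and it inverts
`pairChart`. -/
theorem exists_pairChart_nhds [IsManifold (𝓡∂ 2) ∞ S] (p : S) {W : Set S} (hW : W ∈ 𝓝 p) :
    ∃ U ∈ 𝓝 (pairChart p p),
      ContMDiffOn 𝓘(ℝ, ℝ × ℝ) (𝓡∂ 2) ∞ (pairChartSymm p) ({y | 0 ≤ y.1} ∩ U) ∧
      ∀ y ∈ {y : ℝ × ℝ | 0 ≤ y.1} ∩ U, pairChartSymm p y ∈ W ∧
        pairChartSymm p y ∈ (chartAt (EuclideanHalfSpace 2) p).source ∧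
        pairChart p (pairChartSymm p y) = y := by
  have h1 := extChartAt_target_mem_nhdsWithin (I := 𝓡∂ 2) p
  rw [range_modelWithCornersEuclideanHalfSpace] at h1
  obtain ⟨O, hO, hpO, hsub⟩ := mem_nhdsWithin.1 h1
  have h2 : (extChartAt (𝓡∂ 2) p).symm ⁻¹' W ∈ 𝓝 (extChartAt (𝓡∂ 2) p p) :=
    (continuousAt_extChartAt_symm (I := 𝓡∂ 2) p).preimage_mem_nhds (by
      rwa [extChartAt_to_inv])
  have h3 : O ∩ (extChartAt (𝓡∂ 2) p).symm ⁻¹' W ∈ 𝓝 (extChartAt (𝓡∂ 2) p p) :=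
    inter_mem (hO.mem_nhds hpO) h2
  have htgt : ∀ y ∈ {y : ℝ × ℝ | 0 ≤ y.1} ∩
      euclideanPair.symm ⁻¹' (O ∩ (extChartAt (𝓡∂ 2) p).symm ⁻¹' W),
      euclideanPair.symm y ∈ (extChartAt (𝓡∂ 2) p).target := fun y hy =>
    hsub ⟨hy.2.1, by
      change 0 ≤ (euclideanPair.symm y) 0
      rw [euclideanPair_symm_zero]; exact hy.1⟩
  refine ⟨euclideanPair.symm ⁻¹' (O ∩ (extChartAt (𝓡∂ 2) p).symm ⁻¹' W),
    euclideanPair.symm.continuous.continuousAt.preimage_mem_nhds (by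
      rw [pairChart, ContinuousLinearEquiv.symm_apply_apply]; exact h3), ?_, ?_⟩
  · exact (contMDiffOn_extChartAt_symm (I := 𝓡∂ 2) (n := ∞) p).comp
      euclideanPair.symm.contDiff.contMDiff.contMDiffOn htgt
  · intro y hy
    refine ⟨hy.2.2, ?_, ?_⟩
    · have := (extChartAt (𝓡∂ 2) p).map_target (htgt y hy)
      rwa [extChartAt_source] at this
    · rw [pairChart, pairChartSymm, (extChartAt (𝓡∂ 2) p).right_inv (htgt y hy),
        ContinuousLinearEquiv.apply_symm_apply]

/-- In a chart, an immersed boundary circle is a regular curve on the boundary line. -/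
theorem exists_deriv_pairChart_ne_zero [IsManifold (𝓡∂ 2) ∞ S] {γ : Circle → S}
    (hγ : ContMDiff (𝓡 1) (𝓡∂ 2) ∞ γ)
    (himm : ∀ z, Function.Injective (mfderiv (𝓡 1) (𝓡∂ 2) γ z))
    (hbd : ∀ z, γ z ∈ (𝓡∂ 2).boundary S) (t : ℝ) :
    (∀ s, γ (Circle.exp s) ∈ (chartAt (EuclideanHalfSpace 2) (γ (Circle.exp t))).source →
      ContDiffAt ℝ ∞ (fun s : ℝ => (pairChart (γ (Circle.exp t)) (γ (Circle.exp s))).2) s) ∧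
      ∃ m ≠ 0, HasDerivAt
        (fun s : ℝ => (pairChart (γ (Circle.exp t)) (γ (Circle.exp s))).2) m t := by
  set p := γ (Circle.exp t) with hp
  have hcurve : ContMDiff 𝓘(ℝ, ℝ) (𝓡∂ 2) ∞ (fun s : ℝ => γ (Circle.exp s)) :=
    hγ.comp contMDiff_circleExp
  have hsrc : p ∈ (chartAt (EuclideanHalfSpace 2) p).source := mem_chart_source _ p
  have hB : ∀ s, γ (Circle.exp s) ∈ (chartAt (EuclideanHalfSpace 2) p).source →
      ContDiffAt ℝ ∞ (fun s : ℝ => pairChart p (γ (Circle.exp s))) s := by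
    intro s hs
    exact (ContMDiffAt.comp (g := pairChart p) (f := fun s : ℝ => γ (Circle.exp s)) s
      (contMDiffAt_pairChart p hs) hcurve.contMDiffAt).contDiffAt
  refine ⟨fun s hs => contDiff_snd.contDiffAt.comp s (hB s hs), ?_⟩
  have hBd := hB t hsrc
  have hder := (hBd.differentiableAt (by simp)).hasDerivAt
  set v := deriv (fun s : ℝ => pairChart p (γ (Circle.exp s))) t with hv
  have h2 : HasDerivAt (fun s : ℝ => (pairChart p (γ (Circle.exp s))).2) v.2 t := hder.snd
  have h1 : HasDerivAt (fun s : ℝ => (pairChart p (γ (Circle.exp s))).1) v.1 t := hder.fst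
  refine ⟨v.2, fun h0 => ?_, h2⟩
  have hv1 : v.1 = 0 := by
    have hev : (fun s : ℝ => (pairChart p (γ (Circle.exp s))).1) =ᶠ[𝓝 t] fun _ => 0 := by
      have := hcurve.continuous.continuousAt.preimage_mem_nhds (x := t)
        ((chartAt (EuclideanHalfSpace 2) p).open_source.mem_nhds hsrc)
      filter_upwards [this] with s hs
      exact (pairChart_fst_eq_zero_iff p hs).2 (hbd _)
    exact h1.unique ((hasDerivAt_const t (0 : ℝ)).congr_of_eventuallyEq hev)
  have hv0 : v = 0 := Prod.ext hv1 h0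
  -- the chart and `γ` are immersions, so a zero velocity would force `Circle.exp` to have zero
  -- derivative at `t`; but `Circle.angle t` is a local inverse of it
  obtain ⟨A, hA⟩ := isInvertible_mfderiv_extChartAt (I := 𝓡∂ 2) (x := p) (y := p) (by simp)
  have e1 : HasMFDerivAt (𝓡∂ 2) 𝓘(ℝ, EuclideanSpace ℝ (Fin 2)) (extChartAt (𝓡∂ 2) p) p A := by
    rw [hA]
    exact (mdifferentiableAt_extChartAt hsrc).hasMFDerivAt
  have e2 : HasMFDerivAt 𝓘(ℝ, ℝ) (𝓡 1) Circle.exp t (mfderiv 𝓘(ℝ, ℝ) (𝓡 1) Circle.exp t) :=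
    ((contMDiff_circleExp (m := ∞)).contMDiffAt.mdifferentiableAt (by simp)).hasMFDerivAt
  have e3 : HasMFDerivAt (𝓡 1) (𝓡∂ 2) γ (Circle.exp t) (mfderiv (𝓡 1) (𝓡∂ 2) γ (Circle.exp t)) :=
    (hγ.contMDiffAt.mdifferentiableAt (by simp)).hasMFDerivAt
  have e4 := (e1.comp (Circle.exp t) e3).comp t e2
  have e6 : HasDerivAt (fun s : ℝ => extChartAt (𝓡∂ 2) p (γ (Circle.exp s))) 0 t := by
    have := euclideanPair.symm.hasFDerivAt.comp_hasDerivAt t hder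
    rw [hv0] at this
    simpa [pairChart, Function.comp_def] using this
  have e7 := hasMFDerivAt_unique e4 e6.hasFDerivAt.hasMFDerivAt
  have e8 := congrArg (fun L : TangentSpace 𝓘(ℝ, ℝ) t →L[ℝ]
    TangentSpace 𝓘(ℝ, EuclideanSpace ℝ (Fin 2)) (extChartAt (𝓡∂ 2) p p) => L (1 : ℝ)) e7
  have e8' : ContinuousLinearMap.toSpanSingleton ℝ (0 : EuclideanSpace ℝ (Fin 2)) (1 : ℝ) = 0 := by
    simp
  have e9 : A (mfderiv (𝓡 1) (𝓡∂ 2) γ (Circle.exp t)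
      (mfderiv 𝓘(ℝ, ℝ) (𝓡 1) Circle.exp t (1 : ℝ))) = 0 := e8.trans e8'
  have e10 : mfderiv (𝓡 1) (𝓡∂ 2) γ (Circle.exp t) (mfderiv 𝓘(ℝ, ℝ) (𝓡 1) Circle.exp t (1 : ℝ)) = 0 :=
    (map_eq_zero_iff A A.injective).1 e9
  have e11 : mfderiv 𝓘(ℝ, ℝ) (𝓡 1) Circle.exp t (1 : ℝ) = 0 :=
    (map_eq_zero_iff _ (himm _)).1 e10
  have f1 : HasMFDerivAt (𝓡 1) 𝓘(ℝ, ℝ) (Circle.angle t) (Circle.exp t)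
      (mfderiv (𝓡 1) 𝓘(ℝ, ℝ) (Circle.angle t) (Circle.exp t)) :=
    ((Circle.contMDiffAt_angle_exp t).mdifferentiableAt (by simp)).hasMFDerivAt
  have f3 : (fun s : ℝ => Circle.angle t (Circle.exp s)) =ᶠ[𝓝 t] fun s => s := by
    filter_upwards [Metric.ball_mem_nhds t Real.pi_pos] with s hs
    exact Circle.angle_exp (by rwa [Metric.mem_ball, Real.dist_eq] at hs)
  have f4 := hasMFDerivAt_unique (f1.comp t e2)
    ((hasFDerivAt_id t).congr_of_eventuallyEq f3).hasMFDerivAt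
  have f5 := congrArg (fun L : TangentSpace 𝓘(ℝ, ℝ) t →L[ℝ]
    TangentSpace 𝓘(ℝ, ℝ) (Circle.angle t (Circle.exp t)) => L (1 : ℝ)) f4
  have f6 : mfderiv (𝓡 1) 𝓘(ℝ, ℝ) (Circle.angle t) (Circle.exp t)
    (mfderiv 𝓘(ℝ, ℝ) (𝓡 1) Circle.exp t (1 : ℝ)) = (1 : ℝ) := f5
  rw [e11, map_zero] at f6
  have f7 : (0 : ℝ) = 1 := f6
  norm_num at f7

/-- The inverse of a smoothly embedded boundary circle extends to a smooth map from a neighbourhood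
of the circle to `Circle`. -/
theorem exists_boundary_angle [IsManifold (𝓡∂ 2) ∞ S] [CompactSpace S] [T2Space S] {γ : Circle → S}
    (hγ : ContMDiff (𝓡 1) (𝓡∂ 2) ∞ γ)
    (himm : ∀ z, Function.Injective (mfderiv (𝓡 1) (𝓡∂ 2) γ z)) (hinj : Function.Injective γ)
    (hbd : ∀ z, γ z ∈ (𝓡∂ 2).boundary S) :
    ∃ (ϑ : S → Circle) (O : Set S), IsOpen O ∧ (∀ z, γ z ∈ O ∧ ϑ (γ z) = z) ∧
      ContMDiffOn (𝓡∂ 2) (𝓡 1) ∞ ϑ O := by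
  have hemb : IsClosedEmbedding γ := hγ.continuous.isClosedEmbedding hinj
  -- it is enough to extend the inverse as a map to `ℂ`, which can be done locally
  obtain ⟨Θ, hΘ⟩ := exists_contMDiffMap_forall_mem_convex_of_local (𝓡∂ 2) (M := S) (F := ℂ)
    (n := (⊤ : ℕ∞))
    (t := fun x => {v | ∀ z, γ z = x → v = z}) (fun x a ha b hb s t hs ht hst z hz => by
      rw [ha z hz, hb z hz, ← add_smul, hst, one_smul]) (fun x => by
    by_cases hx : x ∈ range γ
    · obtain ⟨z, rfl⟩ := hx
      obtain ⟨t, rfl⟩ := Circle.exp_surjective z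
      obtain ⟨hsm', m, hm, hder⟩ := exists_deriv_pairChart_ne_zero hγ himm hbd t
      set p := γ (Circle.exp t) with hp
      set g : ℝ → ℝ := fun s => (pairChart p (γ (Circle.exp s))).2 with hg
      have hsrc : p ∈ (chartAt (EuclideanHalfSpace 2) p).source := mem_chart_source _ p
      have hsm : ContDiffAt ℝ ∞ g t := hsm' t hsrc
      have hA : HasFDerivAt g ((ContinuousLinearEquiv.unitsEquivAut ℝ (Units.mk0 m hm) :
          ℝ ≃L[ℝ] ℝ) : ℝ →L[ℝ] ℝ) t := by
        refine hder.hasFDerivAt.congr_fderiv ?_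
        exact ContinuousLinearMap.ext fun s => by simp
      set e := hsm.toOpenPartialHomeomorph g hA (by simp) with he
      have hte : t ∈ e.source := hsm.mem_toOpenPartialHomeomorph_source hA (by simp)
      -- the inverse of `g` is smooth on a neighbourhood of `g t`, not only at that point
      have hT : ∀ᶠ s in 𝓝 t, γ (Circle.exp s) ∈ (chartAt (EuclideanHalfSpace 2) p).source ∧
          deriv g s ≠ 0 := by
        have h0 : Continuous (fun s : ℝ => γ (Circle.exp s)) := hγ.continuous.comp (by fun_prop)
        refine Filter.Eventually.and (h0.continuousAt.preimage_mem_nhds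
          ((chartAt (EuclideanHalfSpace 2) p).open_source.mem_nhds hsrc)) ?_
        have h1 : ContinuousAt (fun s => fderiv ℝ g s 1) t :=
          (hsm.fderiv_right (m := ∞) (by simp)).continuousAt.clm_apply continuousAt_const
        refine h1.eventually_ne ?_
        rw [fderiv_apply_one_eq_deriv, hder.deriv]
        exact hm
      obtain ⟨T, hTsub, hTo, htT⟩ := eventually_nhds_iff.1 hT
      set U : Set S := {x | x ∈ (chartAt (EuclideanHalfSpace 2) p).source ∧
        (pairChart p x).2 ∈ e.target ∩ e.symm ⁻¹' T} with hUdef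
      have hF : ContMDiffOn (𝓡∂ 2) 𝓘(ℝ, ℂ) ∞
          (fun x => (Circle.exp (e.symm (pairChart p x).2) : ℂ)) U := by
        intro x hx
        have h1 : ContMDiffAt (𝓡∂ 2) 𝓘(ℝ, ℝ) ∞ (fun x => (pairChart p x).2) x :=
          ContMDiffAt.comp (g := (Prod.snd : ℝ × ℝ → ℝ)) x contDiff_snd.contMDiff.contMDiffAt
            (contMDiffAt_pairChart p hx.1)
        have hT' := hTsub _ hx.2.2
        have hinv : ContDiffAt ℝ ∞ e.symm (pairChart p x).2 :=
          e.contDiffAt_symm_deriv hT'.2 hx.2.1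
            ((hsm' _ hT'.1).differentiableAt (by simp)).hasDerivAt (hsm' _ hT'.1)
        have h2 : ContMDiffAt (𝓡∂ 2) 𝓘(ℝ, ℝ) ∞ (fun x => e.symm (pairChart p x).2) x :=
          ContMDiffAt.comp (g := e.symm) x hinv.contMDiffAt h1
        exact (Circle.contMDiff_coe.contMDiffAt.comp x
          ((contMDiff_circleExp (m := ∞)).contMDiffAt.comp x h2)).contMDiffWithinAt
      have hU : U ∈ 𝓝 p := by
        refine inter_mem ((chartAt (EuclideanHalfSpace 2) p).open_source.mem_nhds hsrc) ?_
        have h1 : ContinuousAt (fun x => (pairChart p x).2) p :=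
          continuous_snd.continuousAt.comp (contMDiffAt_pairChart p hsrc).continuousAt
        refine h1.preimage_mem_nhds ((e.isOpen_inter_preimage_symm hTo).mem_nhds ?_)
        exact ⟨e.map_source hte, by
          have : e.symm (pairChart p p).2 = t := e.left_inv hte
          rw [mem_preimage, this]; exact htT⟩
      have hW : Circle.exp '' (e.source ∩ Metric.ball t π) ∈ 𝓝 (Circle.exp t) := by
        have h1 : Circle.angle t ⁻¹' (e.source ∩ Metric.ball t π) ∈ 𝓝 (Circle.exp t) := by
          refine (Circle.contMDiffAt_angle_exp t).continuousAt.preimage_mem_nhds ?_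
          rw [Circle.angle_exp_self]
          exact inter_mem (e.open_source.mem_nhds hte) (Metric.ball_mem_nhds t Real.pi_pos)
        filter_upwards [h1] with w hw
        exact ⟨_, hw, Circle.exp_angle t w⟩
      rw [hemb.isInducing.nhds_eq_comap] at hW
      obtain ⟨N, hN, hNW⟩ := hW
      refine ⟨U ∩ N, inter_mem hU hN, _, hF.mono inter_subset_left, fun y hy z hz => ?_⟩
      obtain ⟨s, hs, rfl⟩ := hNW (show γ z ∈ N from hz ▸ hy.2)
      have h3 : e.symm (pairChart p y).2 = s := by
        rw [← hz]
        exact e.left_inv hs.1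
      simp only [h3]
    · refine ⟨(range γ)ᶜ, hemb.isClosed_range.isOpen_compl.mem_nhds hx, fun _ => 0,
        contMDiffOn_const, fun y hy z hz => ?_⟩
      exact absurd ⟨z, hz⟩ hy)
  have hΘc : Continuous Θ := Θ.contMDiff.continuous
  refine ⟨fun x => Circle.exp (Complex.arg (Θ x)), {x | Θ x ≠ 0},
    isOpen_ne_fun hΘc continuous_const, fun z => ?_, fun x (hx : Θ x ≠ 0) => ?_⟩
  · have h1 : Θ (γ z) = z := hΘ (γ z) z rfl
    simp only [ne_eq, mem_ofPred_eq, h1]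
    exact ⟨Circle.coe_ne_zero z, Circle.exp_arg z⟩
  · -- near `x`, rotate so that the argument is taken away from the cut
    set a := Circle.exp (Complex.arg (Θ x)) with ha
    have hsl : Θ x / (a : ℂ) ∈ Complex.slitPlane := by
      have : Θ x / (a : ℂ) = ((‖Θ x‖ : ℝ) : ℂ) := by
        rw [div_eq_iff (Circle.coe_ne_zero a), ha, Circle.coe_exp, Complex.norm_mul_exp_arg_mul_I]
      rw [this, Complex.ofReal_mem_slitPlane]
      exact norm_pos_iff.2 hx
    clear_value a
    have hev : ∀ y : S, Θ y ≠ 0 →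
        Circle.exp (Complex.arg (Θ y)) = a * Circle.exp (Complex.arg (Θ y / a)) := by
      intro y hy
      have h1 := Complex.norm_mul_exp_arg_mul_I (Θ y)
      have h2 := Complex.norm_mul_exp_arg_mul_I (Θ y / a)
      rw [norm_div, Circle.norm_coe, div_one] at h2
      ext
      rw [Circle.coe_mul, Circle.coe_exp, Circle.coe_exp]
      have h3 : ((‖Θ y‖ : ℝ) : ℂ) ≠ 0 := by simpa using hy
      refine mul_left_cancel₀ h3 ?_
      rw [h1]
      rw [eq_div_iff (Circle.coe_ne_zero a)] at h2
      linear_combination -h2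
    have h1 : ContMDiffAt (𝓡∂ 2) 𝓘(ℝ, ℝ) ∞ (fun y => Complex.arg (Θ y / a)) x := by
      have h2 : ContDiffAt ℝ ∞ (fun z : ℂ => (Complex.log (z / a)).im) (Θ x) := by
        have h3 : ContDiffAt ℝ ∞ (fun z : ℂ => Complex.log (z / a)) (Θ x) :=
          ContDiffAt.comp (f := fun z : ℂ => z / (a : ℂ)) (Θ x)
            ((Complex.contDiffAt_log hsl).restrict_scalars ℝ) (contDiffAt_id.div_const _)
        exact Complex.imCLM.contDiff.contDiffAt.comp (Θ x) h3
      simp only [Complex.log_im] at h2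
      exact h2.contMDiffAt.comp x Θ.contMDiff.contMDiffAt
    have h2 : ContMDiffAt (𝓡∂ 2) (𝓡 1) ∞ (fun y => a * Circle.exp (Complex.arg (Θ y / a))) x :=
      contMDiffAt_const.mul ((contMDiff_circleExp (m := ∞)).contMDiffAt.comp x h1)
    refine (h2.congr_of_eventuallyEq ?_).contMDiffWithinAt
    filter_upwards [hΘc.continuousAt.eventually_ne hx] with y hy using hev y hy

end BoundaryAngle

/-! ### Collars -/

section Collar

variable {S : Type u} [TopologicalSpace S] [ChartedSpace (EuclideanHalfSpace 2) S]

/-- The angle and the boundary defining function form a chart near a point of a boundary circle: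
they have a local inverse that is smooth up to the boundary. -/
theorem exists_local_collar [IsManifold (𝓡∂ 2) ∞ S] {γ : Circle → S}
    (hγ : ContMDiff (𝓡 1) (𝓡∂ 2) ∞ γ)
    (himm : ∀ z, Function.Injective (mfderiv (𝓡 1) (𝓡∂ 2) γ z))
    (hbd : ∀ z, γ z ∈ (𝓡∂ 2).boundary S)
    {σ : S → ℝ} (hσ : ContMDiff (𝓡∂ 2) 𝓘(ℝ, ℝ) ∞ σ) (hσ0 : ∀ x, 0 ≤ σ x)
    (hσb : ∀ x ∈ (𝓡∂ 2).boundary S, σ x = 0 ∧ mfderiv (𝓡∂ 2) 𝓘(ℝ, ℝ) σ x ≠ 0)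
    {ϑ : S → Circle} {O : Set S} (hO : IsOpen O) (hϑγ : ∀ z, γ z ∈ O ∧ ϑ (γ z) = z)
    (hϑ : ContMDiffOn (𝓡∂ 2) (𝓡 1) ∞ ϑ O) (t : ℝ) {W : Set S} (hW : W ∈ 𝓝 (γ (Circle.exp t))) :
    ∃ N ∈ 𝓝 (γ (Circle.exp t)), N ⊆ W ∧ InjOn (fun x => (σ x, ϑ x)) N ∧
      ∃ V ∈ 𝓝 ((0 : ℝ), Circle.exp t), ∃ G : ℝ × Circle → S,
        ContMDiffOn (𝓘(ℝ, ℝ).prod (𝓡 1)) (𝓡∂ 2) ∞ G (V ∩ {y | y.1 ≤ 0}) ∧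
        ∀ y ∈ V, y.1 ≤ 0 → G y ∈ N ∧ σ (G y) = -y.1 ∧ ϑ (G y) = y.2 := by
  obtain ⟨hgsm, m, hm, hgder⟩ := exists_deriv_pairChart_ne_zero hγ himm hbd t
  set p := γ (Circle.exp t) with hp
  have hsrc : p ∈ (chartAt (EuclideanHalfSpace 2) p).source := mem_chart_source _ p
  have hpb : p ∈ (𝓡∂ 2).boundary S := hbd _
  set H := {y : ℝ × ℝ | 0 ≤ y.1} with hH
  have hp01 : (pairChart p p).1 = 0 := (pairChart_fst_eq_zero_iff p hsrc).2 hpb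
  have hpH : pairChart p p ∈ H := hp01.ge
  have hsymm : pairChartSymm p (pairChart p p) = p := pairChartSymm_pairChart p hsrc
  set Q : Set S := O ∩ ϑ ⁻¹' {w | ((w / Circle.exp t : Circle) : ℂ) ∈ Complex.slitPlane} with hQ
  have hQo : IsOpen Q :=
    hϑ.continuousOn.isOpen_inter_preimage hO (Circle.isOpen_slitPlane_div t)
  have hpQ : p ∈ Q := ⟨(hϑγ _).1, by
    rw [mem_preimage, (hϑγ _).2]; exact Circle.exp_mem_slitPlane_div t⟩
  have hloc : ∀ x ∈ Q, ContMDiffAt (𝓡∂ 2) 𝓘(ℝ, ℝ) ∞ (fun x => Circle.angle t (ϑ x)) x := by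
    intro x hx
    exact (Circle.contMDiffAt_angle hx.2).comp x (hϑ.contMDiffAt (hO.mem_nhds hx.1))
  have hWQ : W ∩ Q ∈ 𝓝 p := inter_mem hW (hQo.mem_nhds hpQ)
  obtain ⟨U, hU, hUsm, hUmem⟩ := exists_pairChart_nhds p hWQ
  let F : ℝ × ℝ → ℝ × ℝ := fun y => (σ (pairChartSymm p y), Circle.angle t (ϑ (pairChartSymm p y)))
  have hF : ContDiffOn ℝ ∞ F (H ∩ U) := by
    intro y hy
    have h1 : ContMDiffWithinAt 𝓘(ℝ, ℝ × ℝ) 𝓘(ℝ, ℝ) ∞ (fun y => σ (pairChartSymm p y)) (H ∩ U) y :=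
      hσ.contMDiffAt.comp_contMDiffWithinAt y (hUsm y hy)
    have h2 : ContMDiffWithinAt 𝓘(ℝ, ℝ × ℝ) 𝓘(ℝ, ℝ) ∞
        (fun y => Circle.angle t (ϑ (pairChartSymm p y))) (H ∩ U) y :=
      ContMDiffAt.comp_contMDiffWithinAt (g := fun x => Circle.angle t (ϑ x)) y
        (hloc _ (hUmem y hy).1.2) (hUsm y hy)
    exact h1.contDiffWithinAt.prodMk h2.contDiffWithinAt
  have hFp : F (pairChart p p) = (0, t) := by
    have h1 : ϑ p = Circle.exp t := (hϑγ _).2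
    simp only [F, hsymm, (hσb p hpb).1, h1, Circle.angle_exp_self]
  have hHU : H ∩ U ∈ 𝓝[H] (pairChart p p) := inter_mem self_mem_nhdsWithin (mem_nhdsWithin_of_mem_nhds hU)
  obtain ⟨L, hL⟩ : ∃ L : ℝ × ℝ →L[ℝ] ℝ × ℝ, HasFDerivWithinAt F L H (pairChart p p) :=
    ⟨_, (((hF _ ⟨hpH, mem_of_mem_nhds hU⟩).mono_of_mem_nhdsWithin hHU).differentiableWithinAt
      (by simp)).hasFDerivWithinAt⟩
  -- along the boundary line, `F` is `(0, g s) ↦ (0, s)`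
  have hL01 : L (0, m) = (0, 1) := by
    set β : ℝ → ℝ × ℝ := fun s => (0, (pairChart p (γ (Circle.exp s))).2) with hβ
    have hβd : HasDerivAt β (0, m) t := (hasDerivAt_const t (0 : ℝ)).prodMk hgder
    have hβt : β t = pairChart p p := Prod.ext hp01.symm rfl
    have hL' : HasFDerivWithinAt F L H (β t) := by rw [hβt]; exact hL
    have h1 : HasDerivWithinAt (F ∘ β) (L (0, m)) univ t :=
      hL'.comp_hasDerivWithinAt t hβd.hasDerivWithinAt (fun s _ => le_refl (0 : ℝ))
    have h2 : (F ∘ β) =ᶠ[𝓝 t] fun s => ((0 : ℝ), s) := by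
      have h0 : Continuous (fun s : ℝ => γ (Circle.exp s)) := hγ.continuous.comp (by fun_prop)
      filter_upwards [h0.continuousAt.preimage_mem_nhds
        ((chartAt (EuclideanHalfSpace 2) p).open_source.mem_nhds hsrc),
        Metric.ball_mem_nhds t Real.pi_pos] with s hs hs'
      have h3 : β s = pairChart p (γ (Circle.exp s)) :=
        Prod.ext ((pairChart_fst_eq_zero_iff p hs).2 (hbd _)).symm rfl
      simp only [Function.comp, F, h3, pairChartSymm_pairChart p hs, (hσb _ (hbd _)).1, (hϑγ _).2]
      rw [Circle.angle_exp]
      rwa [Metric.mem_ball, Real.dist_eq] at hs'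
    have h3 : HasDerivAt (fun s : ℝ => ((0 : ℝ), s)) ((0 : ℝ), (1 : ℝ)) t :=
      (hasDerivAt_const t (0 : ℝ)).prodMk (hasDerivAt_id t)
    exact (h1.hasDerivAt univ_mem).unique (h3.congr_of_eventuallyEq h2)
  have hL1 : HasFDerivWithinAt (fun y => σ (pairChartSymm p y))
      ((ContinuousLinearMap.fst ℝ ℝ ℝ).comp L) H (pairChart p p) :=
    hL.fst
  have hsnd : ∀ y : ℝ × ℝ, L y = (y.1 * (L (1, 0)).1, y.1 * (L (1, 0)).2 + y.2 / m) := by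
    intro y
    have h1 : y = y.1 • ((1 : ℝ), (0 : ℝ)) + (y.2 / m) • ((0 : ℝ), m) := by
      ext <;> simp [hm]
    conv_lhs => rw [h1]
    rw [map_add, map_smul, map_smul, hL01]
    ext <;> simp
  have ha0 : 0 ≤ (L (1, 0)).1 := by
    have h1 : IsLocalMinOn (fun y => σ (pairChartSymm p y)) H (pairChart p p) := by
      refine Filter.Eventually.of_forall fun y => ?_
      simp only [hsymm, (hσb p hpb).1]
      exact hσ0 _
    refine h1.hasFDerivWithinAt_nonneg hL1 (y := ((1 : ℝ), (0 : ℝ))) ?_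
    refine mem_posTangentConeAt_of_segment_subset ?_
    intro y hy
    rw [segment_eq_image'] at hy
    obtain ⟨s, hs, rfl⟩ := hy
    change 0 ≤ (pairChart p p + s • (pairChart p p + (1, 0) - pairChart p p)).1
    simp [hp01, hs.1]
  have ha : 0 < (L (1, 0)).1 := by
    refine lt_of_le_of_ne ha0 fun h0 => (hσb p hpb).2 ?_
    have h1 : (ContinuousLinearMap.fst ℝ ℝ ℝ).comp L = 0 := by
      refine ContinuousLinearMap.ext fun y => ?_
      change (L y).1 = 0
      rw [hsnd, ← h0, mul_zero]
    rw [h1] at hL1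
    refine HasMFDerivAt.mfderiv ⟨hσ.continuous.continuousAt, ?_⟩
    have h2 := HasFDerivWithinAt.comp (extChartAt (𝓡∂ 2) p p) (s := range (𝓡∂ 2)) hL1
      euclideanPair.hasFDerivAt.hasFDerivWithinAt (fun y hy => by
        rw [range_modelWithCornersEuclideanHalfSpace] at hy
        exact hy)
    have h3 : ((fun y => σ (pairChartSymm p y)) ∘ euclideanPair) =
        fun y => σ ((extChartAt (𝓡∂ 2) p).symm y) := by
      ext y; simp [pairChartSymm]
    rw [h3, ContinuousLinearMap.zero_comp] at h2
    exact h2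
  have hLinj : Function.Injective L.toLinearMap := by
    rw [← LinearMap.ker_eq_bot, LinearMap.ker_eq_bot']
    intro y hy
    have h1 : L y = 0 := hy
    rw [hsnd] at h1
    have h2 : y.1 * (L (1, 0)).1 = 0 := congrArg Prod.fst h1
    have h3 : y.1 * (L (1, 0)).2 + y.2 / m = 0 := congrArg Prod.snd h1
    have h4 : y.1 = 0 := (mul_eq_zero.1 h2).resolve_right ha.ne'
    rw [h4, zero_mul, zero_add, div_eq_zero_iff] at h3
    exact Prod.ext h4 (h3.resolve_right hm)
  set A : (ℝ × ℝ) ≃L[ℝ] ℝ × ℝ :=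
    (LinearEquiv.ofInjectiveEndo L.toLinearMap hLinj).toContinuousLinearEquiv with hA
  have hAL : (A : ℝ × ℝ →L[ℝ] ℝ × ℝ) = L := ContinuousLinearMap.ext fun y => rfl
  obtain ⟨U', hU', hU'U, hinj, V, hV, g, hg, hgm⟩ := exists_local_inverse_halfPlane (A := A)
    hp01 hU hF (hAL ▸ hL) ⟨_, ha, fun y => by
      have : A y = L y := rfl
      rw [this, hsnd, mul_comm]⟩ (fun y _ => hσ0 _) (fun y hy h0 => by
      have h1 := hUmem y ⟨h0.ge, hy⟩
      have h2 : pairChartSymm p y ∈ (𝓡∂ 2).boundary S :=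
        (pairChart_fst_eq_zero_iff p h1.2.1).1 (by rw [h1.2.2, h0])
      exact (hσb _ h2).1)
  set N : Set S := (W ∩ Q) ∩ ((chartAt (EuclideanHalfSpace 2) p).source ∩ pairChart p ⁻¹' U') with hN
  refine ⟨N, ?_, fun x hx => hx.1.1, ?_, ?_⟩
  · exact inter_mem hWQ (inter_mem ((chartAt (EuclideanHalfSpace 2) p).open_source.mem_nhds hsrc)
      ((contMDiffAt_pairChart p hsrc).continuousAt.preimage_mem_nhds hU'))
  · intro x hx y hy hxy
    have h1 : F (pairChart p x) = F (pairChart p y) := by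
      simp only [F, pairChartSymm_pairChart p hx.2.1, pairChartSymm_pairChart p hy.2.1]
      rw [(Prod.mk.inj hxy).1, (Prod.mk.inj hxy).2]
    have h2 := hinj ⟨pairChart_fst_nonneg p hx.2.1, hx.2.2⟩ ⟨pairChart_fst_nonneg p hy.2.1, hy.2.2⟩ h1
    rw [← pairChartSymm_pairChart p hx.2.1, h2, pairChartSymm_pairChart p hy.2.1]
  · have hj : ∀ w : Circle, ((w / Circle.exp t : Circle) : ℂ) ∈ Complex.slitPlane → ∀ τ : ℝ,
        ContMDiffAt (𝓘(ℝ, ℝ).prod (𝓡 1)) 𝓘(ℝ, ℝ × ℝ) ∞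
          (fun y : ℝ × Circle => (-y.1, Circle.angle t y.2)) (τ, w) := by
      intro w hw τ
      have h1 : ContMDiffAt (𝓘(ℝ, ℝ).prod (𝓡 1)) 𝓘(ℝ, ℝ) ∞ (fun y : ℝ × Circle => -y.1) (τ, w) :=
        contDiff_neg.contMDiff.contMDiffAt.comp (τ, w) contMDiffAt_fst
      have h2 : ContMDiffAt (𝓘(ℝ, ℝ).prod (𝓡 1)) 𝓘(ℝ, ℝ) ∞
          (fun y : ℝ × Circle => Circle.angle t y.2) (τ, w) :=
        ContMDiffAt.comp (g := Circle.angle t) (τ, w) (Circle.contMDiffAt_angle hw) contMDiffAt_snd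
      exact h1.prodMk_space h2
    refine ⟨{y | ((y.2 / Circle.exp t : Circle) : ℂ) ∈ Complex.slitPlane ∧
      (-y.1, Circle.angle t y.2) ∈ V}, inter_mem ?_ ?_,
      fun y => pairChartSymm p (g (-y.1, Circle.angle t y.2)), ?_, ?_⟩
    · exact ((Circle.isOpen_slitPlane_div t).preimage continuous_snd).mem_nhds
        (Circle.exp_mem_slitPlane_div t)
    · refine (hj _ (Circle.exp_mem_slitPlane_div t) 0).continuousAt.preimage_mem_nhds ?_
      simpa [hFp] using hV
    · rintro ⟨τ, w⟩ ⟨⟨hw, hwV⟩, hτ⟩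
      have hτ' : τ ≤ 0 := hτ
      have hmem : (-τ, Circle.angle t w) ∈ {y : ℝ × ℝ | 0 ≤ y.1} ∩ V :=
        ⟨by change 0 ≤ -τ; linarith, hwV⟩
      have h1 := (hg _ hmem).contMDiffWithinAt
      have h2 := hUsm _ ⟨(hgm _ hmem).1.1, hU'U (hgm _ hmem).1.2⟩
      have h3 : MapsTo (fun y : ℝ × Circle => (-y.1, Circle.angle t y.2))
          ({y : ℝ × Circle | ((y.2 / Circle.exp t : Circle) : ℂ) ∈ Complex.slitPlane ∧
            (-y.1, Circle.angle t y.2) ∈ V} ∩ {y | y.1 ≤ 0}) ({y : ℝ × ℝ | 0 ≤ y.1} ∩ V) := by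
        rintro ⟨τ, w⟩ ⟨⟨hw, hwV⟩, hτ⟩
        have hτ' : τ ≤ 0 := hτ
        exact ⟨by change 0 ≤ -τ; linarith, hwV⟩
      have h4 := ContMDiffWithinAt.comp (τ, w) h1 (hj w hw τ).contMDiffWithinAt h3
      exact ContMDiffWithinAt.comp (g := pairChartSymm p)
        (f := g ∘ fun y : ℝ × Circle => (-y.1, Circle.angle t y.2)) (τ, w) h2 h4 fun y hy =>
        ⟨(hgm _ (h3 hy)).1.1, hU'U (hgm _ (h3 hy)).1.2⟩
    · rintro ⟨τ, w⟩ ⟨hw, hwV⟩ hτ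
      have hτ' : τ ≤ 0 := hτ
      have hmem : (-τ, Circle.angle t w) ∈ {y : ℝ × ℝ | 0 ≤ y.1} ∩ V :=
        ⟨by change 0 ≤ -τ; linarith, hwV⟩
      obtain ⟨⟨h1, h2⟩, h3⟩ := hgm _ hmem
      obtain ⟨h4, h5, h6⟩ := hUmem _ ⟨h1, hU'U h2⟩
      have h7 : σ (pairChartSymm p (g (-τ, Circle.angle t w))) = -τ := congrArg Prod.fst h3
      have h8 : Circle.angle t (ϑ (pairChartSymm p (g (-τ, Circle.angle t w)))) =
        Circle.angle t w := congrArg Prod.snd h3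
      refine ⟨⟨h4, h5, ?_⟩, h7, ?_⟩
      · rw [mem_preimage, h6]; exact h2
      · rw [← Circle.exp_angle t (ϑ _), h8, Circle.exp_angle]

end Collar

section Collar

variable {S : Type u} [TopologicalSpace S] [ChartedSpace (EuclideanHalfSpace 2) S]

/-- Collar coordinates near one smoothly embedded boundary circle, inside a given neighbourhood. -/
theorem exists_collar_of_circle [IsManifold (𝓡∂ 2) ∞ S] [CompactSpace S] [T2Space S]
    {γ : Circle → S} (hγ : ContMDiff (𝓡 1) (𝓡∂ 2) ∞ γ)
    (himm : ∀ z, Function.Injective (mfderiv (𝓡 1) (𝓡∂ 2) γ z)) (hinj : Function.Injective γ)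
    (hbd : ∀ z, γ z ∈ (𝓡∂ 2).boundary S) {W : Set S} (hW : IsOpen W) (hγW : ∀ z, γ z ∈ W) :
    ∃ ε > 0, ∃ (c : ℝ × Circle → S) (d : S → ℝ × Circle), (∀ z, c (0, z) = γ z) ∧
      ContMDiffOn (𝓘(ℝ, ℝ).prod (𝓡 1)) (𝓡∂ 2) ∞ c (Ioc (-ε) 0 ×ˢ univ) ∧
      (∀ ε' ∈ Ioc 0 ε, IsOpen (c '' (Ioc (-ε') 0 ×ˢ univ))) ∧
      ContMDiffOn (𝓡∂ 2) (𝓘(ℝ, ℝ).prod (𝓡 1)) ∞ d (c '' (Ioc (-ε) 0 ×ˢ univ)) ∧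
      (∀ y ∈ Ioc (-ε) 0 ×ˢ univ, d (c y) = y) ∧ ∀ y ∈ Ioc (-ε) 0 ×ˢ univ, c y ∈ W := by
  obtain ⟨σ, hσ, hσ0, hσb⟩ := exists_boundary_defining_function (S := S)
  obtain ⟨ϑ, O, hO, hϑγ, hϑ⟩ := exists_boundary_angle hγ himm hinj hbd
  have hcpt : IsCompact (range γ) := isCompact_range hγ.continuous
  obtain ⟨T, hT, hTinj⟩ := InjOn.exists_mem_nhdsSet (f := fun x => (σ x, ϑ x)) (s := range γ) (by
      rintro _ ⟨z, rfl⟩ _ ⟨w, rfl⟩ h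
      have := (Prod.mk.inj h).2
      rw [(hϑγ z).2, (hϑγ w).2] at this
      rw [this]) hcpt (by
      rintro _ ⟨z, rfl⟩
      exact hσ.continuous.continuousAt.prodMk
        (hϑ.continuousOn.continuousAt (hO.mem_nhds (hϑγ z).1))) (by
      rintro _ ⟨z, rfl⟩
      obtain ⟨t, rfl⟩ := Circle.exp_surjective z
      obtain ⟨N, hN, -, hNinj, -⟩ :=
        exists_local_collar hγ himm hbd hσ hσ0 hσb hO hϑγ hϑ t univ_mem
      exact ⟨N, hN, hNinj⟩)
  obtain ⟨T', hT'o, hγT', hT'T⟩ := mem_nhdsSet_iff_exists.1 hT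
  set W' : Set S := W ∩ O ∩ T' with hW'
  have hW'o : IsOpen W' := (hW.inter hO).inter hT'o
  have hW'inj : InjOn (fun x => (σ x, ϑ x)) W' := hTinj.mono fun x hx => hT'T hx.2
  -- local inverses exist at each point of the circle, hence on a uniform collar
  have hloc : ∀ᶠ τ in 𝓝 (0 : ℝ), ∀ z ∈ (univ : Set Circle), ∃ V ∈ 𝓝 (τ, z), ∃ G : ℝ × Circle → S,
      ContMDiffOn (𝓘(ℝ, ℝ).prod (𝓡 1)) (𝓡∂ 2) ∞ G (V ∩ {y | y.1 ≤ 0}) ∧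
        ∀ y ∈ V, y.1 ≤ 0 → G y ∈ W' ∧ σ (G y) = -y.1 ∧ ϑ (G y) = y.2 := by
    refine isCompact_univ.eventually_forall_of_forall_eventually fun z _ => ?_
    obtain ⟨t, rfl⟩ := Circle.exp_surjective z
    obtain ⟨N, -, hNW, -, V, hV, G, hG, hGV⟩ := exists_local_collar hγ himm hbd hσ hσ0 hσb hO hϑγ hϑ t
      (hW'o.mem_nhds ⟨⟨hγW (Circle.exp t), (hϑγ _).1⟩, hγT' (mem_range_self _)⟩)
    filter_upwards [eventually_mem_nhds_iff.2 hV] with y hy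
    exact ⟨V, hy, G, hG, fun y' hy' h0 => ⟨hNW (hGV y' hy' h0).1, (hGV y' hy' h0).2⟩⟩
  obtain ⟨ε, hε, hball⟩ := Metric.eventually_nhds_iff.1 hloc
  have hloc' : ∀ τ ∈ Ioc (-ε) 0, ∀ z : Circle, ∃ V ∈ 𝓝 (τ, z), ∃ G : ℝ × Circle → S,
      ContMDiffOn (𝓘(ℝ, ℝ).prod (𝓡 1)) (𝓡∂ 2) ∞ G (V ∩ {y | y.1 ≤ 0}) ∧
        ∀ y ∈ V, y.1 ≤ 0 → G y ∈ W' ∧ σ (G y) = -y.1 ∧ ϑ (G y) = y.2 := by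
    intro τ hτ z
    refine hball ?_ z (mem_univ z)
    rw [Real.dist_eq, sub_zero, abs_lt]
    exact ⟨hτ.1, hτ.2.trans_lt hε⟩
  have hex : ∀ y : ℝ × Circle, y.1 ∈ Ioc (-ε) 0 → ∃ x ∈ W', σ x = -y.1 ∧ ϑ x = y.2 := by
    rintro ⟨τ, z⟩ hτ
    obtain ⟨V, hV, G, -, hGV⟩ := hloc' τ hτ z
    exact ⟨G (τ, z), hGV _ (mem_of_mem_nhds hV) hτ.2⟩
  have : Nonempty S := ⟨γ 1⟩
  choose! c hcW' hcσ hcϑ using hex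
  have hceq : ∀ y : ℝ × Circle, y.1 ∈ Ioc (-ε) 0 → ∀ x ∈ W', σ x = -y.1 → ϑ x = y.2 → c y = x := by
    intro y hy x hx h1 h2
    exact hW'inj (hcW' y hy) hx (Prod.ext ((hcσ y hy).trans h1.symm) ((hcϑ y hy).trans h2.symm))
  have himg : ∀ ε' ≤ ε, c '' (Ioc (-ε') 0 ×ˢ univ) = W' ∩ σ ⁻¹' (Iio ε') := by
    intro ε' hε'
    ext x
    constructor
    · rintro ⟨y, ⟨hy, -⟩, rfl⟩
      have hy' : y.1 ∈ Ioc (-ε) 0 := ⟨by linarith [hy.1], hy.2⟩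
      refine ⟨hcW' y hy', ?_⟩
      rw [mem_preimage, hcσ y hy', mem_Iio]
      linarith [hy.1]
    · rintro ⟨hx, hx'⟩
      have hx'' : σ x < ε' := hx'
      have h0 := hσ0 x
      exact ⟨(-σ x, ϑ x), ⟨⟨by simp only; linarith, by simp only; linarith⟩, mem_univ _⟩,
        hceq _ ⟨by simp only; linarith, by simp only; linarith⟩ x hx (by simp) rfl⟩
  refine ⟨ε, hε, c, fun x => (-σ x, ϑ x), fun z => ?_, ?_, fun ε' hε' => ?_, ?_, ?_, ?_⟩
  · exact hceq _ ⟨by simp [hε], le_refl (0 : ℝ)⟩ _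
      ⟨⟨hγW z, (hϑγ z).1⟩, hγT' (mem_range_self z)⟩ (by simp [(hσb _ (hbd z)).1]) (hϑγ z).2
  · rintro ⟨τ, z⟩ ⟨hτ, -⟩
    obtain ⟨V, hV, G, hG, hGV⟩ := hloc' τ hτ z
    have h1 : ContMDiffWithinAt (𝓘(ℝ, ℝ).prod (𝓡 1)) (𝓡∂ 2) ∞ G (Ioc (-ε) 0 ×ˢ univ) (τ, z) := by
      refine (hG (τ, z) ⟨mem_of_mem_nhds hV, hτ.2⟩).mono_of_mem_nhdsWithin ?_
      exact inter_mem (mem_nhdsWithin_of_mem_nhds hV)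
        (mem_of_superset self_mem_nhdsWithin fun y hy => hy.1.2)
    have hcG : ∀ y ∈ V, y.1 ∈ Ioc (-ε) 0 → c y = G y := fun y hy hy1 =>
      hceq y hy1 _ (hGV y hy hy1.2).1 (hGV y hy hy1.2).2.1 (hGV y hy hy1.2).2.2
    refine h1.congr_of_eventuallyEq ?_ (hcG _ (mem_of_mem_nhds hV) hτ)
    filter_upwards [self_mem_nhdsWithin, mem_nhdsWithin_of_mem_nhds hV] with y hy hyV
    exact hcG y hyV hy.1
  · rw [himg ε' hε'.2]
    exact hW'o.inter (isOpen_Iio.preimage hσ.continuous)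
  · rw [himg ε le_rfl]
    have h1 : ContMDiff (𝓡∂ 2) 𝓘(ℝ, ℝ) ∞ (fun x => -σ x) := contDiff_neg.contMDiff.comp hσ
    exact h1.contMDiffOn.prodMk (hϑ.mono fun x hx => hx.1.1.2)
  · rintro y ⟨hy, -⟩
    simp only [hcσ y hy, hcϑ y hy, neg_neg]
  · rintro y ⟨hy, -⟩
    exact (hcW' y hy).1.1

/-- Finitely many disjoint compact sets in a Hausdorff space have disjoint open neighbourhoods. -/
theorem exists_disjoint_open_nhds {X ι : Type*} [TopologicalSpace X] [T2Space X] [Finite ι]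
    {K : ι → Set X} (hK : ∀ i, IsCompact (K i)) (hd : ∀ i j, i ≠ j → Disjoint (K i) (K j)) :
    ∃ W : ι → Set X, (∀ i, IsOpen (W i)) ∧ (∀ i, K i ⊆ W i) ∧
      ∀ i j, i ≠ j → Disjoint (W i) (W j) := by
  have h : ∀ i j, ∃ A B : Set X, IsOpen A ∧ IsOpen B ∧
      (i ≠ j → K i ⊆ A ∧ K j ⊆ B ∧ Disjoint A B) := by
    intro i j
    by_cases hij : i = j
    · exact ⟨univ, univ, isOpen_univ, isOpen_univ, fun h => absurd hij h⟩
    · obtain ⟨A, B, hA, hB, h1, h2, h3⟩ := SeparatedNhds.of_isCompact_isCompact (hK i) (hK j) (hd i j hij)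
      exact ⟨A, B, hA, hB, fun _ => ⟨h1, h2, h3⟩⟩
  choose A B hA hB hAB using h
  -- for `j = i` the condition is void, so that all `j` can be intersected over
  refine ⟨fun i => ⋂ j, {x | i ≠ j → x ∈ A i j ∩ B j i}, fun i => isOpen_iInter_of_finite fun j => ?_,
    fun i x hx => mem_iInter.2 fun j hij => ⟨(hAB i j hij).1 hx, (hAB j i (Ne.symm hij)).2.1 hx⟩,
    fun i j hij => ?_⟩
  · by_cases hij : i = j
    · simp [hij]
    · simpa [hij] using! (hA i j).inter (hB j i)
  · rw [Set.disjoint_left]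
    intro x hx hy
    exact Set.disjoint_left.1 (hAB i j hij).2.2 (mem_iInter.1 hx j hij).1
      (mem_iInter.1 hy i (Ne.symm hij)).2

/-- Collar coordinates exist in each neighbourhood of the boundary. -/
theorem exists_isCollar [IsManifold (𝓡∂ 2) ∞ S] [CompactSpace S] [T2Space S] {k : ℕ}
    {γ : Fin k → Circle → S} (hγ : IsBoundaryCoordinates γ) {U : Set S}
    (hU : U ∈ 𝓝ˢ ((𝓡∂ 2).boundary S)) :
    ∃ (ε : ℝ) (c : Fin k → ℝ × Circle → S), IsCollar γ ε c ∧
      ∀ i, ∀ y ∈ Ioc (-ε) 0 ×ˢ univ, c i y ∈ U := by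
  have hbd : ∀ i z, γ i z ∈ (𝓡∂ 2).boundary S := fun i z => by
    rw [← hγ.iUnion_range]; exact mem_iUnion.2 ⟨i, mem_range_self z⟩
  obtain ⟨U', hU'o, hbU', hU'U⟩ := mem_nhdsSet_iff_exists.1 hU
  obtain ⟨W, hWo, hW, hWd⟩ := exists_disjoint_open_nhds (K := fun i => range (γ i))
    (fun i => isCompact_range (hγ.contMDiff i).continuous) (fun i j hij => by
      rw [Set.disjoint_left]
      rintro _ ⟨z, rfl⟩ ⟨w, hw⟩
      exact hij (hγ.injective j i w z hw).1.symm)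
  have h := fun i => exists_collar_of_circle (hγ.contMDiff i) (hγ.immersion i)
    (fun z w hzw => (hγ.injective i i z w hzw).2) (hbd i) (hU'o.inter (hWo i))
    (fun z => ⟨hbU' (hbd i z), hW i (mem_range_self z)⟩)
  choose e he c d hc0 hcsm hcopen hdsm hdc hcW using h
  obtain ⟨ε, hε, hεe⟩ : ∃ ε > 0, ∀ i, ε ≤ e i := by
    have h1 : ∀ᶠ ε in 𝓝[>] (0 : ℝ), ∀ i, ε ≤ e i :=
      eventually_all.2 fun i => mem_of_superset (Ioc_mem_nhdsGT (he i)) fun x hx => hx.2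
    obtain ⟨ε, h2, h3⟩ := (h1.and self_mem_nhdsWithin).exists
    exact ⟨ε, h3, h2⟩
  have hsub : ∀ i, Ioc (-ε) 0 ×ˢ (univ : Set Circle) ⊆ Ioc (-e i) 0 ×ˢ univ := fun i =>
    prod_mono_left (Ioc_subset_Ioc_left (by linarith [hεe i]))
  refine ⟨ε, c, ⟨hε, hc0, fun i => (hcsm i).mono (hsub i), fun i => hcopen i ε ⟨hε, hεe i⟩,
    fun i => ⟨d i, (hdsm i).mono (image_mono (hsub i)), fun y hy => hdc i y (hsub i hy)⟩, ?_⟩,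
    fun i y hy => hU'U (hcW i y (hsub i hy)).1⟩
  intro i j hij
  refine (hWd i j hij).mono ?_ ?_
  · rintro _ ⟨y, hy, rfl⟩; exact (hcW i y (hsub i hy)).2
  · rintro _ ⟨y, hy, rfl⟩; exact (hcW j y (hsub j hy)).2

end Collar

/-! ### Local diffeomorphisms -/

section LocalDiffeo

variable {E₁ E₂ E₃ E₄ H₁ H₂ H₃ H₄ M₁ M₂ M₃ M₄ : Type*}
  [NormedAddCommGroup E₁] [NormedSpace ℝ E₁] [TopologicalSpace H₁] {I₁ : ModelWithCorners ℝ E₁ H₁}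
  [TopologicalSpace M₁] [ChartedSpace H₁ M₁]
  [NormedAddCommGroup E₂] [NormedSpace ℝ E₂] [TopologicalSpace H₂] {I₂ : ModelWithCorners ℝ E₂ H₂}
  [TopologicalSpace M₂] [ChartedSpace H₂ M₂]
  [NormedAddCommGroup E₃] [NormedSpace ℝ E₃] [TopologicalSpace H₃] {I₃ : ModelWithCorners ℝ E₃ H₃}
  [TopologicalSpace M₃] [ChartedSpace H₃ M₃]
  [NormedAddCommGroup E₄] [NormedSpace ℝ E₄] [TopologicalSpace H₄] {I₄ : ModelWithCorners ℝ E₄ H₄}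
  [TopologicalSpace M₄] [ChartedSpace H₄ M₄]

/-- A partial homeomorphism that is smooth in both directions gives local diffeomorphisms. -/
theorem OpenPartialHomeomorph.isLocalDiffeomorphAt (e : OpenPartialHomeomorph M₁ M₂)
    (h : ContMDiffOn I₁ I₂ ∞ e e.source) (h' : ContMDiffOn I₂ I₁ ∞ e.symm e.target) {x : M₁}
    (hx : x ∈ e.source) : IsLocalDiffeomorphAt I₁ I₂ ∞ e x :=
  ⟨{ e.toPartialEquiv with
      open_source := e.open_source
      open_target := e.open_target
      contMDiffOn_toFun := h
      contMDiffOn_invFun := h' }, hx, fun _ _ => rfl⟩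

theorem IsLocalDiffeomorphAt.congr_of_eventuallyEq {f g : M₁ → M₂} {x : M₁}
    (hf : IsLocalDiffeomorphAt I₁ I₂ ∞ f x) (h : g =ᶠ[𝓝 x] f) :
    IsLocalDiffeomorphAt I₁ I₂ ∞ g x := by
  obtain ⟨Φ, hx, hΦ⟩ := hf
  obtain ⟨U, hU, hUo, hxU⟩ := eventually_nhds_iff.1 h
  set e := Φ.toOpenPartialHomeomorph.restrOpen U hUo with he
  have hsub : e.source ⊆ Φ.source := fun y hy => hy.1
  refine ⟨{ e.toPartialEquiv with
      open_source := e.open_source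
      open_target := e.open_target
      contMDiffOn_toFun := Φ.contMDiffOn_toFun.mono hsub
      contMDiffOn_invFun := Φ.contMDiffOn_invFun.mono fun y hy => hy.1 }, ⟨hx, hxU⟩, fun y hy => ?_⟩
  have hy' : y ∈ Φ.source ∩ U := hy
  exact (hU y hy'.2).trans (hΦ hy'.1)

theorem IsLocalDiffeomorphAt.prodMap {f : M₁ → M₂} {g : M₃ → M₄} {x : M₁} {y : M₃}
    (hf : IsLocalDiffeomorphAt I₁ I₂ ∞ f x) (hg : IsLocalDiffeomorphAt I₃ I₄ ∞ g y) :
    IsLocalDiffeomorphAt (I₁.prod I₃) (I₂.prod I₄) ∞ (Prod.map f g) (x, y) := by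
  obtain ⟨Φ, hx, hΦ⟩ := hf
  obtain ⟨Ψ, hy, hΨ⟩ := hg
  set e := Φ.toOpenPartialHomeomorph.prod Ψ.toOpenPartialHomeomorph with he
  refine ⟨{ e.toPartialEquiv with
      open_source := e.open_source
      open_target := e.open_target
      contMDiffOn_toFun := Φ.contMDiffOn_toFun.prodMap Ψ.contMDiffOn_toFun
      contMDiffOn_invFun := Φ.contMDiffOn_invFun.prodMap Ψ.contMDiffOn_invFun }, ⟨hx, hy⟩, ?_⟩
  rintro ⟨a, b⟩ ⟨ha, hb⟩
  exact Prod.ext (hΦ ha) (hΨ hb)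

theorem IsLocalDiffeomorphAt.contMDiffAt_of_comp {f : M₁ → M₂} {g : M₂ → M₃} {x : M₁}
    (hf : IsLocalDiffeomorphAt I₁ I₂ ∞ f x) (hg : ContMDiffAt I₁ I₃ ∞ (g ∘ f) x) :
    ContMDiffAt I₂ I₃ ∞ g (f x) := by
  have h1 := hf.localInverse_contMDiffAt
  have h2 : hf.localInverse (f x) = x := hf.localInverse_left_inv hf.localInverse_mem_target
  have h3 : ContMDiffAt I₂ I₃ ∞ ((g ∘ f) ∘ hf.localInverse) (f x) :=
    ContMDiffAt.comp (f x) (by rw [h2]; exact hg) h1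
  refine h3.congr_of_eventuallyEq ?_
  filter_upwards [hf.localInverse_eventuallyEq_right] with y hy
  exact congrArg g hy.symm

/-- A local diffeomorphism factors through another one with the same local image. -/
theorem IsLocalDiffeomorphAt.of_comp {f : M₁ → M₂} {g : M₂ → M₃} {x : M₁}
    (hf : IsLocalDiffeomorphAt I₁ I₂ ∞ f x) (hg : IsLocalDiffeomorphAt I₁ I₃ ∞ (g ∘ f) x) :
    IsLocalDiffeomorphAt I₂ I₃ ∞ g (f x) := by
  have h2 : hf.localInverse (f x) = x := hf.localInverse_left_inv hf.localInverse_mem_target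
  have h3 : IsLocalDiffeomorphAt I₂ I₃ ∞ ((g ∘ f) ∘ hf.localInverse) (f x) :=
    IsLocalDiffeomorphAt.comp I₃ M₃ hf.localInverse_isLocalDiffeomorphAt (by rw [h2]; exact hg)
  refine h3.congr_of_eventuallyEq ?_
  filter_upwards [hf.localInverse_eventuallyEq_right] with y hy
  exact congrArg g hy.symm

end LocalDiffeo

section Glue

variable {E : Type*} [NormedAddCommGroup E] [NormedSpace ℝ E] {M : Type*} [TopologicalSpace M]

/-- Local parametrizations of a topological space by open subsets of a normed space, with smooth
coordinate changes, define a smooth structure. -/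
theorem exists_isManifold_of_parametrizations {J : Type*} {Ω : J → Set E} {f : J → E → M}
    (hΩ : ∀ j, IsOpen (Ω j)) (hc : ∀ j, ContinuousOn (f j) (Ω j))
    (ho : ∀ j, ∀ U ⊆ Ω j, IsOpen U → IsOpen (f j '' U))
    (hinj : ∀ j, ∀ x ∈ Ω j, ∃ U ∈ 𝓝 x, InjOn (f j) U)
    (hcov : ∀ m, ∃ j, ∃ x ∈ Ω j, f j x = m)
    (hcompat : ∀ j j', ∀ x ∈ Ω j, ∀ y ∈ Ω j', f j x = f j' y → ∃ g : E → E,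
      ContDiffAt ℝ ∞ g x ∧ g x = y ∧ ∀ᶠ x' in 𝓝 x, f j' (g x') = f j x') :
    ∃ (_ : ChartedSpace E M) (_ : IsManifold 𝓘(ℝ, E) ∞ M),
      ∀ j, IsLocalDiffeomorphOn 𝓘(ℝ, E) 𝓘(ℝ, E) ∞ (f j) (Ω j) := by
  have hex : ∀ j, ∀ x ∈ Ω j, ∃ e : OpenPartialHomeomorph E M,
      x ∈ e.source ∧ e.source ⊆ Ω j ∧ EqOn e (f j) e.source := by
    intro j x hx
    obtain ⟨U, hU, hUinj⟩ := hinj j x hx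
    obtain ⟨V, hVU, hVo, hxV⟩ := mem_nhds_iff.1 (inter_mem hU ((hΩ j).mem_nhds hx))
    have hVinj : InjOn (f j) V := hUinj.mono fun y hy => (hVU hy).1
    have hVΩ : V ⊆ Ω j := fun y hy => (hVU hy).2
    refine ⟨OpenPartialHomeomorph.ofContinuousOpenRestrict (hVinj.toPartialEquiv (f j) V)
      ((hc j).mono hVΩ) ?_ hVo, hxV, hVΩ, fun y _ => rfl⟩
    intro O hO
    obtain ⟨O', hO', rfl⟩ := isOpen_induced_iff.1 hO
    have : V.domRestrict (f j) '' (Subtype.val ⁻¹' O') = f j '' (V ∩ O') := by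
      rw [domRestrict_eq, image_comp, Subtype.image_preimage_coe]
    exact this ▸ ho j _ (fun y hy => hVΩ hy.1) (hVo.inter hO')
  choose j₀ x₀ hx₀ hf₀ using hcov
  let A : Set (OpenPartialHomeomorph M E) :=
    {e | ∃ j, e.target ⊆ Ω j ∧ EqOn e.symm (f j) e.target}
  let cs : ChartedSpace E M :=
    { atlas := A
      chartAt := fun m => (hex (j₀ m) (x₀ m) (hx₀ m)).choose.symm
      mem_chart_source := fun m => by
        obtain ⟨h1, -, h3⟩ := (hex (j₀ m) (x₀ m) (hx₀ m)).choose_spec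
        have := OpenPartialHomeomorph.map_source _ h1
        rwa [h3 h1, hf₀] at this
      chart_mem_atlas := fun m => by
        obtain ⟨h1, h2, h3⟩ := (hex (j₀ m) (x₀ m) (hx₀ m)).choose_spec
        exact ⟨j₀ m, h2, h3⟩ }
  have hman : IsManifold 𝓘(ℝ, E) ∞ M := by
    refine isManifold_of_contDiffOn 𝓘(ℝ, E) ∞ M ?_
    rintro e e' ⟨j, he, hej⟩ ⟨j', he', hej'⟩
    simp only [modelWithCornersSelf_coe, modelWithCornersSelf_coe_symm, Function.id_comp,
      Function.comp_id, preimage_id, range_id, inter_univ]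
    intro x hx
    rw [OpenPartialHomeomorph.trans_source, OpenPartialHomeomorph.symm_source] at hx
    have hy : e' (e.symm x) ∈ e'.target := e'.map_source hx.2
    have h1 : f j x = f j' (e' (e.symm x)) := by
      rw [← hej hx.1, ← hej' hy, e'.left_inv hx.2]
    obtain ⟨g, hg, hgx, hgf⟩ := hcompat j j' x (he hx.1) _ (he' hy) h1
    refine (hg.congr_of_eventuallyEq ?_).contDiffWithinAt
    have h2 := hg.continuousAt.preimage_mem_nhds (by rw [hgx]; exact e'.open_target.mem_nhds hy)
    filter_upwards [hgf, h2, e.open_target.mem_nhds hx.1] with x' h3 h4 h5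
    change e' (e.symm x') = g x'
    rw [hej h5, ← h3, ← hej' h4, e'.right_inv h4]
  refine ⟨cs, hman, fun j x => ?_⟩
  obtain ⟨e, hxe, heΩ, hef⟩ := hex j x x.2
  have hmem : e.symm ∈ IsManifold.maximalAtlas 𝓘(ℝ, E) ∞ M :=
    IsManifold.subset_maximalAtlas ⟨j, heΩ, hef⟩
  have h1 := contMDiffOn_symm_of_mem_maximalAtlas hmem
  have h2 := contMDiffOn_of_mem_maximalAtlas hmem
  exact (e.isLocalDiffeomorphAt (I₁ := 𝓘(ℝ, E)) (I₂ := 𝓘(ℝ, E)) h1 h2 hxe).congr_of_eventuallyEq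
    (by filter_upwards [e.open_source.mem_nhds hxe] with y hy using (hef hy).symm)

end Glue

/-! ### Points of the cut -/

section Cut

variable {S : Type u} [TopologicalSpace S] [ChartedSpace (EuclideanHalfSpace 2) S]

/-- The data of the cut: boundary coordinates `γ` of the surface and collars of width `ε` extending
them, on which the monodromy `ψ` is the identity. -/
structure IsCutCollar (ψ : Diffeomorph (𝓡∂ 2) (𝓡∂ 2) S S ∞) {k : ℕ} (γ : Fin k → Circle → S) (ε : ℝ)
    (c : Fin k → ℝ × Circle → S) : Prop where
  coordinates : IsBoundaryCoordinates γ
  collar : IsCollar γ ε c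
  fix : ∀ i, ∀ y ∈ Ioc (-ε) 0 ×ˢ univ, ψ (c i y) = c i y

/-- The `n`-th iterate of a diffeomorphism, `n ∈ ℤ`. -/
noncomputable def iter (ψ : Diffeomorph (𝓡∂ 2) (𝓡∂ 2) S S ∞) (n : ℤ) (x : S) : S :=
  ((ψ.toEquiv : Equiv.Perm S) ^ n) x

section Iter

variable (ψ : Diffeomorph (𝓡∂ 2) (𝓡∂ 2) S S ∞)

@[simp] theorem iter_zero (x : S) : iter ψ 0 x = x := rfl

@[simp] theorem iter_one (x : S) : iter ψ 1 x = ψ x := by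
  rw [iter, zpow_one]; rfl

theorem iter_add (m n : ℤ) (x : S) : iter ψ (m + n) x = iter ψ m (iter ψ n x) := by
  rw [iter, zpow_add]; rfl

@[simp] theorem iter_neg_iter (n : ℤ) (x : S) : iter ψ (-n) (iter ψ n x) = x := by
  rw [← iter_add, neg_add_cancel, iter_zero]

@[simp] theorem iter_iter_neg (n : ℤ) (x : S) : iter ψ n (iter ψ (-n) x) = x := by
  rw [← iter_add, add_neg_cancel, iter_zero]

theorem iter_of_fixed {x : S} (hx : ψ x = x) (n : ℤ) : iter ψ n x = x :=
  Equiv.Perm.zpow_apply_eq_self_of_apply_eq_self (f := (ψ.toEquiv : Equiv.Perm S)) hx n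

theorem contMDiff_iter (n : ℤ) : ContMDiff (𝓡∂ 2) (𝓡∂ 2) ∞ (iter ψ n) := by
  have h1 : ∀ n : ℕ, ContMDiff (𝓡∂ 2) (𝓡∂ 2) ∞ (iter ψ n) := by
    intro n
    induction n with
    | zero => exact contMDiff_id
    | succ n ih =>
      have : iter ψ ((n + 1 : ℕ) : ℤ) = iter ψ n ∘ ψ := by
        ext x; rw [Nat.cast_succ, iter_add, iter_one]; rfl
      rw [this]; exact ih.comp ψ.contMDiff
  have hsymm : ∀ x, iter ψ (-1) x = ψ.symm x := fun x => by
    have h : ψ (iter ψ (-1) x) = ψ (ψ.symm x) := by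
      rw [← iter_one ψ (iter ψ (-1) x), iter_iter_neg, ψ.apply_symm_apply]
    exact ψ.injective h
  have h2 : ∀ n : ℕ, ContMDiff (𝓡∂ 2) (𝓡∂ 2) ∞ (iter ψ (-n)) := by
    intro n
    induction n with
    | zero => exact contMDiff_id
    | succ n ih =>
      have : iter ψ (-((n + 1 : ℕ) : ℤ)) = iter ψ (-n) ∘ ψ.symm := by
        ext x; rw [Nat.cast_succ, neg_add, iter_add, hsymm]; rfl
      rw [this]; exact ih.comp ψ.symm.contMDiff
  obtain ⟨m, rfl | rfl⟩ := n.eq_nat_or_neg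
  · exact h1 m
  · exact h2 m

theorem iter_mem_interior_iff [IsManifold (𝓡∂ 2) ∞ S] (n : ℤ) (x : S) :
    iter ψ n x ∈ (𝓡∂ 2).interior S ↔ x ∈ (𝓡∂ 2).interior S := by
  let e : Diffeomorph (𝓡∂ 2) (𝓡∂ 2) S S ∞ :=
    { toEquiv := (ψ.toEquiv : Equiv.Perm S) ^ n
      contMDiff_toFun := contMDiff_iter ψ n
      contMDiff_invFun := by
        have := contMDiff_iter ψ (-n)
        have h : iter ψ (-n) = ((ψ.toEquiv : Equiv.Perm S) ^ n).symm := by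
          ext x
          rw [Equiv.eq_symm_apply]
          exact iter_iter_neg ψ n x
        rw [h] at this
        exact this }
  have h := e.preimage_interior (by simp)
  exact Set.ext_iff.1 h x

end Iter

variable {ψ : Diffeomorph (𝓡∂ 2) (𝓡∂ 2) S S ∞} {k : ℕ} {γ : Fin k → Circle → S} {h : Fin k → ℤ}
  {ε : ℝ} {c : Fin k → ℝ × Circle → S}

theorem mem_boundary_iff_notMem_interior {x : S} :
    x ∈ (𝓡∂ 2).boundary S ↔ x ∉ (𝓡∂ 2).interior S := by
  rw [← (𝓡∂ 2).compl_interior, mem_compl_iff]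

theorem IsBoundaryCoordinates.mem_boundary (hγ : IsBoundaryCoordinates γ) (i : Fin k) (z : Circle) :
    γ i z ∈ (𝓡∂ 2).boundary S := by
  rw [← hγ.iUnion_range]; exact mem_iUnion.2 ⟨i, mem_range_self z⟩

theorem IsBoundaryCoordinates.exists_eq (hγ : IsBoundaryCoordinates γ) {x : S}
    (hx : x ∈ (𝓡∂ 2).boundary S) : ∃ i z, γ i z = x := by
  rw [← hγ.iUnion_range] at hx
  obtain ⟨i, z, rfl⟩ := mem_iUnion.1 hx
  exact ⟨i, z, rfl⟩

namespace IsCollar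

theorem injective (hc : IsCollar γ ε c) {i j : Fin k} {y y' : ℝ × Circle} (hy : y.1 ∈ Ioc (-ε) 0)
    (hy' : y'.1 ∈ Ioc (-ε) 0) (heq : c i y = c j y') : i = j ∧ y = y' := by
  have hij : i = j := by
    by_contra hij
    refine Set.disjoint_left.1 (hc.disjoint i j hij) ⟨y, ⟨hy, mem_univ _⟩, rfl⟩ ?_
    rw [heq]; exact ⟨y', ⟨hy', mem_univ _⟩, rfl⟩
  subst hij
  obtain ⟨d, -, hd⟩ := hc.smooth_inverse i
  exact ⟨rfl, by rw [← hd y ⟨hy, mem_univ _⟩, heq, hd y' ⟨hy', mem_univ _⟩]⟩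

theorem zero_mem (hc : IsCollar γ ε c) : (0 : ℝ) ∈ Ioc (-ε) 0 := ⟨by linarith [hc.pos], le_rfl⟩

theorem mem_boundary_iff (hc : IsCollar γ ε c) (hγ : IsBoundaryCoordinates γ) {i : Fin k}
    {y : ℝ × Circle} (hy : y.1 ∈ Ioc (-ε) 0) : c i y ∈ (𝓡∂ 2).boundary S ↔ y.1 = 0 := by
  constructor
  · intro h
    obtain ⟨j, z, hz⟩ := hγ.exists_eq h
    rw [← hc.boundary] at hz
    rw [(hc.injective hc.zero_mem hy hz).2.symm]
  · intro h
    have : y = (0, y.2) := Prod.ext h rfl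
    rw [this, hc.boundary]
    exact hγ.mem_boundary i _

theorem mem_interior (hc : IsCollar γ ε c) (hγ : IsBoundaryCoordinates γ) {i : Fin k}
    {τ : ℝ} {w : Circle} (hy : τ ∈ Ioo (-ε) 0) : c i (τ, w) ∈ (𝓡∂ 2).interior S := by
  by_contra h
  have := (hc.mem_boundary_iff hγ (y := (τ, w)) ⟨hy.1, hy.2.le⟩).1 (mem_boundary_iff_notMem_interior.2 h)
  exact hy.2.ne this

end IsCollar

namespace IsCutCollar

variable (H : IsCutCollar ψ γ ε c)
include H

theorem fix_boundary (i : Fin k) (z : Circle) : ψ (γ i z) = γ i z := by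
  have := H.fix i (0, z) ⟨H.collar.zero_mem, mem_univ _⟩
  rwa [H.collar.boundary] at this

theorem iter_collar (n : ℤ) {i : Fin k} {y : ℝ × Circle} (hy : y.1 ∈ Ioc (-ε) 0) :
    iter ψ n (c i y) = c i y :=
  iter_of_fixed ψ (H.fix i y ⟨hy, mem_univ _⟩) n

theorem iter_boundary (n : ℤ) {x : S} (hx : x ∈ (𝓡∂ 2).boundary S) : iter ψ n x = x := by
  obtain ⟨i, z, rfl⟩ := H.coordinates.exists_eq hx
  exact iter_of_fixed ψ (H.fix_boundary i z) n

end IsCutCollar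

/-- The relation on `S × ℝ` that defines the cut: `b` is the image of `a` under an iterate of the
deck transformation `(x, s + 2π) ↦ (ψ x, s)`, or `a` and `b` lie over a boundary circle, on the same
orbit of the flow of `∂_s - h_i ∂_θ`. -/
def cutRel (ψ : Diffeomorph (𝓡∂ 2) (𝓡∂ 2) S S ∞) (γ : Fin k → Circle → S) (h : Fin k → ℤ)
    (a b : S × ℝ) : Prop :=
  (∃ n : ℤ, b.1 = iter ψ n a.1 ∧ a.2 = b.2 + n * (2 * π)) ∨
    ∃ (i : Fin k) (z : Circle), a.1 = γ i z ∧ b.1 = γ i (z * Circle.exp (-(h i : ℝ) * (b.2 - a.2)))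

theorem circle_exp_int_mul (m n : ℤ) : Circle.exp (m * (n * (2 * π))) = 1 := by
  have : (m : ℝ) * (n * (2 * π)) = ((m * n : ℤ) : ℝ) * (2 * π) := by push_cast; ring
  rw [this, Circle.exp_int_mul_two_pi]

theorem MappingTorus.mk_iter (ψ : Diffeomorph (𝓡∂ 2) (𝓡∂ 2) S S ∞) (n : ℤ) (x : S) (s : ℝ) :
    MappingTorus.mk ψ (iter ψ n x, s) = MappingTorus.mk ψ (x, s + n * (2 * π)) := by
  have hnat : ∀ (n : ℕ) x s, MappingTorus.mk ψ (x, s + n * (2 * π)) =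
      MappingTorus.mk ψ (iter ψ n x, s) := by
    intro n
    induction n with
    | zero => intro x s; simp
    | succ n ih =>
      intro x s
      rw [Nat.cast_succ, Nat.cast_succ, iter_add, iter_one,
        show s + (n + 1 : ℝ) * (2 * π) = s + n * (2 * π) + 2 * π by ring, ← ih]
      exact Quot.sound ⟨x, _, rfl, rfl⟩
  obtain ⟨m, rfl | rfl⟩ := n.eq_nat_or_neg
  · exact (hnat m x s).symm
  · have := hnat m (iter ψ (-m) x) (s + ((-m : ℤ) : ℝ) * (2 * π))
    rw [iter_iter_neg] at this
    rw [← this]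
    congr 2
    push_cast; ring

section MkEq

variable (H : IsCutCollar ψ γ ε c)
include H

/-- The two kinds of identification compose, as `ψ` is the identity on the boundary and the orbits
on the boundary tori are closed: the `h_i` are integers. -/
theorem equivalence_cutRel : Equivalence (cutRel ψ γ h) where
  refl a := Or.inl ⟨0, by simp⟩
  symm := by
    rintro ⟨x, s⟩ ⟨x', s'⟩ (⟨n, h1, h2⟩ | ⟨i, z, h1, h2⟩)
    · refine Or.inl ⟨-n, ?_, ?_⟩
      · simp only at h1 ⊢; rw [h1, iter_neg_iter]
      · simp only at h2 ⊢; push_cast; rw [h2]; ring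
    · refine Or.inr ⟨i, _, h2, ?_⟩
      simp only at h1 ⊢
      rw [h1, mul_assoc, ← Circle.exp_add]
      ring_nf; simp
  trans := by
    rintro ⟨x, s⟩ ⟨x', s'⟩ ⟨x'', s''⟩ (⟨n, h1, h2⟩ | ⟨i, z, h1, h2⟩) (⟨m, h3, h4⟩ | ⟨j, w, h3, h4⟩)
    · refine Or.inl ⟨m + n, ?_, ?_⟩
      · simp only at h1 h3 ⊢; rw [h3, h1, iter_add]
      · simp only at h2 h4 ⊢; push_cast; rw [h2, h4]; ring
    · simp only at h1 h2 h3 h4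
      have hx : x = γ j w := by
        rw [← iter_neg_iter ψ n x, ← h1, h3, iter_of_fixed ψ (H.fix_boundary j w)]
      refine Or.inr ⟨j, w, hx, ?_⟩
      simp only
      rw [h4, h2]
      congr 2
      rw [show -(h j : ℝ) * (s'' - (s' + n * (2 * π))) =
        -(h j : ℝ) * (s'' - s') + (h j) * (n * (2 * π)) by ring, Circle.exp_add,
        circle_exp_int_mul, mul_one]
    · simp only at h1 h2 h3 h4
      refine Or.inr ⟨i, z, h1, ?_⟩
      simp only
      rw [h3, h2, iter_of_fixed ψ (H.fix_boundary i _), h4]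
      congr 2
      rw [show -(h i : ℝ) * (s'' + m * (2 * π) - s) =
        -(h i : ℝ) * (s'' - s) + ((-h i : ℤ) : ℝ) * (m * (2 * π)) by push_cast; ring, Circle.exp_add,
        circle_exp_int_mul, mul_one]
    · simp only at h1 h2 h3 h4
      obtain ⟨rfl, hw⟩ := H.coordinates.injective _ _ _ _ (h2.symm.trans h3)
      refine Or.inr ⟨i, z, h1, ?_⟩
      simp only
      rw [h4, ← hw, mul_assoc, ← Circle.exp_add]
      ring_nf

/-- The iterated quotient in the definition of `OpenBookCut` is the quotient by `cutRel`. -/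
theorem OpenBookCut.mk_eq_mk_iff {a b : S × ℝ} :
    OpenBookCut.mk ψ γ h a = OpenBookCut.mk ψ γ h b ↔ cutRel ψ γ h a b := by
  have E := equivalence_cutRel (h := h) H
  constructor
  · intro hab
    let st : Setoid (S × ℝ) := ⟨cutRel ψ γ h, E⟩
    let f1 : MappingTorus ψ → Quotient st := Quot.lift (Quotient.mk st) (by
      rintro _ _ ⟨x, s, rfl, rfl⟩
      exact Quotient.sound (Or.inl ⟨1, by simp, by simp⟩))
    let f2 : OpenBookCut ψ γ h → Quotient st := Quot.lift f1 (by
      rintro _ _ ⟨i, z, s, t, rfl, rfl⟩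
      exact Quotient.sound (Or.inr ⟨i, z, rfl, by simp⟩))
    have h1 : f2 (OpenBookCut.mk ψ γ h a) = f2 (OpenBookCut.mk ψ γ h b) := by rw [hab]
    exact Quotient.exact h1
  · rintro (⟨n, h1, h2⟩ | ⟨i, z, h1, h2⟩)
    · obtain ⟨x, s⟩ := a
      obtain ⟨x', s'⟩ := b
      simp only at h1 h2
      rw [h2, h1]
      exact congrArg (OpenBookCut.proj ψ γ h) (MappingTorus.mk_iter ψ n x s').symm
    · obtain ⟨x, s⟩ := a
      obtain ⟨x', s'⟩ := b
      simp only at h1 h2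
      refine Quot.sound ⟨i, z, s, s' - s, by rw [h1], ?_⟩
      rw [h2, add_sub_cancel]

theorem OpenBookCut.mk_eq_mk_iff_of_interior {a b : S × ℝ} (ha : a.1 ∈ (𝓡∂ 2).interior S) :
    OpenBookCut.mk ψ γ h a = OpenBookCut.mk ψ γ h b ↔
      ∃ n : ℤ, b.1 = iter ψ n a.1 ∧ a.2 = b.2 + n * (2 * π) := by
  rw [OpenBookCut.mk_eq_mk_iff H]
  refine ⟨fun hab => hab.resolve_right ?_, Or.inl⟩
  rintro ⟨i, z, h1, -⟩
  exact mem_boundary_iff_notMem_interior.1 (h1 ▸ H.coordinates.mem_boundary i z) ha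

theorem OpenBookCut.mk_iter (n : ℤ) (x : S) (s : ℝ) :
    OpenBookCut.mk ψ γ h (iter ψ n x, s) = OpenBookCut.mk ψ γ h (x, s + n * (2 * π)) :=
  ((OpenBookCut.mk_eq_mk_iff H).2 (Or.inl ⟨n, rfl, rfl⟩)).symm

theorem OpenBookCut.mk_boundary (i : Fin k) (z : Circle) (s t : ℝ) :
    OpenBookCut.mk ψ γ h (γ i (z * Circle.exp (-(h i : ℝ) * t)), s + t) =
      OpenBookCut.mk ψ γ h (γ i z, s) :=
  ((OpenBookCut.mk_eq_mk_iff H).2 (Or.inr ⟨i, z, rfl, by simp⟩)).symm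

/-- On a fixed page two different points are not identified. -/
theorem OpenBookCut.mk_page_injective {x x' : S} {s : ℝ}
    (hx : OpenBookCut.mk ψ γ h (x, s) = OpenBookCut.mk ψ γ h (x', s)) : x = x' := by
  rcases (OpenBookCut.mk_eq_mk_iff H).1 hx with ⟨n, h1, h2⟩ | ⟨i, z, h1, h2⟩
  · have h3 : (n : ℝ) * (2 * π) = 0 := by simpa using h2
    have h4 : n = 0 := by
      rcases mul_eq_zero.1 h3 with h5 | h5
      · exact_mod_cast h5
      · exact absurd h5 Real.two_pi_pos.ne'
    rw [h4] at h1
    exact h1.symm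
  · simp only [sub_self, mul_zero, Circle.exp_zero, mul_one] at h1 h2
    rw [h1, h2]

theorem IsCutCollar.mem_interior_iff_of_mk_eq [IsManifold (𝓡∂ 2) ∞ S] {a b : S × ℝ}
    (hab : OpenBookCut.mk ψ γ h a = OpenBookCut.mk ψ γ h b) :
    a.1 ∈ (𝓡∂ 2).interior S ↔ b.1 ∈ (𝓡∂ 2).interior S := by
  rcases (OpenBookCut.mk_eq_mk_iff H).1 hab with ⟨n, h1, -⟩ | ⟨i, z, h1, h2⟩
  · rw [h1, iter_mem_interior_iff]
  · rw [h1, h2]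
    have h3 := mem_boundary_iff_notMem_interior.1 (H.coordinates.mem_boundary i z)
    have h4 := mem_boundary_iff_notMem_interior.1
      (H.coordinates.mem_boundary i (z * Circle.exp (-(h i : ℝ) * (b.2 - a.2))))
    exact ⟨fun h => absurd h h3, fun h => absurd h h4⟩

/-- In the definition of `OpenBookCut.tube` any angle of the disc coordinate can be used. -/
theorem OpenBookCut.tube_eq {i : Fin k} {b : Circle} {ρ : ℝ} (hρ : 0 ≤ ρ) (hρε : ρ ^ 2 < ε) (s : ℝ) :
    OpenBookCut.tube ψ γ h c i (b, ρ * (Circle.exp s : ℂ)) =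
      OpenBookCut.mk ψ γ h (c i (-ρ ^ 2, b * Circle.exp (-(h i : ℝ) * s)), s) := by
  have hn : ‖(ρ * (Circle.exp s : ℂ) : ℂ)‖ = ρ := by
    rw [norm_mul, Circle.norm_coe, mul_one, Complex.norm_real, Real.norm_of_nonneg hρ]
  rw [OpenBookCut.tube]
  simp only [hn]
  set t := Complex.arg (ρ * (Circle.exp s : ℂ)) with ht
  -- at the core the angles differ by the boundary identification, elsewhere by a multiple of `2π`
  rcases hρ.eq_or_lt with h0 | h0
  · have h1 : (-ρ ^ 2 : ℝ) = 0 := by rw [← h0]; ring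
    rw [h1, H.collar.boundary, H.collar.boundary]
    have := OpenBookCut.mk_boundary (h := h) H i (b * Circle.exp (-(h i : ℝ) * t)) t (s - t)
    rw [← this, mul_assoc, ← Circle.exp_add]
    ring_nf
  · have h1 : Circle.exp t = Circle.exp s := by
      rw [ht, Complex.arg_real_mul _ h0, Circle.exp_arg]
    obtain ⟨n, hn⟩ := Circle.exp_eq_exp.1 h1
    refine (OpenBookCut.mk_eq_mk_iff H).2 (Or.inl ⟨n, ?_, hn⟩)
    have hmem : (-ρ ^ 2 : ℝ) ∈ Ioc (-ε) 0 := ⟨by linarith, by nlinarith⟩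
    simp only
    rw [H.iter_collar n hmem, hn,
      show -(h i : ℝ) * (s + n * (2 * π)) = -(h i : ℝ) * s + ((-h i : ℤ) : ℝ) * (n * (2 * π)) by
        push_cast; ring, Circle.exp_add, circle_exp_int_mul, mul_one]

/-- The inverse of the polar coordinates in `OpenBookCut.tube`, which is defined on the whole
collar, the boundary included. -/
theorem OpenBookCut.mk_collar_eq_tube {i : Fin k} {τ : ℝ} {w : Circle} (hτ : τ ∈ Ioc (-ε) 0) (s : ℝ) :
    OpenBookCut.mk ψ γ h (c i (τ, w), s) =
      OpenBookCut.tube ψ γ h c i (w * Circle.exp (h i * s), √(-τ) * (Circle.exp s : ℂ)) := by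
  have h1 : √(-τ) ^ 2 = -τ := Real.sq_sqrt (by linarith [hτ.2])
  rw [OpenBookCut.tube_eq H (Real.sqrt_nonneg _) (by rw [h1]; linarith [hτ.1]), h1, neg_neg,
    mul_assoc, ← Circle.exp_add]
  ring_nf; simp

end MkEq

end Cut

/-! ### Topology of the cut -/

section CutTopology

variable {S : Type u} [TopologicalSpace S] [ChartedSpace (EuclideanHalfSpace 2) S]
  {ψ : Diffeomorph (𝓡∂ 2) (𝓡∂ 2) S S ∞} {k : ℕ} {γ : Fin k → Circle → S} {h : Fin k → ℤ}
  {ε : ℝ} {c : Fin k → ℝ × Circle → S}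

theorem OpenBookCut.isQuotientMap_mk : IsQuotientMap (OpenBookCut.mk ψ γ h) :=
  IsQuotientMap.comp (g := OpenBookCut.proj ψ γ h) (f := MappingTorus.mk ψ)
    isQuotientMap_quot_mk isQuotientMap_quot_mk

theorem OpenBookCut.continuous_mk : Continuous (OpenBookCut.mk ψ γ h) :=
  OpenBookCut.isQuotientMap_mk.continuous

theorem neg_sq_norm_mem {z : ℂ} (hz : z ∈ Metric.ball (0 : ℂ) (√ε)) :
    -‖z‖ ^ 2 ∈ Ioc (-ε) 0 := by
  have h1 : ‖z‖ < √ε := by simpa using hz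
  have h2 : ‖z‖ ^ 2 < ε := (Real.lt_sqrt (norm_nonneg z)).1 h1
  exact ⟨by linarith, by nlinarith [norm_nonneg z]⟩

theorem IsCollar.isClosed_image_Icc [T2Space S] (hc : IsCollar γ ε c) (i : Fin k) {a : ℝ}
    (ha : -ε < a) : IsClosed (c i '' (Icc a 0 ×ˢ univ)) := by
  refine IsCompact.isClosed ((isCompact_Icc.prod isCompact_univ).image_of_continuousOn ?_)
  refine (hc.contMDiffOn i).continuousOn.mono (prod_mono ?_ Subset.rfl)
  exact fun τ hτ => ⟨ha.trans_le hτ.1, hτ.2⟩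

theorem isOpen_surface_interior [IsManifold (𝓡∂ 2) ∞ S] : IsOpen ((𝓡∂ 2).interior S) :=
  (𝓡∂ 2).isOpen_interior (n := ∞) (by simp)

section

variable (H : IsCutCollar ψ γ ε c)
include H

/-- Over the interior the quotient map is open, as it is the quotient by an action of `ℤ`
by homeomorphisms. -/
theorem OpenBookCut.isOpen_mk_image {U : Set (S × ℝ)} (hU : IsOpen U)
    (hUi : U ⊆ (𝓡∂ 2).interior S ×ˢ univ) : IsOpen (OpenBookCut.mk ψ γ h '' U) := by
  rw [← OpenBookCut.isQuotientMap_mk.isOpen_preimage]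
  have : OpenBookCut.mk ψ γ h ⁻¹' (OpenBookCut.mk ψ γ h '' U) =
      ⋃ n : ℤ, (fun y : S × ℝ => (iter ψ n y.1, y.2 - n * (2 * π))) ⁻¹' U := by
    ext ⟨x, s⟩
    simp only [mem_preimage, mem_image, mem_iUnion]
    constructor
    · rintro ⟨a, ha, hab⟩
      obtain ⟨n, h1, h2⟩ := (OpenBookCut.mk_eq_mk_iff_of_interior H (hUi ha).1).1 hab
      refine ⟨-n, ?_⟩
      simp only at h1 h2
      rw [h1, iter_neg_iter]
      have h3 : s - ((-n : ℤ) : ℝ) * (2 * π) = a.2 := by rw [h2]; push_cast; ring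
      rw [h3]; exact ha
    · rintro ⟨n, hn⟩
      refine ⟨_, hn, ?_⟩
      rw [OpenBookCut.mk_iter H]; simp
  rw [this]
  refine isOpen_iUnion fun n => hU.preimage ?_
  exact ((contMDiff_iter ψ n).continuous.comp continuous_fst).prodMk (by fun_prop)

/-- Over the interior only points whose `s`-coordinates differ by a multiple of `2π` are
identified. -/
theorem OpenBookCut.injOn_mk (s₀ : ℝ) :
    InjOn (OpenBookCut.mk ψ γ h) ((𝓡∂ 2).interior S ×ˢ Ioo (s₀ - π) (s₀ + π)) := by
  rintro ⟨x, s⟩ ⟨hx, hs⟩ ⟨x', s'⟩ ⟨-, hs'⟩ heq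
  obtain ⟨n, h1, h2⟩ := (OpenBookCut.mk_eq_mk_iff_of_interior H hx).1 heq
  simp only at h1 h2 hs hs'
  have hn : n = 0 := by
    have h3 : |(n : ℝ) * (2 * π)| < 1 * (2 * π) := by
      rw [abs_lt]
      constructor <;> linarith [hs.1, hs.2, hs'.1, hs'.2]
    rw [abs_mul, abs_of_pos Real.two_pi_pos] at h3
    have h4 := lt_of_mul_lt_mul_right h3 Real.two_pi_pos.le
    have h5 : |n| < 1 := by exact_mod_cast h4
    exact Int.abs_lt_one_iff.1 h5
  subst hn
  simp at h1 h2
  rw [h1, h2]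

theorem OpenBookCut.mem_collar_of_mk_eq_tube {i : Fin k} {x : S} {s : ℝ} {y : Circle × ℂ}
    (hy : y.2 ∈ Metric.ball (0 : ℂ) (√ε))
    (heq : OpenBookCut.tube ψ γ h c i y = OpenBookCut.mk ψ γ h (x, s)) :
    x ∈ c i '' (Ioc (-ε) 0 ×ˢ univ) := by
  have hτ := neg_sq_norm_mem hy
  rcases (OpenBookCut.mk_eq_mk_iff H).1 heq with ⟨n, h1, h2⟩ | ⟨j, z, h1, h2⟩
  · simp only at h1
    rw [h1, H.iter_collar n hτ]
    exact ⟨_, ⟨hτ, mem_univ _⟩, rfl⟩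
  · simp only at h1 h2
    rw [← H.collar.boundary] at h1
    obtain ⟨rfl, -⟩ := H.collar.injective hτ H.collar.zero_mem h1
    rw [h2, ← H.collar.boundary]
    exact ⟨_, ⟨H.collar.zero_mem, mem_univ _⟩, rfl⟩

/-- The parametrizations of the tubular neighbourhoods are injective, with disjoint images. -/
theorem OpenBookCut.tube_injective {i j : Fin k} {y y' : Circle × ℂ}
    (hy : y.2 ∈ Metric.ball (0 : ℂ) (√ε)) (hy' : y'.2 ∈ Metric.ball (0 : ℂ) (√ε))
    (heq : OpenBookCut.tube ψ γ h c i y = OpenBookCut.tube ψ γ h c j y') : i = j ∧ y = y' := by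
  have hτ := neg_sq_norm_mem hy
  have hτ' := neg_sq_norm_mem hy'
  obtain ⟨b, z⟩ := y
  obtain ⟨b', z'⟩ := y'
  simp only at hτ hτ'
  rcases (OpenBookCut.mk_eq_mk_iff H).1 heq with ⟨n, h1, h2⟩ | ⟨l, w, h1, h2⟩
  · simp only at h1 h2
    rw [H.iter_collar n hτ] at h1
    obtain ⟨rfl, h3⟩ := H.collar.injective hτ' hτ h1
    obtain ⟨h4, h5⟩ := Prod.ext_iff.1 h3
    simp only at h4 h5
    have h6 : ‖z'‖ = ‖z‖ := by
      have : ‖z'‖ ^ 2 = ‖z‖ ^ 2 := by linarith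
      exact (sq_eq_sq₀ (norm_nonneg _) (norm_nonneg _)).1 this
    refine ⟨rfl, Prod.ext ?_ ?_⟩
    · simp only
      rw [h2, show -(h j : ℝ) * (Complex.arg z' + n * (2 * π)) =
        -(h j : ℝ) * Complex.arg z' + ((-h j : ℤ) : ℝ) * (n * (2 * π)) by push_cast; ring,
        Circle.exp_add, circle_exp_int_mul, mul_one] at h5
      exact (mul_right_cancel h5).symm
    · simp only
      rw [← Complex.norm_mul_exp_arg_mul_I z, ← Complex.norm_mul_exp_arg_mul_I z', h6,
        ← Circle.coe_exp, ← Circle.coe_exp, h2, Circle.exp_add, Circle.exp_int_mul_two_pi, mul_one]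
  · simp only at h1 h2
    rw [← H.collar.boundary] at h1 h2
    obtain ⟨rfl, h3⟩ := H.collar.injective hτ H.collar.zero_mem h1
    obtain ⟨rfl, h4⟩ := H.collar.injective hτ' H.collar.zero_mem h2
    obtain ⟨h5, h6⟩ := Prod.ext_iff.1 h3
    obtain ⟨h7, h8⟩ := Prod.ext_iff.1 h4
    simp only at h5 h6 h7 h8
    have hz : z = 0 := by simpa using h5
    have hz' : z' = 0 := by simpa using h7
    subst hz hz'
    simp at h6 h8
    exact ⟨rfl, by rw [h6, h8]⟩

theorem OpenBookCut.exists_tube_eq_of_boundary {x : S} (hx : x ∈ (𝓡∂ 2).boundary S) (s : ℝ) :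
    ∃ i b, OpenBookCut.tube ψ γ h c i (b, 0) = OpenBookCut.mk ψ γ h (x, s) := by
  obtain ⟨i, z, rfl⟩ := H.coordinates.exists_eq hx
  refine ⟨i, z * Circle.exp (h i * s), ?_⟩
  rw [← H.collar.boundary, OpenBookCut.mk_collar_eq_tube H H.collar.zero_mem]
  simp

theorem OpenBookCut.tube_zero (i : Fin k) (b : Circle) :
    OpenBookCut.tube ψ γ h c i (b, 0) = OpenBookCut.mk ψ γ h (γ i b, 0) := by
  rw [OpenBookCut.tube]; simp [H.collar.boundary]

/-- Away from the core the angle is locally continuous. At the core each angle in the compact set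
`[-π, π]` is a possible limit, and all of them give the same point of the cut. -/
theorem OpenBookCut.continuousOn_tube (i : Fin k) :
    ContinuousOn (OpenBookCut.tube ψ γ h c i) (univ ×ˢ Metric.ball 0 (√ε)) := by
  rintro ⟨b₀, z₀⟩ ⟨-, hz₀⟩
  refine ContinuousAt.continuousWithinAt ?_
  rw [ContinuousAt, tendsto_nhds]
  intro O hO hm
  have hGc : ContinuousOn (fun y : (Circle × ℂ) × ℝ => OpenBookCut.mk ψ γ h
      (c i (-‖y.1.2‖ ^ 2, y.1.1 * Circle.exp (-(h i : ℝ) * y.2)), y.2))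
      ((univ ×ˢ Metric.ball 0 (√ε)) ×ˢ univ) := by
    refine OpenBookCut.continuous_mk.comp_continuousOn (ContinuousOn.prodMk ?_ (by fun_prop))
    refine (H.collar.contMDiffOn i).continuousOn.comp (by fun_prop) ?_
    rintro ⟨⟨b, z⟩, s⟩ ⟨⟨-, hz⟩, -⟩
    exact ⟨neg_sq_norm_mem hz, mem_univ _⟩
  have hGo : IsOpen (((univ : Set Circle) ×ˢ Metric.ball (0 : ℂ) (√ε)) ×ˢ (univ : Set ℝ)) :=
    (isOpen_univ.prod Metric.isOpen_ball).prod isOpen_univ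
  have key : ∀ s ∈ Icc (-π) π, ∀ᶠ y : (Circle × ℂ) × ℝ in 𝓝 ((b₀, z₀), s),
      y.1.2 = ‖y.1.2‖ * (Circle.exp y.2 : ℂ) → OpenBookCut.tube ψ γ h c i y.1 ∈ O := by
    intro s _
    by_cases hs : z₀ = ‖z₀‖ * (Circle.exp s : ℂ)
    · have hmem := hGo.mem_nhds (show ((b₀, z₀), s) ∈ _ from ⟨⟨mem_univ _, hz₀⟩, mem_univ _⟩)
      have h1 := (hGc.continuousAt hmem).eventually_mem (s := O) (hO.mem_nhds (by
        simp only
        have h2 := OpenBookCut.tube_eq (h := h) H (i := i) (b := b₀) (norm_nonneg z₀)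
          (by linarith [(neg_sq_norm_mem hz₀).1]) s
        rw [← h2, ← hs]; exact hm))
      filter_upwards [h1, hmem] with y hy hyb hyz
      have h2 := OpenBookCut.tube_eq (h := h) H (i := i) (b := y.1.1) (norm_nonneg y.1.2)
          (by linarith [(neg_sq_norm_mem hyb.1.2).1]) y.2
      rw [← h2, ← hyz] at hy
      exact hy
    · have : IsClosed {y : (Circle × ℂ) × ℝ | y.1.2 = ‖y.1.2‖ * (Circle.exp y.2 : ℂ)} :=
        isClosed_eq (by fun_prop) (by fun_prop)
      filter_upwards [this.isOpen_compl.mem_nhds (show ((b₀, z₀), s) ∈ _ from hs)] with y hy hy'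
      exact absurd hy' hy
  have h3 := isCompact_Icc.eventually_forall_of_forall_eventually (K := Icc (-π) π)
    (P := fun (y : Circle × ℂ) (s : ℝ) => y.2 = ‖y.2‖ * (Circle.exp s : ℂ) →
      OpenBookCut.tube ψ γ h c i y ∈ O) key
  filter_upwards [h3] with y hy
  refine hy (Complex.arg y.2) ⟨(Complex.neg_pi_lt_arg _).le, Complex.arg_le_pi _⟩ ?_
  rw [Circle.coe_exp, Complex.norm_mul_exp_arg_mul_I]

/-- The preimage in `S × ℝ` of the image of `W` under a tube is open: by
`OpenBookCut.mk_collar_eq_tube` it is given by an open condition on the collar coordinates. -/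
theorem OpenBookCut.isOpen_tube_image (i : Fin k) {W : Set (Circle × ℂ)} (hW : IsOpen W)
    (hWb : W ⊆ univ ×ˢ Metric.ball 0 (√ε)) : IsOpen (OpenBookCut.tube ψ γ h c i '' W) := by
  rw [← OpenBookCut.isQuotientMap_mk.isOpen_preimage]
  obtain ⟨d, hd, hdc⟩ := H.collar.smooth_inverse i
  set C := c i '' (Ioc (-ε) 0 ×ˢ univ) with hC
  have hCo : IsOpen C := H.collar.isOpen_image i
  -- on the collar, `tube ∘ P` is the quotient map
  set P : S × ℝ → Circle × ℂ :=
    fun y => ((d y.1).2 * Circle.exp (h i * y.2), √(-(d y.1).1) * (Circle.exp y.2 : ℂ)) with hP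
  have hPc : ContinuousOn P (C ×ˢ univ) := by
    have h1 : ContinuousOn (fun y : S × ℝ => d y.1) (C ×ˢ univ) :=
      hd.continuousOn.comp (by fun_prop) fun y hy => hy.1
    have h2 : Continuous fun y : (ℝ × Circle) × ℝ =>
        (y.1.2 * Circle.exp (h i * y.2), √(-y.1.1) * (Circle.exp y.2 : ℂ)) := by fun_prop
    exact h2.comp_continuousOn (h1.prodMk (by fun_prop))
  have hPb : ∀ y ∈ C ×ˢ (univ : Set ℝ), (P y).2 ∈ Metric.ball (0 : ℂ) (√ε) ∧
      OpenBookCut.mk ψ γ h y = OpenBookCut.tube ψ γ h c i (P y) := by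
    rintro ⟨_, s⟩ ⟨⟨⟨τ, w⟩, hy, rfl⟩, -⟩
    have h1 : d (c i (τ, w)) = (τ, w) := hdc _ hy
    constructor
    · simp only [hP, h1, Metric.mem_ball, dist_zero_right, norm_mul, Circle.norm_coe, mul_one,
        Complex.norm_real, Real.norm_of_nonneg (Real.sqrt_nonneg _)]
      exact Real.sqrt_lt_sqrt (by linarith [hy.1.2]) (by linarith [hy.1.1])
    · simp only [hP, h1]
      exact OpenBookCut.mk_collar_eq_tube H hy.1 s
  have : OpenBookCut.mk ψ γ h ⁻¹' (OpenBookCut.tube ψ γ h c i '' W) = (C ×ˢ univ) ∩ P ⁻¹' W := by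
    ext y
    constructor
    · rintro ⟨a, ha, hay⟩
      have hyC : y ∈ C ×ˢ (univ : Set ℝ) :=
        ⟨OpenBookCut.mem_collar_of_mk_eq_tube H (hWb ha).2 hay, mem_univ _⟩
      obtain ⟨h1, h2⟩ := hPb y hyC
      refine ⟨hyC, ?_⟩
      rw [h2] at hay
      rw [mem_preimage, ← (OpenBookCut.tube_injective H (hWb ha).2 h1 hay).2]
      exact ha
    · rintro ⟨hyC, hy⟩
      exact ⟨P y, hy, (hPb y hyC).2.symm⟩
  rw [this]
  exact hPc.isOpen_inter_preimage (hCo.prod isOpen_univ) hW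

/-- Each point of the cut has a representative whose `s`-coordinate is in a given interval of
length `2π`. -/
theorem OpenBookCut.exists_mk_eq_near (s₀ : ℝ) (y : S × ℝ) :
    ∃ x' s', s' ∈ Icc (s₀ - π) (s₀ + π) ∧ OpenBookCut.mk ψ γ h (x', s') = OpenBookCut.mk ψ γ h y ∧
      ∃ n : ℤ, x' = iter ψ n y.1 := by
  obtain ⟨x, s⟩ := y
  set n : ℤ := ⌊(s - s₀ + π) / (2 * π)⌋ with hn
  have hpi := Real.two_pi_pos
  refine ⟨iter ψ n x, s - n * (2 * π), ⟨?_, ?_⟩, ?_, n, rfl⟩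
  · have := Int.floor_le ((s - s₀ + π) / (2 * π))
    rw [← hn, le_div_iff₀ hpi] at this
    linarith
  · have := Int.lt_floor_add_one ((s - s₀ + π) / (2 * π))
    rw [← hn, div_lt_iff₀ hpi] at this
    linarith
  · rw [OpenBookCut.mk_iter H]; simp

theorem OpenBookCut.compactSpace [CompactSpace S] : CompactSpace (OpenBookCut ψ γ h) := by
  have h1 : IsCompact (OpenBookCut.mk ψ γ h '' (univ ×ˢ Icc (0 - π) (0 + π))) :=
    (isCompact_univ.prod isCompact_Icc).image OpenBookCut.continuous_mk
  refine ⟨h1.of_isClosed_subset isClosed_univ fun m _ => ?_⟩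
  obtain ⟨y, rfl⟩ := OpenBookCut.isQuotientMap_mk.surjective m
  obtain ⟨x', s', hs', heq, -⟩ := OpenBookCut.exists_mk_eq_near (h := h) H 0 y
  exact ⟨(x', s'), ⟨mem_univ _, hs'⟩, heq⟩

theorem OpenBookCut.separated_of_tube {i j : Fin k} {y y' : Circle × ℂ}
    (hy : y.2 ∈ Metric.ball (0 : ℂ) (√ε)) (hy' : y'.2 ∈ Metric.ball (0 : ℂ) (√ε))
    (hne : OpenBookCut.tube ψ γ h c i y ≠ OpenBookCut.tube ψ γ h c j y') :
    SeparatedNhds {OpenBookCut.tube ψ γ h c i y} {OpenBookCut.tube ψ γ h c j y'} := by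
  have hbo : IsOpen ((univ : Set Circle) ×ˢ Metric.ball (0 : ℂ) (√ε)) :=
    isOpen_univ.prod Metric.isOpen_ball
  have hyb : y ∈ (univ : Set Circle) ×ˢ Metric.ball (0 : ℂ) (√ε) := ⟨mem_univ _, hy⟩
  have hyb' : y' ∈ (univ : Set Circle) ×ˢ Metric.ball (0 : ℂ) (√ε) := ⟨mem_univ _, hy'⟩
  by_cases hij : i = j
  · subst hij
    have hne' : y ≠ y' := fun h => hne (by rw [h])
    obtain ⟨U, V, hU, hV, hyU, hyV, hUV⟩ := t2_separation hne'
    refine ⟨_, _, OpenBookCut.isOpen_tube_image H i (hU.inter hbo) inter_subset_right,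
      OpenBookCut.isOpen_tube_image H i (hV.inter hbo) inter_subset_right, ?_, ?_, ?_⟩
    · rintro _ rfl; exact ⟨y, ⟨hyU, hyb⟩, rfl⟩
    · rintro _ rfl; exact ⟨y', ⟨hyV, hyb'⟩, rfl⟩
    · rw [Set.disjoint_left]
      rintro _ ⟨a, ha, rfl⟩ ⟨a', ha', heq⟩
      have := (OpenBookCut.tube_injective H ha'.2.2 ha.2.2 heq).2
      subst this
      exact Set.disjoint_left.1 hUV ha.1 ha'.1
  · refine ⟨_, _, OpenBookCut.isOpen_tube_image H i hbo Subset.rfl,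
      OpenBookCut.isOpen_tube_image H j hbo Subset.rfl, ?_, ?_, ?_⟩
    · rintro _ rfl; exact ⟨y, hyb, rfl⟩
    · rintro _ rfl; exact ⟨y', hyb', rfl⟩
    · rw [Set.disjoint_left]
      rintro _ ⟨a, ha, rfl⟩ ⟨a', ha', heq⟩
      exact hij (OpenBookCut.tube_injective H ha'.2 ha.2 heq).1.symm

variable [IsManifold (𝓡∂ 2) ∞ S] [T2Space S]

/-- Points of the binding are separated from all other points: from points of the same collar inside
the tube, and from points outside the collar by a smaller tube. -/
theorem OpenBookCut.separated_of_binding (i : Fin k) (b : Circle) {m : OpenBookCut ψ γ h}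
    (hne : OpenBookCut.tube ψ γ h c i (b, 0) ≠ m) :
    SeparatedNhds {OpenBookCut.tube ψ γ h c i (b, 0)} {m} := by
  have hε := Real.sqrt_pos.2 H.collar.pos
  obtain ⟨⟨x, s⟩, rfl⟩ := OpenBookCut.isQuotientMap_mk.surjective m
  by_cases hx : x ∈ (𝓡∂ 2).interior S
  swap
  · obtain ⟨j, b', hj⟩ := OpenBookCut.exists_tube_eq_of_boundary (h := h) H
      (mem_boundary_iff_notMem_interior.2 hx) s
    rw [← hj] at hne ⊢
    exact OpenBookCut.separated_of_tube H (by simpa using hε) (by simpa using hε) hne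
  by_cases hxc : x ∈ c i '' (Ioc (-ε) 0 ×ˢ univ)
  · obtain ⟨⟨τ, w⟩, ⟨hτ, -⟩, rfl⟩ := hxc
    rw [OpenBookCut.mk_collar_eq_tube H hτ] at hne ⊢
    refine OpenBookCut.separated_of_tube H (by simpa using hε) ?_ hne
    simp only [Metric.mem_ball, dist_zero_right, norm_mul, Circle.norm_coe, mul_one,
        Complex.norm_real, Real.norm_of_nonneg (Real.sqrt_nonneg _)]
    exact Real.sqrt_lt_sqrt (by linarith [hτ.2]) (by linarith [hτ.1])
  · have hcl := H.collar.isClosed_image_Icc i (a := -(ε / 2)) (by linarith [H.collar.pos])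
    set K := c i '' (Icc (-(ε / 2)) 0 ×ˢ univ) with hK
    have hsub : Metric.ball (0 : ℂ) (√(ε / 2)) ⊆ Metric.ball (0 : ℂ) (√ε) :=
      Metric.ball_subset_ball (Real.sqrt_le_sqrt (by linarith [H.collar.pos]))
    refine ⟨_, _, OpenBookCut.isOpen_tube_image H i
        (W := univ ×ˢ Metric.ball 0 (√(ε / 2))) (isOpen_univ.prod Metric.isOpen_ball)
        (prod_mono Subset.rfl hsub),
      OpenBookCut.isOpen_mk_image H (U := ((𝓡∂ 2).interior S ∩ Kᶜ) ×ˢ univ)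
        ((isOpen_surface_interior.inter hcl.isOpen_compl).prod isOpen_univ)
        (prod_mono inter_subset_left Subset.rfl), ?_, ?_, ?_⟩
    · rintro _ rfl
      exact ⟨(b, 0), ⟨mem_univ _, by simpa using H.collar.pos⟩, rfl⟩
    · rintro _ rfl
      refine ⟨(x, s), ⟨⟨hx, fun hxK => hxc ?_⟩, mem_univ _⟩, rfl⟩
      obtain ⟨y, hy, rfl⟩ := hxK
      exact ⟨y, ⟨⟨by linarith [hy.1.1, H.collar.pos], hy.1.2⟩, mem_univ _⟩, rfl⟩
    · rw [Set.disjoint_left]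
      rintro _ ⟨⟨b', z⟩, ⟨-, hz⟩, rfl⟩ ⟨⟨x', s'⟩, ⟨⟨hx', hxK⟩, -⟩, heq⟩
      have hτ := neg_sq_norm_mem (hsub hz)
      obtain ⟨n, h1, h2⟩ := (OpenBookCut.mk_eq_mk_iff_of_interior H hx').1 heq
      refine hxK ⟨(-‖z‖ ^ 2, b' * Circle.exp (-(h i : ℝ) * z.arg)), ⟨⟨?_, hτ.2⟩, mem_univ _⟩, ?_⟩
      · have h1 : ‖z‖ < √(ε / 2) := by simpa using hz
        have h2 : ‖z‖ ^ 2 < ε / 2 := (Real.lt_sqrt (norm_nonneg z)).1 h1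
        simp only; linarith
      · simp only at h1
        rw [← iter_neg_iter ψ n x', ← h1, H.iter_collar (-n) hτ]

theorem OpenBookCut.t2Space : T2Space (OpenBookCut ψ γ h) := by
  have key : ∀ m m' : OpenBookCut ψ γ h, m ≠ m' → SeparatedNhds {m} {m'} := by
    intro m m' hne
    obtain ⟨⟨x, s⟩, rfl⟩ := OpenBookCut.isQuotientMap_mk.surjective m
    obtain ⟨⟨x', s'⟩, rfl⟩ := OpenBookCut.isQuotientMap_mk.surjective m'
    by_cases hx : x ∈ (𝓡∂ 2).interior S
    swap
    · obtain ⟨j, b', hj⟩ := OpenBookCut.exists_tube_eq_of_boundary (h := h) H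
        (mem_boundary_iff_notMem_interior.2 hx) s
      rw [← hj] at hne ⊢
      exact OpenBookCut.separated_of_binding H j b' hne
    by_cases hx' : x' ∈ (𝓡∂ 2).interior S
    swap
    · obtain ⟨j, b', hj⟩ := OpenBookCut.exists_tube_eq_of_boundary (h := h) H
        (mem_boundary_iff_notMem_interior.2 hx') s'
      rw [← hj] at hne ⊢
      exact (OpenBookCut.separated_of_binding H j b' hne.symm).symm
    -- move the representative of the second point close to the first: then neighbourhoods of
    -- width `1` in the direction of `s` lie in an interval of length `2π`
    obtain ⟨x'', s'', hs'', heq, n, hn⟩ := OpenBookCut.exists_mk_eq_near (h := h) H s (x', s')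
    have hx'' : x'' ∈ (𝓡∂ 2).interior S := by
      rw [hn]; exact (iter_mem_interior_iff ψ n x').2 hx'
    rw [← heq] at hne ⊢
    have hne' : (x, s) ≠ (x'', s'') := fun h => hne (by rw [h])
    obtain ⟨U, V, hU, hV, hyU, hyV, hUV⟩ := t2_separation hne'
    have hpi := Real.pi_gt_three
    have hI := isOpen_surface_interior (S := S)
    refine ⟨_, _, OpenBookCut.isOpen_mk_image H (U := U ∩ (𝓡∂ 2).interior S ×ˢ Ioo (s - 1) (s + 1))
        (hU.inter (hI.prod isOpen_Ioo)) (fun a ha => ⟨ha.2.1, mem_univ _⟩),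
      OpenBookCut.isOpen_mk_image H (U := V ∩ (𝓡∂ 2).interior S ×ˢ Ioo (s'' - 1) (s'' + 1))
        (hV.inter (hI.prod isOpen_Ioo)) (fun a ha => ⟨ha.2.1, mem_univ _⟩), ?_, ?_, ?_⟩
    · rintro _ rfl
      exact ⟨_, ⟨hyU, hx, by linarith, by linarith⟩, rfl⟩
    · rintro _ rfl
      exact ⟨_, ⟨hyV, hx'', by linarith, by linarith⟩, rfl⟩
    · rw [Set.disjoint_left]
      rintro _ ⟨a, ⟨haU, ha, ha1, ha2⟩, rfl⟩ ⟨a', ⟨haV, ha', ha1', ha2'⟩, heq'⟩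
      have := OpenBookCut.injOn_mk (h := h) H ((s + s'') / 2)
        (x₁ := a') (x₂ := a) ⟨ha', by linarith [hs''.1, hs''.2], by linarith [hs''.1, hs''.2]⟩
        ⟨ha, by linarith [hs''.1, hs''.2], by linarith [hs''.1, hs''.2]⟩ heq'
      subst this
      exact Set.disjoint_left.1 hUV haU haV
  refine ⟨fun m m' hne => ?_⟩
  obtain ⟨U, V, hU, hV, hmU, hmV, hUV⟩ := key m m' hne
  exact ⟨U, V, hU, hV, hmU rfl, hmV rfl, hUV⟩

end

end CutTopology

/-! ### The smooth structure of the cut -/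

section LocalDiffeoLemmas

variable {E₁ E₂ E₃ H₁ H₂ M₁ M₂ Q : Type*}
  [NormedAddCommGroup E₁] [NormedSpace ℝ E₁] [TopologicalSpace H₁] {I₁ : ModelWithCorners ℝ E₁ H₁}
  [TopologicalSpace M₁] [ChartedSpace H₁ M₁]
  [NormedAddCommGroup E₂] [NormedSpace ℝ E₂] [TopologicalSpace H₂] {I₂ : ModelWithCorners ℝ E₂ H₂}
  [TopologicalSpace M₂] [ChartedSpace H₂ M₂]
  [NormedAddCommGroup E₃] [NormedSpace ℝ E₃]

theorem IsLocalDiffeomorphOn.isOpen_image {f : M₁ → M₂} {Ω : Set M₁}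
    (hf : IsLocalDiffeomorphOn I₁ I₂ ∞ f Ω) {U : Set M₁} (hU : IsOpen U) (hUΩ : U ⊆ Ω) :
    IsOpen (f '' U) := by
  rw [isOpen_iff_mem_nhds]
  rintro _ ⟨x, hx, rfl⟩
  obtain ⟨Φ, hxΦ, hΦ⟩ := hf ⟨x, hUΩ hx⟩
  have h1 : IsOpen (Φ.toOpenPartialHomeomorph '' (Φ.source ∩ U)) :=
    Φ.toOpenPartialHomeomorph.isOpen_image_of_subset_source (Φ.open_source.inter hU)
      inter_subset_left
  refine mem_of_superset (h1.mem_nhds ⟨x, ⟨hxΦ, hx⟩, (hΦ hxΦ).symm⟩) ?_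
  rintro _ ⟨y, hy, rfl⟩
  exact ⟨y, hy.2, hΦ hy.1⟩

theorem IsLocalDiffeomorphAt.exists_injOn {f : M₁ → M₂} {x : M₁}
    (hf : IsLocalDiffeomorphAt I₁ I₂ ∞ f x) : ∃ U ∈ 𝓝 x, InjOn f U := by
  obtain ⟨Φ, hx, hΦ⟩ := hf
  exact ⟨Φ.source, Φ.open_source.mem_nhds hx, fun a ha b hb hab =>
    Φ.injOn ha hb (by rw [← hΦ ha, ← hΦ hb, hab])⟩

/-- A transition map between two parametrizations `q : M₁ → Q` and `q' : M₂ → Q` gives a transition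
map in local coordinates of `M₁` and `M₂`. -/
theorem exists_transition {q : M₁ → Q} {q' : M₂ → Q} {e : E₃ → M₁} {e' : E₃ → M₂} {x y : E₃}
    (he : IsLocalDiffeomorphAt 𝓘(ℝ, E₃) I₁ ∞ e x) (he' : IsLocalDiffeomorphAt 𝓘(ℝ, E₃) I₂ ∞ e' y)
    (hg : ∃ g : M₁ → M₂, ContMDiffAt I₁ I₂ ∞ g (e x) ∧ g (e x) = e' y ∧
      ∀ᶠ a in 𝓝 (e x), q' (g a) = q a) :
    ∃ g : E₃ → E₃, ContDiffAt ℝ ∞ g x ∧ g x = y ∧ ∀ᶠ x' in 𝓝 x, q' (e' (g x')) = q (e x') := by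
  obtain ⟨g, hg, hgx, hq⟩ := hg
  have h1 : he'.localInverse (e' y) = y := he'.localInverse_left_inv he'.localInverse_mem_target
  have h2 : ContMDiffAt 𝓘(ℝ, E₃) I₂ ∞ (g ∘ e) x := hg.comp x he.contMDiffAt
  have h3 : ContMDiffAt 𝓘(ℝ, E₃) 𝓘(ℝ, E₃) ∞ (he'.localInverse ∘ (g ∘ e)) x :=
    ContMDiffAt.comp x (by
      have : (g ∘ e) x = e' y := hgx
      rw [this]; exact he'.localInverse_contMDiffAt) h2
  refine ⟨_, h3.contDiffAt, ?_, ?_⟩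
  · simp [hgx, h1]
  · have h4 : Tendsto (g ∘ e) (𝓝 x) (𝓝 (e' y)) := by
      have := h2.continuousAt.tendsto
      have h5 : (g ∘ e) x = e' y := hgx
      rwa [h5] at this
    filter_upwards [h4.eventually he'.localInverse_eventuallyEq_right,
      he.contMDiffAt.continuousAt.eventually hq] with x' h6 h7
    have h8 : e' (he'.localInverse (g (e x'))) = g (e x') := h6
    simp only [Function.comp_apply]
    rw [h8, h7]

/-- A linear isomorphism onto a product is a diffeomorphism onto the product manifold. -/
theorem ContinuousLinearEquiv.isLocalDiffeomorphAt_prod {F F' : Type*} [NormedAddCommGroup F]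
    [NormedSpace ℝ F] [NormedAddCommGroup F'] [NormedSpace ℝ F'] (L : E₃ ≃L[ℝ] F × F') (x : E₃) :
    IsLocalDiffeomorphAt 𝓘(ℝ, E₃) (𝓘(ℝ, F).prod 𝓘(ℝ, F')) ∞ L x := by
  refine OpenPartialHomeomorph.isLocalDiffeomorphAt L.toHomeomorph.toOpenPartialHomeomorph ?_ ?_
    (mem_univ x)
  · rw [← modelWithCornersSelf_prod, chartedSpaceSelf_prod]
    exact L.contDiff.contMDiff.contMDiffOn
  · rw [← modelWithCornersSelf_prod, chartedSpaceSelf_prod]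
    exact L.symm.contDiff.contMDiff.contMDiffOn

theorem Circle.isLocalDiffeomorphAt_exp (t : ℝ) :
    IsLocalDiffeomorphAt 𝓘(ℝ, ℝ) (𝓡 1) ∞ (fun s : ℝ => Circle.exp s) t := by
  have hmem : ∀ s ∈ Ioo (t - π) (t + π), |s - t| < π := fun s hs => by
    rw [abs_lt]; constructor <;> linarith [hs.1, hs.2]
  let e : OpenPartialHomeomorph ℝ Circle :=
    { toFun := fun s => Circle.exp s
      invFun := Circle.angle t
      source := Ioo (t - π) (t + π)
      target := {w | ((w / Circle.exp t : Circle) : ℂ) ∈ Complex.slitPlane}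
      map_source' := fun s hs => by
        rw [Set.mem_ofPred_eq, ← Circle.exp_sub, Complex.mem_slitPlane_iff_arg,
          Circle.arg_exp (by linarith [hs.1]) (by linarith [hs.2])]
        exact ⟨by linarith [hs.2], Circle.coe_ne_zero _⟩
      map_target' := fun w hw => by
        have h1 := (Complex.mem_slitPlane_iff_arg.1 hw).1
        have h2 := Complex.arg_mem_Ioc ((w / Circle.exp t : Circle) : ℂ)
        have h3 := lt_of_le_of_ne h2.2 h1
        rw [Circle.angle]
        exact ⟨by linarith [h2.1], by linarith⟩
      left_inv' := fun s hs => Circle.angle_exp (hmem s hs)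
      right_inv' := fun w _ => Circle.exp_angle t w
      open_source := isOpen_Ioo
      open_target := Circle.isOpen_slitPlane_div t
      continuousOn_toFun := Circle.exp.continuous.continuousOn
      continuousOn_invFun := fun w hw =>
        (Circle.contMDiffAt_angle hw).continuousAt.continuousWithinAt }
  exact e.isLocalDiffeomorphAt contMDiff_circleExp.contMDiffOn
    (fun w hw => (Circle.contMDiffAt_angle hw).contMDiffWithinAt)
    ⟨by linarith [Real.pi_pos], by linarith [Real.pi_pos]⟩

end LocalDiffeoLemmas

section InteriorChart

variable {S : Type u} [TopologicalSpace S] [ChartedSpace (EuclideanHalfSpace 2) S]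

theorem isOpen_extChartAt_target_pos (x : S) :
    IsOpen ((extChartAt (𝓡∂ 2) x).target ∩ {u | 0 < u 0}) := by
  have h : (extChartAt (𝓡∂ 2) x).target ∩ {u | 0 < u 0} =
      (𝓡∂ 2).symm ⁻¹' (chartAt (EuclideanHalfSpace 2) x).target ∩ {u | 0 < u 0} := by
    ext u
    rw [extChartAt_target, range_modelWithCornersEuclideanHalfSpace]
    simp only [mem_inter_iff, mem_ofPred_eq]
    constructor
    · rintro ⟨⟨h1, -⟩, h2⟩; exact ⟨h1, h2⟩
    · rintro ⟨h1, h2⟩; exact ⟨⟨h1, le_of_lt h2⟩, h2⟩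
  rw [h]
  exact ((chartAt (EuclideanHalfSpace 2) x).open_target.preimage (𝓡∂ 2).continuous_symm).inter
    (isOpen_lt continuous_const (by fun_prop))

variable [IsManifold (𝓡∂ 2) ∞ S]

/-- Charts of a manifold with boundary are charts of its interior in the sense of manifolds without
boundary. -/
theorem isLocalDiffeomorphAt_extChartAt_symm (x : S) {u : EuclideanSpace ℝ (Fin 2)}
    (hu : u ∈ (extChartAt (𝓡∂ 2) x).target ∩ {u | 0 < u 0}) :
    IsLocalDiffeomorphAt (𝓡 2) (𝓡∂ 2) ∞ (extChartAt (𝓡∂ 2) x).symm u := by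
  let e : OpenPartialHomeomorph (EuclideanSpace ℝ (Fin 2)) S :=
    { toFun := (extChartAt (𝓡∂ 2) x).symm
      invFun := extChartAt (𝓡∂ 2) x
      source := (extChartAt (𝓡∂ 2) x).target ∩ {u | 0 < u 0}
      target := (extChartAt (𝓡∂ 2) x).source ∩ (𝓡∂ 2).interior S
      map_source' := fun v hv => by
        have h1 := (extChartAt (𝓡∂ 2) x).map_target hv.1
        refine ⟨h1, ?_⟩
        rw [extChartAt_source] at h1
        rw [← extChartAt_zero_pos_iff x h1, (extChartAt (𝓡∂ 2) x).right_inv hv.1]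
        exact hv.2
      map_target' := fun y hy => by
        refine ⟨(extChartAt (𝓡∂ 2) x).map_source hy.1, ?_⟩
        have h1 := hy.1
        rw [extChartAt_source] at h1
        exact (extChartAt_zero_pos_iff x h1).2 hy.2
      left_inv' := fun v hv => (extChartAt (𝓡∂ 2) x).right_inv hv.1
      right_inv' := fun y hy => (extChartAt (𝓡∂ 2) x).left_inv hy.1
      open_source := isOpen_extChartAt_target_pos x
      open_target := (isOpen_extChartAt_source x).inter isOpen_surface_interior
      continuousOn_toFun := (continuousOn_extChartAt_symm x).mono inter_subset_left
      continuousOn_invFun := (continuousOn_extChartAt x).mono inter_subset_left }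
  refine e.isLocalDiffeomorphAt ((contMDiffOn_extChartAt_symm x).mono inter_subset_left) ?_ hu
  refine contMDiffOn_extChartAt.mono ?_
  rw [← extChartAt_source (𝓡∂ 2) x]
  exact inter_subset_left

end InteriorChart

section CutManifold

variable {S : Type u} [TopologicalSpace S] [ChartedSpace (EuclideanHalfSpace 2) S]
  {ψ : Diffeomorph (𝓡∂ 2) (𝓡∂ 2) S S ∞} {k : ℕ} {γ : Fin k → Circle → S} {h : Fin k → ℤ}
  {ε : ℝ} {c : Fin k → ℝ × Circle → S} (H : IsCutCollar ψ γ ε c)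
include H

/-- The transition maps between parametrizations of the interior are iterates of the deck
transformation. -/
theorem OpenBookCut.exists_transition_mk {a b : S × ℝ} (ha : a.1 ∈ (𝓡∂ 2).interior S)
    (hab : OpenBookCut.mk ψ γ h a = OpenBookCut.mk ψ γ h b) :
    ∃ g : S × ℝ → S × ℝ, ContMDiff ((𝓡∂ 2).prod 𝓘(ℝ, ℝ)) ((𝓡∂ 2).prod 𝓘(ℝ, ℝ)) ∞ g ∧ g a = b ∧
      ∀ a', OpenBookCut.mk ψ γ h (g a') = OpenBookCut.mk ψ γ h a' := by
  obtain ⟨n, h1, h2⟩ := (OpenBookCut.mk_eq_mk_iff_of_interior H ha).1 hab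
  refine ⟨fun y => (iter ψ n y.1, y.2 - n * (2 * π)), ?_, ?_, ?_⟩
  · refine ((contMDiff_iter ψ n).comp contMDiff_fst).prodMk ?_
    have : ContDiff ℝ ∞ fun s : ℝ => s - n * (2 * π) := by fun_prop
    exact this.contMDiff.comp contMDiff_snd
  · exact Prod.ext h1.symm (by simp [h2])
  · intro a'
    rw [OpenBookCut.mk_iter H]; simp

/-- The transition map from the mapping torus to a tube is
`(τ, θ, s) ↦ (θ + h_i s, √(-τ) e^{is})`, which is smooth for `τ < 0`. -/
theorem OpenBookCut.exists_transition_mk_tube {a : S × ℝ} (ha : a.1 ∈ (𝓡∂ 2).interior S) {i : Fin k}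
    {y : Circle × ℂ} (hy : y.2 ∈ Metric.ball (0 : ℂ) (√ε))
    (hay : OpenBookCut.mk ψ γ h a = OpenBookCut.tube ψ γ h c i y) :
    ∃ g : S × ℝ → Circle × ℂ, ContMDiffAt ((𝓡∂ 2).prod 𝓘(ℝ, ℝ)) ((𝓡 1).prod 𝓘(ℝ, ℂ)) ∞ g a ∧
      g a = y ∧ ∀ᶠ a' in 𝓝 a, OpenBookCut.tube ψ γ h c i (g a') = OpenBookCut.mk ψ γ h a' := by
  obtain ⟨x, s⟩ := a
  obtain ⟨d, hd, hdc⟩ := H.collar.smooth_inverse i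
  have hxC := OpenBookCut.mem_collar_of_mk_eq_tube H hy hay.symm
  have hCo : IsOpen (c i '' (Ioc (-ε) 0 ×ˢ univ)) := H.collar.isOpen_image i
  have htube : ∀ x' ∈ c i '' (Ioc (-ε) 0 ×ˢ univ), ∀ s' : ℝ, OpenBookCut.tube ψ γ h c i
      ((d x').2 * Circle.exp (h i * s'), √(-(d x').1) * (Circle.exp s' : ℂ)) =
        OpenBookCut.mk ψ γ h (x', s') := by
    rintro _ ⟨y, hy, rfl⟩ s'
    rw [hdc y hy, ← OpenBookCut.mk_collar_eq_tube H hy.1]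
  refine ⟨fun y => ((d y.1).2 * Circle.exp (h i * y.2), √(-(d y.1).1) * (Circle.exp y.2 : ℂ)),
    ?_, ?_, ?_⟩
  · have h1 : ContMDiffAt ((𝓡∂ 2).prod 𝓘(ℝ, ℝ)) (𝓘(ℝ, ℝ).prod (𝓡 1)) ∞
        (fun y : S × ℝ => d y.1) (x, s) :=
      ContMDiffAt.comp (g := d) (f := Prod.fst) (x, s) (hd.contMDiffAt (hCo.mem_nhds hxC))
        contMDiffAt_fst
    have h2 : ContMDiffAt ((𝓡∂ 2).prod 𝓘(ℝ, ℝ)) 𝓘(ℝ, ℝ) ∞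
        (fun y : S × ℝ => (d y.1).1) (x, s) := contMDiffAt_fst.comp (x, s) h1
    have h3 : ContMDiffAt ((𝓡∂ 2).prod 𝓘(ℝ, ℝ)) (𝓡 1) ∞
        (fun y : S × ℝ => (d y.1).2) (x, s) := contMDiffAt_snd.comp (x, s) h1
    have hneg : (d x).1 < 0 := by
      obtain ⟨⟨τ, w⟩, hy, rfl⟩ := hxC
      rw [hdc _ hy]
      refine lt_of_le_of_ne hy.1.2 fun h0 => ?_
      exact mem_boundary_iff_notMem_interior.1
        ((H.collar.mem_boundary_iff H.coordinates hy.1).2 h0) ha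
    have h4 : ContDiffAt ℝ ∞ (fun τ : ℝ => √(-τ)) (d x).1 := by
      refine ContDiffAt.sqrt contDiffAt_id.neg ?_
      exact (neg_pos.2 hneg).ne'
    have h5 : ContMDiffAt ((𝓡∂ 2).prod 𝓘(ℝ, ℝ)) 𝓘(ℝ, ℝ) ∞
        (fun y : S × ℝ => √(-(d y.1).1)) (x, s) :=
      ContMDiffAt.comp (g := fun τ : ℝ => √(-τ)) (f := fun y : S × ℝ => (d y.1).1)
        (x, s) h4.contMDiffAt h2
    have h6 : ContMDiffAt ((𝓡∂ 2).prod 𝓘(ℝ, ℝ)) (𝓡 1) ∞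
        (fun y : S × ℝ => Circle.exp (h i * y.2)) (x, s) := by
      have : ContDiff ℝ ∞ fun s : ℝ => (h i : ℝ) * s := by fun_prop
      exact (contMDiff_circleExp.comp (this.contMDiff.comp contMDiff_snd)).contMDiffAt
    have h7 : ContMDiffAt ((𝓡∂ 2).prod 𝓘(ℝ, ℝ)) 𝓘(ℝ, ℂ) ∞
        (fun y : S × ℝ => (Circle.exp y.2 : ℂ)) (x, s) :=
      (Circle.contMDiff_coe.comp (contMDiff_circleExp.comp contMDiff_snd)).contMDiffAt
    have h8 : ContMDiffAt ((𝓡∂ 2).prod 𝓘(ℝ, ℝ)) 𝓘(ℝ, ℂ) ∞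
        (fun y : S × ℝ => (√(-(d y.1).1) : ℂ)) (x, s) :=
      ContMDiffAt.comp (g := fun τ : ℝ => (τ : ℂ)) (f := fun y : S × ℝ => √(-(d y.1).1))
        (x, s) Complex.ofRealCLM.contDiff.contMDiff.contMDiffAt h5
    have h9 : ContMDiffAt ((𝓡∂ 2).prod 𝓘(ℝ, ℝ)) 𝓘(ℝ, ℂ) ∞
        (fun y : S × ℝ => (√(-(d y.1).1) : ℂ) * (Circle.exp y.2 : ℂ)) (x, s) :=
      ContMDiffAt.comp (g := fun q : ℂ × ℂ => q.1 * q.2) (I' := 𝓘(ℝ, ℂ × ℂ)) (x, s)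
        (contDiff_mul (𝕜 := ℝ) (𝔸 := ℂ)).contMDiff.contMDiffAt (h8.prodMk_space h7)
    exact (h3.mul h6).prodMk h9
  · refine (OpenBookCut.tube_injective H ?_ hy ((htube x hxC s).trans hay)).2
    obtain ⟨⟨τ, w⟩, hy, rfl⟩ := hxC
    simp only [hdc _ hy, Metric.mem_ball, dist_zero_right, norm_mul, Circle.norm_coe, mul_one,
        Complex.norm_real, Real.norm_of_nonneg (Real.sqrt_nonneg _)]
    exact Real.sqrt_lt_sqrt (by linarith [hy.1.2]) (by linarith [hy.1.1])
  · filter_upwards [(hCo.prod isOpen_univ).mem_nhds (show (x, s) ∈ _ from ⟨hxC, mem_univ _⟩)]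
      with a' ha'
    exact htube a'.1 ha'.1 a'.2

/-- Away from the core circle, the parametrization `OpenBookCut.tube` factors through `S × ℝ`. -/
theorem OpenBookCut.exists_tube_lift {i : Fin k} {y : Circle × ℂ}
    (hy : y.2 ∈ Metric.ball (0 : ℂ) (√ε)) (hy0 : y.2 ≠ 0) (s : ℝ) (hs : y.2 = ‖y.2‖ * (Circle.exp s : ℂ)) :
    ∃ g : Circle × ℂ → S × ℝ, ContMDiffAt ((𝓡 1).prod 𝓘(ℝ, ℂ)) ((𝓡∂ 2).prod 𝓘(ℝ, ℝ)) ∞ g y ∧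
      (g y).1 ∈ (𝓡∂ 2).interior S ∧ (g y).2 = s ∧
      ∀ᶠ y' in 𝓝 y, OpenBookCut.mk ψ γ h (g y') = OpenBookCut.tube ψ γ h c i y' := by
  obtain ⟨b, z⟩ := y
  simp only at hy hy0 hs
  have hz : 0 < ‖z‖ := norm_pos_iff.2 hy0
  -- the branch of the angle near `z` with the value `s` at `z`
  set ϑ : ℂ → ℝ := fun z => s + (Complex.log (z * (Circle.exp (-s) : ℂ))).im with hϑ
  have hexp : (Circle.exp s : ℂ) * (Circle.exp (-s) : ℂ) = 1 := by
    rw [← Circle.coe_mul, ← Circle.exp_add]; simp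
  have hzs : z * (Circle.exp (-s) : ℂ) = ‖z‖ := by
    conv_lhs => rw [hs]
    rw [mul_assoc, hexp, mul_one]
  have hϑz : ϑ z = s := by
    simp only [hϑ]
    rw [hzs, Complex.log_im, Complex.arg_ofReal_of_nonneg hz.le, add_zero]
  have hϑd : ContDiffAt ℝ ∞ ϑ z := by
    have h1 : ContDiffAt ℝ ∞ (fun z : ℂ => Complex.log (z * (Circle.exp (-s) : ℂ))) z := by
      refine ContDiffAt.comp (g := Complex.log) z ((Complex.contDiffAt_log ?_).restrict_scalars ℝ)
        (contDiffAt_id.mul contDiffAt_const)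
      rw [hzs]
      exact Complex.ofReal_mem_slitPlane.2 hz
    exact contDiffAt_const.add (Complex.imCLM.contDiff.contDiffAt.comp z h1)
  have hpolar : ∀ z' : ℂ, z' = ‖z'‖ * (Circle.exp (ϑ z') : ℂ) := by
    intro z'
    simp only [hϑ]
    have h1 := Complex.norm_mul_exp_arg_mul_I (z' * (Circle.exp (-s) : ℂ))
    rw [norm_mul, Circle.norm_coe, mul_one, ← Circle.coe_exp, ← Complex.log_im] at h1
    rw [Circle.exp_add, Circle.coe_mul, mul_left_comm, h1, mul_left_comm, hexp, mul_one]
  have hτ : -‖z‖ ^ 2 ∈ Ioo (-ε) 0 := ⟨(neg_sq_norm_mem hy).1, by nlinarith⟩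
  refine ⟨fun y => (c i (-‖y.2‖ ^ 2, y.1 * Circle.exp (-(h i : ℝ) * ϑ y.2)), ϑ y.2), ?_, ?_, hϑz, ?_⟩
  · have h1 : ContMDiffAt ((𝓡 1).prod 𝓘(ℝ, ℂ)) 𝓘(ℝ, ℝ) ∞ (fun y : Circle × ℂ => ϑ y.2) (b, z) :=
      ContMDiffAt.comp (g := ϑ) (f := Prod.snd) (b, z) hϑd.contMDiffAt contMDiffAt_snd
    have h2 : ContMDiffAt ((𝓡 1).prod 𝓘(ℝ, ℂ)) 𝓘(ℝ, ℝ) ∞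
        (fun y : Circle × ℂ => -‖y.2‖ ^ 2) (b, z) := by
      have : ContDiff ℝ ∞ fun z : ℂ => -‖z‖ ^ 2 := (contDiff_norm_sq ℝ).neg
      exact (this.contMDiff.comp contMDiff_snd).contMDiffAt
    have h3 : ContMDiffAt ((𝓡 1).prod 𝓘(ℝ, ℂ)) (𝓡 1) ∞
        (fun y : Circle × ℂ => y.1 * Circle.exp (-(h i : ℝ) * ϑ y.2)) (b, z) := by
      have h4 : ContDiff ℝ ∞ fun s : ℝ => -(h i : ℝ) * s := by fun_prop
      exact contMDiffAt_fst.mul (ContMDiffAt.comp (g := fun s : ℝ => Circle.exp (-(h i : ℝ) * s))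
        (f := fun y : Circle × ℂ => ϑ y.2) (b, z)
        (contMDiff_circleExp.comp h4.contMDiff).contMDiffAt h1)
    have h5 : ContMDiffAt (𝓘(ℝ, ℝ).prod (𝓡 1)) (𝓡∂ 2) ∞ (c i)
        (-‖z‖ ^ 2, b * Circle.exp (-(h i : ℝ) * ϑ z)) := by
      refine (H.collar.contMDiffOn i).contMDiffAt ?_
      exact prod_mem_nhds (Ioc_mem_nhds hτ.1 hτ.2) univ_mem
    exact (ContMDiffAt.comp (g := c i) (b, z) h5 (h2.prodMk h3)).prodMk h1
  · exact H.collar.mem_interior H.coordinates hτ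
  · have hbo : IsOpen ((univ : Set Circle) ×ˢ Metric.ball (0 : ℂ) (√ε)) :=
      isOpen_univ.prod Metric.isOpen_ball
    filter_upwards [hbo.mem_nhds (show (b, z) ∈ _ from ⟨mem_univ _, hy⟩)] with y hy
    have h1 := OpenBookCut.tube_eq (h := h) H (i := i) (b := y.1) (norm_nonneg y.2)
      (by linarith [(neg_sq_norm_mem hy.2).1]) (ϑ y.2)
    rw [← h1, ← hpolar y.2]

theorem OpenBookCut.ne_zero_of_mk_eq_tube {a : S × ℝ} (ha : a.1 ∈ (𝓡∂ 2).interior S) {i : Fin k}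
    {y : Circle × ℂ} (hay : OpenBookCut.tube ψ γ h c i y = OpenBookCut.mk ψ γ h a) : y.2 ≠ 0 := by
  intro hy0
  obtain ⟨b, z⟩ := y
  simp only at hy0
  rw [hy0, OpenBookCut.tube_zero H] at hay
  obtain ⟨n, h1, -⟩ := (OpenBookCut.mk_eq_mk_iff_of_interior H ha).1 hay.symm
  simp only at h1
  have h2 := H.coordinates.mem_boundary i b
  rw [← iter_neg_iter ψ n a.1, ← h1, H.iter_boundary _ h2] at ha
  exact mem_boundary_iff_notMem_interior.1 h2 ha

/-- The transition map from a tube to the mapping torus is given by polar coordinates. -/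
theorem OpenBookCut.exists_transition_tube_mk {a : S × ℝ} (ha : a.1 ∈ (𝓡∂ 2).interior S) {i : Fin k}
    {y : Circle × ℂ} (hy : y.2 ∈ Metric.ball (0 : ℂ) (√ε))
    (hay : OpenBookCut.tube ψ γ h c i y = OpenBookCut.mk ψ γ h a) :
    ∃ g : Circle × ℂ → S × ℝ, ContMDiffAt ((𝓡 1).prod 𝓘(ℝ, ℂ)) ((𝓡∂ 2).prod 𝓘(ℝ, ℝ)) ∞ g y ∧
      g y = a ∧ ∀ᶠ y' in 𝓝 y, OpenBookCut.mk ψ γ h (g y') = OpenBookCut.tube ψ γ h c i y' := by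
  obtain ⟨g, hg, hgi, -, hgt⟩ := OpenBookCut.exists_tube_lift (h := h) H (i := i) hy
    (OpenBookCut.ne_zero_of_mk_eq_tube H ha hay) y.2.arg
    (by rw [Circle.coe_exp, Complex.norm_mul_exp_arg_mul_I])
  obtain ⟨g', hg', hga, hgm⟩ := OpenBookCut.exists_transition_mk H hgi
    (hgt.self_of_nhds.trans hay)
  refine ⟨g' ∘ g, hg'.contMDiffAt.comp y hg, hga, ?_⟩
  filter_upwards [hgt] with y' hy'
  rw [Function.comp_apply, hgm, hy']

/-- The smooth structure of the cut, for which the quotient map is a local diffeomorphism on the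
interior of `S × ℝ` and the maps `OpenBookCut.tube` are local diffeomorphisms. -/
theorem OpenBookCut.exists_isManifold [IsManifold (𝓡∂ 2) ∞ S] [T2Space S] :
    ∃ (_ : ChartedSpace (EuclideanSpace ℝ (Fin 3)) (OpenBookCut ψ γ h))
      (_ : IsManifold (𝓡 3) ∞ (OpenBookCut ψ γ h)),
      IsLocalDiffeomorphOn ((𝓡∂ 2).prod 𝓘(ℝ, ℝ)) (𝓡 3) ∞ (OpenBookCut.mk ψ γ h)
        ((𝓡∂ 2).interior S ×ˢ univ) ∧
      ∀ i, IsLocalDiffeomorphOn ((𝓡 1).prod 𝓘(ℝ, ℂ)) (𝓡 3) ∞ (OpenBookCut.tube ψ γ h c i)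
        (univ ×ˢ Metric.ball 0 (√ε)) := by
  let L₁ : EuclideanSpace ℝ (Fin 3) ≃L[ℝ] EuclideanSpace ℝ (Fin 2) × ℝ :=
    ContinuousLinearEquiv.ofFinrankEq (by simp)
  let L₂ : EuclideanSpace ℝ (Fin 3) ≃L[ℝ] ℝ × ℂ := ContinuousLinearEquiv.ofFinrankEq (by simp)
  let e₁ : S → EuclideanSpace ℝ (Fin 3) → S × ℝ := fun x v =>
    Prod.map (extChartAt (𝓡∂ 2) x).symm id (L₁ v)
  let e₂ : EuclideanSpace ℝ (Fin 3) → Circle × ℂ := fun v =>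
    Prod.map (fun t : ℝ => Circle.exp t) id (L₂ v)
  let Ω₁ : S → Set (EuclideanSpace ℝ (Fin 3)) := fun x =>
    L₁ ⁻¹' (((extChartAt (𝓡∂ 2) x).target ∩ {u | 0 < u 0}) ×ˢ univ)
  let Ω₂ : Set (EuclideanSpace ℝ (Fin 3)) := L₂ ⁻¹' (univ ×ˢ Metric.ball 0 (√ε))
  have hΩ₁ : ∀ x, IsOpen (Ω₁ x) := fun x =>
    ((isOpen_extChartAt_target_pos x).prod isOpen_univ).preimage L₁.continuous
  have hΩ₂ : IsOpen Ω₂ := (isOpen_univ.prod Metric.isOpen_ball).preimage L₂.continuous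
  have he₁ : ∀ x, ∀ v ∈ Ω₁ x,
      IsLocalDiffeomorphAt (𝓡 3) ((𝓡∂ 2).prod 𝓘(ℝ, ℝ)) ∞ (e₁ x) v := by
    intro x v hv
    refine IsLocalDiffeomorphAt.comp (g := Prod.map (extChartAt (𝓡∂ 2) x).symm (id : ℝ → ℝ))
      ((𝓡∂ 2).prod 𝓘(ℝ, ℝ)) (S × ℝ) (L₁.isLocalDiffeomorphAt_prod v) ?_
    exact (isLocalDiffeomorphAt_extChartAt_symm x hv.1).prodMap
      ((Diffeomorph.refl 𝓘(ℝ, ℝ) ℝ ∞).isLocalDiffeomorph _)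
  have he₂ : ∀ v, IsLocalDiffeomorphAt (𝓡 3) ((𝓡 1).prod 𝓘(ℝ, ℂ)) ∞ e₂ v := by
    intro v
    refine IsLocalDiffeomorphAt.comp (g := Prod.map (fun t : ℝ => Circle.exp t) (id : ℂ → ℂ))
      ((𝓡 1).prod 𝓘(ℝ, ℂ)) (Circle × ℂ) (L₂.isLocalDiffeomorphAt_prod v) ?_
    exact (Circle.isLocalDiffeomorphAt_exp _).prodMap
      ((Diffeomorph.refl 𝓘(ℝ, ℂ) ℂ ∞).isLocalDiffeomorph _)
  have hint₁ : ∀ x, ∀ v ∈ Ω₁ x, (e₁ x v).1 ∈ (𝓡∂ 2).interior S := by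
    intro x v hv
    have h1 := (extChartAt (𝓡∂ 2) x).map_target hv.1.1
    rw [extChartAt_source] at h1
    change (extChartAt (𝓡∂ 2) x).symm (L₁ v).1 ∈ _
    rw [← extChartAt_zero_pos_iff x h1, (extChartAt (𝓡∂ 2) x).right_inv hv.1.1]
    exact hv.1.2
  have hball : ∀ v ∈ Ω₂, (e₂ v).2 ∈ Metric.ball (0 : ℂ) (√ε) := fun v hv => hv.2
  have hexists₁ : ∀ a : S × ℝ, a.1 ∈ (𝓡∂ 2).interior S → ∃ v ∈ Ω₁ a.1, e₁ a.1 v = a := by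
    intro a ha
    refine ⟨L₁.symm (extChartAt (𝓡∂ 2) a.1 a.1, a.2), ?_, ?_⟩
    · simp only [Ω₁, mem_preimage, ContinuousLinearEquiv.apply_symm_apply]
      refine ⟨⟨mem_extChartAt_target a.1, ?_⟩, mem_univ _⟩
      exact (extChartAt_zero_pos_iff a.1 (mem_chart_source _ a.1)).2 ha
    · simp only [e₁, ContinuousLinearEquiv.apply_symm_apply, Prod.map, id, extChartAt_to_inv]
  have hexists₂ : ∀ y : Circle × ℂ, y.2 ∈ Metric.ball (0 : ℂ) (√ε) → ∃ v ∈ Ω₂, e₂ v = y := by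
    intro y hy
    refine ⟨L₂.symm (Complex.arg y.1, y.2), ?_, ?_⟩
    · simp only [Ω₂, mem_preimage, ContinuousLinearEquiv.apply_symm_apply]
      exact ⟨mem_univ _, hy⟩
    · simp [e₂]
  let Ω : S ⊕ Fin k → Set (EuclideanSpace ℝ (Fin 3)) := Sum.elim Ω₁ fun _ => Ω₂
  let f : S ⊕ Fin k → EuclideanSpace ℝ (Fin 3) → OpenBookCut ψ γ h :=
    Sum.elim (fun x v => OpenBookCut.mk ψ γ h (e₁ x v))
      fun i v => OpenBookCut.tube ψ γ h c i (e₂ v)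
  obtain ⟨C, hC, hf⟩ := exists_isManifold_of_parametrizations (Ω := Ω) (f := f) (by
      rintro (x | i)
      · exact hΩ₁ x
      · exact hΩ₂) (by
      rintro (x | i)
      · exact OpenBookCut.continuous_mk.comp_continuousOn
          fun v hv => (he₁ x v hv).contMDiffAt.continuousAt.continuousWithinAt
      · exact (OpenBookCut.continuousOn_tube H i).comp
          (fun v hv => (he₂ v).contMDiffAt.continuousAt.continuousWithinAt)
          fun v hv => ⟨mem_univ _, hball v hv⟩) (by
      rintro (x | i) U hU hUo
      · have h1 : IsOpen (e₁ x '' U) :=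
          IsLocalDiffeomorphOn.isOpen_image (fun v => he₁ x v.1 v.2) hUo hU
        have h2 := OpenBookCut.isOpen_mk_image (h := h) H h1 (by
          rintro _ ⟨v, hv, rfl⟩
          exact ⟨hint₁ x v (hU hv), mem_univ _⟩)
        rwa [image_image] at h2
      · have h1 : IsOpen (e₂ '' U) :=
          IsLocalDiffeomorphOn.isOpen_image (Ω := Ω₂) (fun v => he₂ v.1) hUo hU
        have h2 := OpenBookCut.isOpen_tube_image (h := h) H i h1 (by
          rintro _ ⟨v, hv, rfl⟩
          exact ⟨mem_univ _, hball v (hU hv)⟩)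
        rwa [image_image] at h2) (by
      rintro (x | i) v hv
      · obtain ⟨U, hU, hUi⟩ := (he₁ x v hv).exists_injOn
        have hW : (𝓡∂ 2).interior S ×ˢ Ioo ((e₁ x v).2 - π) ((e₁ x v).2 + π) ∈ 𝓝 (e₁ x v) :=
          (isOpen_surface_interior.prod isOpen_Ioo).mem_nhds
            ⟨hint₁ x v hv, by linarith [Real.pi_pos], by linarith [Real.pi_pos]⟩
        refine ⟨U ∩ e₁ x ⁻¹' _, inter_mem hU
          ((he₁ x v hv).contMDiffAt.continuousAt.preimage_mem_nhds hW), ?_⟩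
        intro v₁ hv₁ v₂ hv₂ heq
        exact hUi hv₁.1 hv₂.1 (OpenBookCut.injOn_mk H _ hv₁.2 hv₂.2 heq)
      · obtain ⟨U, hU, hUi⟩ := (he₂ v).exists_injOn
        refine ⟨U ∩ Ω₂, inter_mem hU (hΩ₂.mem_nhds hv), ?_⟩
        intro v₁ hv₁ v₂ hv₂ heq
        exact hUi hv₁.1 hv₂.1
          (OpenBookCut.tube_injective H (hball _ hv₁.2) (hball _ hv₂.2) heq).2) (by
      intro m
      obtain ⟨a, rfl⟩ := OpenBookCut.isQuotientMap_mk.surjective m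
      by_cases ha : a.1 ∈ (𝓡∂ 2).interior S
      · obtain ⟨v, hv, hva⟩ := hexists₁ a ha
        exact ⟨Sum.inl a.1, v, hv, congrArg (OpenBookCut.mk ψ γ h) hva⟩
      · obtain ⟨i, b, hib⟩ := OpenBookCut.exists_tube_eq_of_boundary (h := h) H
          (mem_boundary_iff_notMem_interior.2 ha) a.2
        obtain ⟨v, hv, hvb⟩ := hexists₂ (b, 0) (by simpa using H.collar.pos)
        exact ⟨Sum.inr i, v, hv, (congrArg (OpenBookCut.tube ψ γ h c i) hvb).trans hib⟩) (by
      rintro (x | i) (x' | j) v hv v' hv' heq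
      · obtain ⟨g, hg, hga, hgm⟩ := OpenBookCut.exists_transition_mk H (hint₁ x v hv) heq
        exact exists_transition (q := OpenBookCut.mk ψ γ h) (q' := OpenBookCut.mk ψ γ h)
          (he₁ x v hv) (he₁ x' v' hv') ⟨g, hg.contMDiffAt, hga, Eventually.of_forall hgm⟩
      · exact exists_transition (q := OpenBookCut.mk ψ γ h) (q' := OpenBookCut.tube ψ γ h c j)
          (he₁ x v hv) (he₂ v')
          (OpenBookCut.exists_transition_mk_tube H (hint₁ x v hv) (hball _ hv') heq)
      · exact exists_transition (q := OpenBookCut.tube ψ γ h c i) (q' := OpenBookCut.mk ψ γ h)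
          (he₂ v) (he₁ x' v' hv')
          (OpenBookCut.exists_transition_tube_mk H (hint₁ x' v' hv') (hball _ hv) heq)
      · obtain ⟨rfl, h2⟩ := OpenBookCut.tube_injective H (hball _ hv) (hball _ hv') heq
        exact exists_transition (q := OpenBookCut.tube ψ γ h c i)
          (q' := OpenBookCut.tube ψ γ h c i) (he₂ v) (he₂ v')
          ⟨id, contMDiffAt_id, h2, Eventually.of_forall fun _ => rfl⟩)
  refine ⟨C, hC, ?_, ?_⟩
  · rintro ⟨a, ha, -⟩
    obtain ⟨v, hv, hva⟩ := hexists₁ a ha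
    have h1 : IsLocalDiffeomorphAt (𝓡 3) (𝓡 3) ∞ (OpenBookCut.mk ψ γ h ∘ e₁ a.1) v :=
      hf (Sum.inl a.1) ⟨v, hv⟩
    have h2 := (he₁ a.1 v hv).of_comp h1
    rwa [hva] at h2
  · rintro i ⟨y, -, hy⟩
    obtain ⟨v, hv, hvy⟩ := hexists₂ y hy
    have h1 : IsLocalDiffeomorphAt (𝓡 3) (𝓡 3) ∞ (OpenBookCut.tube ψ γ h c i ∘ e₂) v :=
      hf (Sum.inr i) ⟨v, hv⟩
    have h2 := (he₂ v).of_comp h1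
    rwa [hvy] at h2

end CutManifold

/-! ### The open book -/

section InteriorManifold

variable {S : Type u} [TopologicalSpace S] [ChartedSpace (EuclideanHalfSpace 2) S]
  [IsManifold (𝓡∂ 2) ∞ S]

/-- The interior of a surface is a surface without boundary. -/
theorem exists_isManifold_interior [T2Space S] :
    ∃ (_ : ChartedSpace (EuclideanSpace ℝ (Fin 2)) ((𝓡∂ 2).interior S))
      (_ : IsManifold (𝓡 2) ∞ ((𝓡∂ 2).interior S)),
      ∀ x, IsLocalDiffeomorphAt (𝓡 2) (𝓡∂ 2) ∞ (Subtype.val : (𝓡∂ 2).interior S → S) x := by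
  classical
  let Ω : (𝓡∂ 2).interior S → Set (EuclideanSpace ℝ (Fin 2)) := fun x =>
    (extChartAt (𝓡∂ 2) x.1).target ∩ {u | 0 < u 0}
  have hΩ : ∀ x, IsOpen (Ω x) := fun x => isOpen_extChartAt_target_pos x.1
  have hld : ∀ x, ∀ u ∈ Ω x, IsLocalDiffeomorphAt (𝓡 2) (𝓡∂ 2) ∞ (extChartAt (𝓡∂ 2) x.1).symm u :=
    fun x u hu => isLocalDiffeomorphAt_extChartAt_symm x.1 hu
  have hint : ∀ x, ∀ u ∈ Ω x, (extChartAt (𝓡∂ 2) x.1).symm u ∈ (𝓡∂ 2).interior S := by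
    intro x u hu
    have h1 := (extChartAt (𝓡∂ 2) x.1).map_target hu.1
    rw [extChartAt_source] at h1
    rw [← extChartAt_zero_pos_iff x.1 h1, (extChartAt (𝓡∂ 2) x.1).right_inv hu.1]
    exact hu.2
  let f : (𝓡∂ 2).interior S → EuclideanSpace ℝ (Fin 2) → (𝓡∂ 2).interior S := fun x u =>
    if hu : u ∈ Ω x then ⟨(extChartAt (𝓡∂ 2) x.1).symm u, hint x u hu⟩ else x
  have hf : ∀ x, ∀ u ∈ Ω x, (f x u : S) = (extChartAt (𝓡∂ 2) x.1).symm u := by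
    intro x u hu
    simp only [f, dif_pos hu]
  have hexists : ∀ x : (𝓡∂ 2).interior S, ∃ u ∈ Ω x, f x u = x := by
    intro x
    have h1 : extChartAt (𝓡∂ 2) x.1 x.1 ∈ Ω x :=
      ⟨mem_extChartAt_target x.1, (extChartAt_zero_pos_iff x.1 (mem_chart_source _ x.1)).2 x.2⟩
    exact ⟨_, h1, Subtype.ext ((hf x _ h1).trans (extChartAt_to_inv x.1))⟩
  obtain ⟨C, hC, hd⟩ := exists_isManifold_of_parametrizations (Ω := Ω) (f := f) hΩ (by
      intro x
      rw [IsInducing.subtypeVal.continuousOn_iff]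
      exact ContinuousOn.congr (f := (extChartAt (𝓡∂ 2) x.1).symm)
        (fun u hu => (hld x u hu).contMDiffAt.continuousAt.continuousWithinAt) (hf x)) (by
      intro x U hU hUo
      have h1 : IsOpen ((extChartAt (𝓡∂ 2) x.1).symm '' U) :=
        IsLocalDiffeomorphOn.isOpen_image (fun u => hld x u.1 u.2) hUo hU
      have h2 : f x '' U = Subtype.val ⁻¹' ((extChartAt (𝓡∂ 2) x.1).symm '' U) := by
        ext y
        constructor
        · rintro ⟨u, hu, rfl⟩; exact ⟨u, hu, (hf x u (hU hu)).symm⟩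
        · rintro ⟨u, hu, huy⟩; exact ⟨u, hu, Subtype.ext ((hf x u (hU hu)).trans huy)⟩
      rw [h2]
      exact h1.preimage continuous_subtype_val) (by
      intro x u hu
      obtain ⟨U, hU, hUi⟩ := (hld x u hu).exists_injOn
      refine ⟨U ∩ Ω x, inter_mem hU ((hΩ x).mem_nhds hu), ?_⟩
      intro v hv v' hv' heq
      refine hUi hv.1 hv'.1 ?_
      rw [← hf x v hv.2, ← hf x v' hv'.2, heq]) (by
      intro x
      obtain ⟨u, hu, hux⟩ := hexists x
      exact ⟨x, u, hu, hux⟩) (by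
      intro x x' u hu u' hu' heq
      obtain ⟨g, hg, hgu, hge⟩ := exists_transition (q := (id : S → S)) (q' := (id : S → S))
        (hld x u hu) (hld x' u' hu') ⟨id, contMDiffAt_id, by
          simp only [id]
          rw [← hf x u hu, ← hf x' u' hu', heq], Eventually.of_forall fun _ => rfl⟩
      refine ⟨g, hg, hgu, ?_⟩
      have h1 : ∀ᶠ v in 𝓝 u, g v ∈ Ω x' :=
        hg.continuousAt.eventually_mem ((hΩ x').mem_nhds (by rw [hgu]; exact hu'))
      filter_upwards [hge, h1, (hΩ x).mem_nhds hu] with v hv hv' hvx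
      exact Subtype.ext (by rw [hf x' _ hv', hf x v hvx]; exact hv))
  refine ⟨C, hC, fun x => ?_⟩
  obtain ⟨u, hu, hux⟩ := hexists x
  have h1 : IsLocalDiffeomorphAt (𝓡 2) (𝓡 2) ∞ (f x) u := hd x ⟨u, hu⟩
  have h2 : IsLocalDiffeomorphAt (𝓡 2) (𝓡∂ 2) ∞ (Subtype.val ∘ f x) u := by
    refine (hld x u hu).congr_of_eventuallyEq ?_
    filter_upwards [(hΩ x).mem_nhds hu] with v hv
    exact hf x v hv
  have h3 := h1.of_comp h2
  rwa [hux] at h3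

end InteriorManifold

section OpenBook

variable {S : Type u} [TopologicalSpace S] [ChartedSpace (EuclideanHalfSpace 2) S]

/-- The binding of the open book: the image of the boundary of the mapping torus. -/
def OpenBookCut.binding (ψ : S → S) {k : ℕ} (γ : Fin k → Circle → S) (h : Fin k → ℤ) :
    Set (OpenBookCut ψ γ h) :=
  OpenBookCut.mk ψ γ h '' ((𝓡∂ 2).boundary S ×ˢ univ)

open Classical in
/-- The projection of the open book, given by the coordinate `s` of the mapping torus. The value on
the binding is arbitrary. -/
noncomputable def OpenBookCut.angular (ψ : S → S) {k : ℕ} (γ : Fin k → Circle → S)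
    (h : Fin k → ℤ) (m : OpenBookCut ψ γ h) : Circle :=
  if H : ∃ a : S × ℝ, a.1 ∈ (𝓡∂ 2).interior S ∧ OpenBookCut.mk ψ γ h a = m then
    Circle.exp H.choose.2 else 1

variable {ψ : Diffeomorph (𝓡∂ 2) (𝓡∂ 2) S S ∞} {k : ℕ} {γ : Fin k → Circle → S} {h : Fin k → ℤ}
  {ε : ℝ} {c : Fin k → ℝ × Circle → S}

/-- A smooth structure on the cut for which the quotient map is a local diffeomorphism on the
interior, and the parametrizations of the tubular neighbourhoods are local diffeomorphisms. -/
structure IsSmoothCut (ψ : Diffeomorph (𝓡∂ 2) (𝓡∂ 2) S S ∞) {k : ℕ} (γ : Fin k → Circle → S)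
    (h : Fin k → ℤ) (ε : ℝ) (c : Fin k → ℝ × Circle → S)
    [ChartedSpace (EuclideanSpace ℝ (Fin 3)) (OpenBookCut ψ γ h)] : Prop
    extends IsCutCollar ψ γ ε c where
  mk_localDiffeo : IsLocalDiffeomorphOn ((𝓡∂ 2).prod 𝓘(ℝ, ℝ)) (𝓡 3) ∞ (OpenBookCut.mk ψ γ h)
    ((𝓡∂ 2).interior S ×ˢ univ)
  tube_localDiffeo : ∀ i, IsLocalDiffeomorphOn ((𝓡 1).prod 𝓘(ℝ, ℂ)) (𝓡 3) ∞
    (OpenBookCut.tube ψ γ h c i) (univ ×ˢ Metric.ball 0 (√ε))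

section Topological

variable (H : IsCutCollar ψ γ ε c)
include H

namespace OpenBookCut

theorem angular_mk {x : S} (hx : x ∈ (𝓡∂ 2).interior S) (s : ℝ) :
    angular ψ γ h (mk ψ γ h (x, s)) = Circle.exp s := by
  have hex : ∃ a : S × ℝ, a.1 ∈ (𝓡∂ 2).interior S ∧ mk ψ γ h a = mk ψ γ h (x, s) :=
    ⟨(x, s), hx, rfl⟩
  rw [angular, dif_pos hex]
  obtain ⟨h1, h2⟩ := hex.choose_spec
  obtain ⟨n, -, h3⟩ := (mk_eq_mk_iff_of_interior H h1).1 h2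
  rw [h3, Circle.exp_add, Circle.exp_int_mul_two_pi, mul_one]

theorem binding_eq : binding ψ γ h = {m | ∃ i b, tube ψ γ h c i (b, 0) = m} := by
  ext m
  rw [mem_ofPred_eq]
  constructor
  · rintro ⟨⟨x, s⟩, ⟨hx, -⟩, rfl⟩
    obtain ⟨i, b, hib⟩ := exists_tube_eq_of_boundary (h := h) H hx s
    exact ⟨i, b, hib⟩
  · rintro ⟨i, b, rfl⟩
    rw [tube_zero H]
    exact ⟨(γ i b, 0), ⟨H.coordinates.mem_boundary i b, mem_univ _⟩, rfl⟩

theorem angular_tube (i : Fin k) (b : Circle) {ρ : ℝ} (hρ : 0 < ρ) (hρε : ρ < √ε) (s : ℝ) :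
    angular ψ γ h (tube ψ γ h c i (b, ρ * (Circle.exp s : ℂ))) = Circle.exp s := by
  have h1 : ρ ^ 2 < ε := (Real.lt_sqrt hρ.le).1 hρε
  rw [tube_eq H hρ.le h1, angular_mk H]
  exact H.collar.mem_interior H.coordinates ⟨by linarith, by nlinarith⟩

theorem page_boundary : page ψ γ h '' (𝓡∂ 2).boundary S = binding ψ γ h := by
  rw [binding_eq H]
  ext m
  constructor
  · rintro ⟨x, hx, rfl⟩
    obtain ⟨i, z, rfl⟩ := H.coordinates.exists_eq hx
    exact ⟨i, z, tube_zero H i z⟩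
  · rintro ⟨i, b, rfl⟩
    exact ⟨γ i b, H.coordinates.mem_boundary i b, (tube_zero H i b).symm⟩

theorem page_injective : Function.Injective (page ψ γ h) := fun _ _ hx => mk_page_injective H hx

/-- Every point with angular coordinate `e^{is}` lies on the page over `s`. -/
theorem exists_mk_eq_of_exp {x : S} {s t : ℝ} (hst : Circle.exp s = Circle.exp t) :
    ∃ n : ℤ, mk ψ γ h (x, s) = mk ψ γ h (iter ψ n x, t) := by
  obtain ⟨n, hn⟩ := Circle.exp_eq_exp.1 hst
  exact ⟨n, by rw [mk_iter H, hn]⟩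

variable [IsManifold (𝓡∂ 2) ∞ S]

theorem mk_mem_binding_iff {a : S × ℝ} : mk ψ γ h a ∈ binding ψ γ h ↔ a.1 ∉ (𝓡∂ 2).interior S := by
  constructor
  · rintro ⟨a', ⟨ha', -⟩, heq⟩
    rw [← H.mem_interior_iff_of_mk_eq heq]
    exact mem_boundary_iff_notMem_interior.1 ha'
  · intro ha
    exact ⟨a, ⟨mem_boundary_iff_notMem_interior.2 ha, mem_univ _⟩, rfl⟩

theorem compl_binding : (binding ψ γ h)ᶜ = mk ψ γ h '' ((𝓡∂ 2).interior S ×ˢ univ) := by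
  ext m
  obtain ⟨a, rfl⟩ := isQuotientMap_mk.surjective m
  rw [mem_compl_iff, mk_mem_binding_iff H, not_not]
  constructor
  · intro ha; exact ⟨a, ⟨ha, mem_univ _⟩, rfl⟩
  · rintro ⟨a', ⟨ha', -⟩, heq⟩
    rwa [← H.mem_interior_iff_of_mk_eq heq]

theorem exists_mk_of_notMem_binding {m : OpenBookCut ψ γ h} (hm : m ∉ binding ψ γ h) :
    ∃ x ∈ (𝓡∂ 2).interior S, ∃ s, mk ψ γ h (x, s) = m := by
  rw [← mem_compl_iff, compl_binding H] at hm
  obtain ⟨⟨x, s⟩, ⟨hx, -⟩, rfl⟩ := hm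
  exact ⟨x, hx, s, rfl⟩

theorem isClosed_binding : IsClosed (binding ψ γ h) := by
  rw [← isOpen_compl_iff, compl_binding H]
  exact isOpen_mk_image H (isOpen_surface_interior.prod isOpen_univ) Subset.rfl

/-- The quotient map is a bijection of the interior of the mapping torus onto the complement of the
binding. -/
theorem bijOn_proj : BijOn (proj ψ γ h) (MappingTorus.mk ψ '' ((𝓡∂ 2).interior S ×ˢ univ))
    (binding ψ γ h)ᶜ := by
  rw [compl_binding H]
  refine ⟨?_, ?_, ?_⟩
  · rintro _ ⟨a, ha, rfl⟩; exact ⟨a, ha, rfl⟩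
  · rintro _ ⟨⟨x, s⟩, ha, rfl⟩ _ ⟨⟨x', s'⟩, hb, rfl⟩ heq
    obtain ⟨n, h1, h2⟩ := (mk_eq_mk_iff_of_interior H ha.1).1 heq
    simp only at h1 h2
    rw [h1, h2, MappingTorus.mk_iter]
  · rintro _ ⟨a, ha, rfl⟩; exact ⟨_, ⟨a, ha, rfl⟩, rfl⟩

variable [CompactSpace S] [T2Space S]

theorem isClosedEmbedding_page : IsClosedEmbedding (page ψ γ h) := by
  have := t2Space (h := h) H
  exact (continuous_mk.comp (by fun_prop : Continuous fun x : S => (x, (0 : ℝ)))).isClosedEmbedding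
    (page_injective H)

theorem range_page : range (page ψ γ h) =
    closure ((binding ψ γ h)ᶜ ∩ angular ψ γ h ⁻¹' {1}) := by
  apply Subset.antisymm
  · have h1 : page ψ γ h '' (𝓡∂ 2).interior S ⊆ (binding ψ γ h)ᶜ ∩ angular ψ γ h ⁻¹' {1} := by
      rintro _ ⟨x, hx, rfl⟩
      refine ⟨fun hb => (mk_mem_binding_iff H).1 hb hx, ?_⟩
      rw [mem_preimage, page, angular_mk H hx]; simp
    have h2 : ∀ x : S, x ∈ closure ((𝓡∂ 2).interior S) := by
      intro x
      by_cases hx : x ∈ (𝓡∂ 2).interior S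
      · exact subset_closure hx
      obtain ⟨i, z, rfl⟩ := H.coordinates.exists_eq (mem_boundary_iff_notMem_interior.2 hx)
      have h3 : ContinuousWithinAt (c i) (Ioo (-ε) 0 ×ˢ univ) (0, z) :=
        ((H.collar.contMDiffOn i).continuousOn (0, z) ⟨H.collar.zero_mem, mem_univ _⟩).mono
          (prod_mono Ioo_subset_Ioc_self Subset.rfl)
      have h4 : ((0 : ℝ), z) ∈ closure (Ioo (-ε) 0 ×ˢ (univ : Set Circle)) := by
        rw [closure_prod_eq, closure_Ioo (by linarith [H.collar.pos])]
        exact ⟨⟨by linarith [H.collar.pos], le_rfl⟩, subset_closure (mem_univ _)⟩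
      have h5 := h3.mem_closure_image h4
      rw [H.collar.boundary] at h5
      refine closure_mono ?_ h5
      rintro _ ⟨⟨τ, w⟩, ⟨hτ, -⟩, rfl⟩
      exact H.collar.mem_interior H.coordinates hτ
    rintro _ ⟨x, rfl⟩
    exact closure_mono h1 (image_closure_subset_closure_image
      (isClosedEmbedding_page H).continuous ⟨x, h2 x, rfl⟩)
  · refine closure_minimal ?_ (isClosedEmbedding_page H).isClosed_range
    rintro m ⟨hm, hp⟩
    obtain ⟨x, hx, s, rfl⟩ := exists_mk_of_notMem_binding H hm
    rw [mem_preimage, angular_mk H hx, mem_singleton_iff, ← Circle.exp_zero] at hp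
    obtain ⟨n, hn⟩ := exists_mk_eq_of_exp (h := h) (x := x) H hp
    exact ⟨_, hn.symm⟩

end OpenBookCut

end Topological

section Smooth

variable [ChartedSpace (EuclideanSpace ℝ (Fin 3)) (OpenBookCut ψ γ h)]
  (H : IsSmoothCut ψ γ h ε c)
include H

namespace OpenBookCut

/-- The coordinate `s` is the angle of the discs in the tubular neighbourhoods. -/
theorem isAdaptedTube :
    IsAdaptedTube (binding ψ γ h) (angular ψ γ h) (tube ψ γ h c) (√ε) where
  pos := Real.sqrt_pos.2 H.collar.pos
  localDiffeo := H.tube_localDiffeo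
  injective _ _ _ hy _ hy' heq := tube_injective H.toIsCutCollar hy.2 hy'.2 heq
  binding := binding_eq H.toIsCutCollar
  angular i b _ s hρ hρε := angular_tube H.toIsCutCollar i b hρ hρε s

variable [IsManifold (𝓡∂ 2) ∞ S]

theorem contMDiffAt_angular {m : OpenBookCut ψ γ h} (hm : m ∉ binding ψ γ h) :
    ContMDiffAt (𝓡 3) (𝓡 1) ∞ (angular ψ γ h) m := by
  obtain ⟨x, hx, s, rfl⟩ := exists_mk_of_notMem_binding H.toIsCutCollar hm
  refine (H.mk_localDiffeo ⟨(x, s), hx, mem_univ _⟩).contMDiffAt_of_comp ?_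
  have h1 : ContMDiffAt ((𝓡∂ 2).prod 𝓘(ℝ, ℝ)) (𝓡 1) ∞ (fun a : S × ℝ => Circle.exp a.2) (x, s) :=
    (contMDiff_circleExp.comp contMDiff_snd).contMDiffAt
  refine h1.congr_of_eventuallyEq ?_
  filter_upwards [(isOpen_surface_interior.prod isOpen_univ).mem_nhds
    (show (x, s) ∈ (𝓡∂ 2).interior S ×ˢ (univ : Set ℝ) from ⟨hx, mem_univ _⟩)] with a ha
  exact angular_mk H.toIsCutCollar ha.1 a.2

variable [T2Space S]

/-- Over an arc of the circle, on which the angle has a smooth branch, the mapping torus of the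
interior is trivial. -/
theorem isSmoothFibrationOff : IsSmoothFibrationOff (binding ψ γ h) (angular ψ γ h) where
  isClosed := isClosed_binding H.toIsCutCollar
  contMDiffOn _ hm := (contMDiffAt_angular H hm).contMDiffWithinAt
  locally_trivial := by
    intro w
    set t := Complex.arg w with ht
    have hw : w = Circle.exp t := (Circle.exp_arg w).symm
    have hangle : ∀ w' ∈ {w' : Circle | ((w' / Circle.exp t : Circle) : ℂ) ∈ Complex.slitPlane},
        Circle.angle t w' ∈ Ioo (t - π) (t + π) := by
      intro w' hw'
      have h1 := (Complex.mem_slitPlane_iff_arg.1 hw').1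
      have h2 := Complex.arg_mem_Ioc ((w' / Circle.exp t : Circle) : ℂ)
      have h3 := lt_of_le_of_ne h2.2 h1
      rw [Circle.angle]
      exact ⟨by linarith [h2.1], by linarith⟩
    obtain ⟨C, hC, hval⟩ := exists_isManifold_interior (S := S)
    refine ⟨_, Circle.isOpen_slitPlane_div t, by
      rw [hw]; exact Circle.exp_mem_slitPlane_div t, (𝓡∂ 2).interior S, inferInstance, C, hC,
      fun y => mk ψ γ h (y.2.1, Circle.angle t y.1), ?_, ?_, ?_, ?_⟩
    · rintro ⟨⟨w', x⟩, hw', -⟩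
      have h1 : IsLocalDiffeomorphAt (𝓡 1) 𝓘(ℝ, ℝ) ∞ (Circle.angle t) w' := by
        have h2 := Circle.isLocalDiffeomorphAt_exp (Circle.angle t w')
        have h3 : IsLocalDiffeomorphAt 𝓘(ℝ, ℝ) 𝓘(ℝ, ℝ) ∞
            (Circle.angle t ∘ fun s : ℝ => Circle.exp s) (Circle.angle t w') := by
          refine ((Diffeomorph.refl 𝓘(ℝ, ℝ) ℝ ∞).isLocalDiffeomorph _).congr_of_eventuallyEq ?_
          have h4 := hangle w' hw'
          filter_upwards [Ioo_mem_nhds h4.1 h4.2] with s hs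
          exact Circle.angle_exp (by rw [abs_lt]; constructor <;> linarith [hs.1, hs.2])
        have h5 := h2.of_comp h3
        rwa [Circle.exp_angle] at h5
      have h2 : IsLocalDiffeomorphAt ((𝓡 1).prod (𝓡 2)) ((𝓡∂ 2).prod 𝓘(ℝ, ℝ)) ∞
          (Prod.swap ∘ Prod.map (Circle.angle t) (Subtype.val : (𝓡∂ 2).interior S → S)) (w', x) :=
        IsLocalDiffeomorphAt.comp ((𝓡∂ 2).prod 𝓘(ℝ, ℝ)) (S × ℝ) (h1.prodMap (hval x))
          ((Diffeomorph.prodComm 𝓘(ℝ, ℝ) (𝓡∂ 2) ℝ S ∞).isLocalDiffeomorph _)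
      exact IsLocalDiffeomorphAt.comp (g := mk ψ γ h) (𝓡 3) (OpenBookCut ψ γ h) h2
        (H.mk_localDiffeo ⟨(x.1, Circle.angle t w'), x.2, mem_univ _⟩)
    · rintro ⟨w₁, x₁⟩ ⟨h₁, -⟩ ⟨w₂, x₂⟩ ⟨h₂, -⟩ heq
      have h3 := injOn_mk H.toIsCutCollar t (x₁ := (x₁.1, Circle.angle t w₁))
        (x₂ := (x₂.1, Circle.angle t w₂)) ⟨x₁.2, hangle w₁ h₁⟩ ⟨x₂.2, hangle w₂ h₂⟩ heq
      obtain ⟨h4, h5⟩ := Prod.ext_iff.1 h3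
      simp only at h4 h5
      rw [← Circle.exp_angle t w₁, ← Circle.exp_angle t w₂, h5, Subtype.ext h4]
    · ext m
      constructor
      · rintro ⟨⟨w', x⟩, ⟨hw', -⟩, rfl⟩
        refine ⟨fun hb => (mk_mem_binding_iff H.toIsCutCollar).1 hb x.2, ?_⟩
        rw [mem_preimage]
        simp only
        rw [angular_mk H.toIsCutCollar x.2, Circle.exp_angle]
        exact hw'
      · rintro ⟨hm, hp⟩
        obtain ⟨x, hx, s, rfl⟩ := exists_mk_of_notMem_binding H.toIsCutCollar hm
        rw [mem_preimage, angular_mk H.toIsCutCollar hx] at hp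
        obtain ⟨n, hn⟩ := exists_mk_eq_of_exp (h := h) (x := x) H.toIsCutCollar
          (Circle.exp_angle t (Circle.exp s)).symm
        exact ⟨(Circle.exp s, ⟨iter ψ n x, (iter_mem_interior_iff ψ n x).2 hx⟩),
          ⟨hp, mem_univ _⟩, hn.symm⟩
    · rintro ⟨w', x⟩ -
      simp only
      rw [angular_mk H.toIsCutCollar x.2, Circle.exp_angle]

theorem isOpenBook : IsOpenBook (binding ψ γ h) (angular ψ γ h) :=
  ⟨isSmoothFibrationOff H, k, _, _, isAdaptedTube H⟩

end OpenBookCut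

end Smooth

end OpenBook

/-! ### Flows and vector fields -/

section Flow

variable {M : Type u} [TopologicalSpace M] [ChartedSpace (EuclideanSpace ℝ (Fin 3)) M]

/-- A smooth one-parameter group of maps is the flow of a smooth vector field. -/
theorem exists_contMDiff_field_of_flow [IsManifold (𝓡 3) ∞ M] {Φ : ℝ → M → M}
    (hΦ : ContMDiff (𝓘(ℝ, ℝ).prod (𝓡 3)) (𝓡 3) ∞ (fun y : ℝ × M => Φ y.1 y.2))
    (h0 : ∀ x, Φ 0 x = x) (hadd : ∀ s t x, Φ (s + t) x = Φ s (Φ t x)) :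
    ∃ X : ∀ x : M, TangentSpace (𝓡 3) x,
      ContMDiff (𝓡 3) (𝓡 3).tangent ∞ (fun x => (⟨x, X x⟩ : TangentBundle (𝓡 3) M)) ∧
      ∀ x, IsMIntegralCurve (fun t => Φ t x) X := by
  let X : ∀ x : M, TangentSpace (𝓡 3) x := fun x =>
    mfderiv (𝓘(ℝ, ℝ).prod (𝓡 3)) (𝓡 3) (fun y : ℝ × M => Φ y.1 y.2) (0, x) ((1 : ℝ), 0)
  have hd : ∀ y : ℝ × M, HasMFDerivAt (𝓘(ℝ, ℝ).prod (𝓡 3)) (𝓡 3) (fun y : ℝ × M => Φ y.1 y.2) y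
      (mfderiv (𝓘(ℝ, ℝ).prod (𝓡 3)) (𝓡 3) (fun y : ℝ × M => Φ y.1 y.2) y) :=
    fun y => ((hΦ y).mdifferentiableAt (by simp)).hasMFDerivAt
  refine ⟨X, ?_, ?_⟩
  · -- `X` is the tangent map of the flow, applied to the smooth section `x ↦ ((0, x), (1, 0))`
    have h1 := hΦ.contMDiff_tangentMap (m := ∞) (by simp)
    have h2 : ContMDiff (𝓡 3) (𝓘(ℝ, ℝ).prod (𝓡 3)).tangent ∞
        (fun x : M => (⟨(0, x), ((1 : ℝ), 0)⟩ : TangentBundle (𝓘(ℝ, ℝ).prod (𝓡 3)) (ℝ × M))) := by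
      have h3 : ContMDiff (𝓡 3) (𝓡 3).tangent ∞
          (fun x : M => (⟨x, 0⟩ : TangentBundle (𝓡 3) M)) :=
        Bundle.contMDiff_zeroSection ℝ (TangentSpace (𝓡 3) : M → Type _)
      have h4 : ContMDiff (𝓡 3) (𝓘(ℝ, ℝ).tangent.prod (𝓡 3).tangent) ∞
          (fun x : M => ((⟨0, (1 : ℝ)⟩ : TangentBundle 𝓘(ℝ, ℝ) ℝ),
            (⟨x, 0⟩ : TangentBundle (𝓡 3) M))) := contMDiff_const.prodMk h3
      exact (contMDiff_equivTangentBundleProd_symm (n := ∞)).comp h4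
    have h3 := h1.comp h2
    have h4 : ∀ (x y : M) (_ : x = y) (v : EuclideanSpace ℝ (Fin 3)),
        (⟨x, v⟩ : TangentBundle (𝓡 3) M) = ⟨y, v⟩ := by
      rintro x _ rfl v; rfl
    refine h3.congr fun x => ?_
    exact (h4 _ _ (h0 x) _).symm
  · -- differentiate `Φ s x = Φ (s - t) (Φ t x)` at `s = t`
    intro x t
    have h1 : HasMFDerivAt 𝓘(ℝ, ℝ) (𝓘(ℝ, ℝ).prod (𝓡 3)) (fun s : ℝ => (s - t, Φ t x)) t
        ((ContinuousLinearMap.id ℝ ℝ).prod (0 : ℝ →L[ℝ] EuclideanSpace ℝ (Fin 3))) := by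
      refine HasMFDerivAt.prodMk ?_ (hasMFDerivAt_const _ _)
      exact ((hasFDerivAt_id (𝕜 := ℝ) t).sub_const t).hasMFDerivAt
    have h2 := HasMFDerivAt.comp (g := fun y : ℝ × M => Φ y.1 y.2) t (hd _) h1
    have h3 : (fun y : ℝ × M => Φ y.1 y.2) ∘ (fun s : ℝ => (s - t, Φ t x)) = fun s => Φ s x := by
      ext s
      simp only [Function.comp_apply]
      rw [← hadd, sub_add_cancel]
    rw [h3] at h2
    have h4 : ∀ y : ℝ × M, y = (0, Φ t x) →
        (mfderiv (𝓘(ℝ, ℝ).prod (𝓡 3)) (𝓡 3) (fun y : ℝ × M => Φ y.1 y.2) y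
          ((1 : ℝ), (0 : EuclideanSpace ℝ (Fin 3))) : EuclideanSpace ℝ (Fin 3)) = X (Φ t x) := by
      rintro _ rfl; rfl
    have h5 := h4 (t - t, Φ t x) (by simp)
    refine h2.congr_mfderiv ?_
    refine ContinuousLinearMap.ext_ring ?_
    refine Eq.trans ?_ (h5.trans ?_)
    · rfl
    · exact (one_smul ℝ (X (Φ t x))).symm

/-- If `p` moves with unit speed along the integral curve of `X`, then `X` lifts `∂_s` there. -/
theorem mfderiv_eq_circleField {p : M → Circle} {X : ∀ x : M, TangentSpace (𝓡 3) x} {g : ℝ → M}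
    (hg : IsMIntegralCurve g X) (hp : MDifferentiableAt (𝓡 3) (𝓡 1) p (g 0))
    (h : ∀ t, p (g t) = p (g 0) * Circle.exp t) :
    mfderiv (𝓡 3) (𝓡 1) p (g 0) (X (g 0)) = circleField (p (g 0)) := by
  have h1 := HasMFDerivAt.comp (g := p) (0 : ℝ) hp.hasMFDerivAt (hg 0)
  have h2 : p ∘ g = fun t => p (g 0) * Circle.exp t := funext h
  rw [h2] at h1
  have h3 : MDifferentiableAt 𝓘(ℝ, ℝ) (𝓡 1) (fun t : ℝ => p (g 0) * Circle.exp t) 0 :=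
    ((contMDiff_const.mul contMDiff_circleExp).contMDiffAt (n := ∞)).mdifferentiableAt (by simp)
  have h4 := hasMFDerivAt_unique h1 h3.hasMFDerivAt
  have h5 := congrArg (fun L : ℝ →L[ℝ] EuclideanSpace ℝ (Fin 1) => L 1) h4
  refine Eq.trans ?_ h5
  change _ = mfderiv (𝓡 3) (𝓡 1) p (g 0) ((1 : ℝ) • X (g 0))
  rw [one_smul]

end Flow

/-! ### The Dehn twist flow -/

section Twist

variable {S : Type u} {k : ℕ} {ε : ℝ} {c : Fin k → ℝ × Circle → S} {χ : Fin k → ℝ → ℝ}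

theorem boundaryTwist_of_notMem {x : S} (hx : ∀ i, x ∉ c i '' (Ioc (-ε) 0 ×ˢ univ)) :
    boundaryTwist ε c χ x = x := by
  rw [boundaryTwist, dif_neg]
  rintro ⟨⟨i, y⟩, hy, heq⟩
  exact hx i ⟨y, ⟨hy, mem_univ _⟩, heq⟩

/-- The flow of the vector field `χ_i(τ) ∂_θ` on the collars, whose time `2π` map is the twist. -/
noncomputable def twistFlow (ε : ℝ) (c : Fin k → ℝ × Circle → S) (χ : Fin k → ℝ → ℝ) (t : ℝ) :
    S → S :=
  boundaryTwist ε c fun i τ => t / (2 * π) * χ i τ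

theorem twistFlow_two_pi : twistFlow ε c χ (2 * π) = boundaryTwist ε c χ := by
  rw [twistFlow, div_self Real.two_pi_pos.ne']
  simp

theorem twistFlow_of_notMem {x : S} (hx : ∀ i, x ∉ c i '' (Ioc (-ε) 0 ×ˢ univ)) (t : ℝ) :
    twistFlow ε c χ t x = x :=
  boundaryTwist_of_notMem hx

variable [TopologicalSpace S] [ChartedSpace (EuclideanHalfSpace 2) S]
  {ψ : Diffeomorph (𝓡∂ 2) (𝓡∂ 2) S S ∞} {γ : Fin k → Circle → S} {h : Fin k → ℤ}

theorem IsCollar.boundaryTwist_apply (hc : IsCollar γ ε c) {i : Fin k} {y : ℝ × Circle}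
    (hy : y.1 ∈ Ioc (-ε) 0) :
    boundaryTwist ε c χ (c i y) = c i (y.1, y.2 * Circle.exp (2 * π * χ i y.1)) := by
  have hex : ∃ y' : Fin k × ℝ × Circle, y'.2.1 ∈ Ioc (-ε) 0 ∧ c y'.1 y'.2 = c i y :=
    ⟨(i, y), hy, rfl⟩
  rw [boundaryTwist, dif_pos hex]
  obtain ⟨h1, h2⟩ := hex.choose_spec
  obtain ⟨h3, h4⟩ := hc.injective h1 hy h2
  rw [h3, h4]

theorem IsCollar.twistFlow_apply (hc : IsCollar γ ε c) {i : Fin k} {τ : ℝ} {w : Circle}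
    (hτ : τ ∈ Ioc (-ε) 0) (t : ℝ) :
    twistFlow ε c χ t (c i (τ, w)) = c i (τ, w * Circle.exp (t * χ i τ)) := by
  rw [twistFlow, hc.boundaryTwist_apply (y := (τ, w)) hτ]
  congr 3
  field_simp

theorem IsCollar.twistFlow_zero (hc : IsCollar γ ε c) (x : S) : twistFlow ε c χ 0 x = x := by
  by_cases hx : ∃ i, x ∈ c i '' (Ioc (-ε) 0 ×ˢ univ)
  · obtain ⟨i, ⟨τ, w⟩, hy, rfl⟩ := hx
    rw [hc.twistFlow_apply hy.1]; simp
  · exact twistFlow_of_notMem (not_exists.1 hx) 0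

theorem IsCollar.twistFlow_add (hc : IsCollar γ ε c) (s t : ℝ) (x : S) :
    twistFlow ε c χ (s + t) x = twistFlow ε c χ s (twistFlow ε c χ t x) := by
  by_cases hx : ∃ i, x ∈ c i '' (Ioc (-ε) 0 ×ˢ univ)
  · obtain ⟨i, ⟨τ, w⟩, hy, rfl⟩ := hx
    rw [hc.twistFlow_apply hy.1, hc.twistFlow_apply hy.1, hc.twistFlow_apply hy.1, mul_assoc,
      ← Circle.exp_add]
    ring_nf
  · rw [twistFlow_of_notMem (not_exists.1 hx), twistFlow_of_notMem (not_exists.1 hx),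
      twistFlow_of_notMem (not_exists.1 hx)]

/-- The twist flow commutes with `ψ`, as `ψ` is the identity on the collars. -/
theorem IsCutCollar.twistFlow_iter (H : IsCutCollar ψ γ ε c) (t : ℝ) (n : ℤ) (x : S) :
    twistFlow ε c χ t (iter ψ n x) = iter ψ n (twistFlow ε c χ t x) := by
  by_cases hx : ∃ i, x ∈ c i '' (Ioc (-ε) 0 ×ˢ univ)
  · obtain ⟨i, ⟨τ, w⟩, hy, rfl⟩ := hx
    rw [H.iter_collar n hy.1, H.collar.twistFlow_apply hy.1]
    exact (H.iter_collar (i := i) (y := (τ, w * Circle.exp (t * χ i τ))) n hy.1).symm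
  · rw [twistFlow_of_notMem (not_exists.1 hx), twistFlow_of_notMem]
    rintro i ⟨y, hy, heq⟩
    refine hx ⟨i, y, hy, ?_⟩
    rw [← iter_neg_iter ψ n x, ← heq, H.iter_collar (-n) hy.1]

theorem IsCollar.contMDiff_twistFlow [T2Space S] (hc : IsCollar γ ε c)
    (hχ : ∀ i, IsTwistProfile ε (h i) (χ i)) :
    ContMDiff (𝓘(ℝ, ℝ).prod (𝓡∂ 2)) (𝓡∂ 2) ∞ (fun y : ℝ × S => twistFlow ε c χ y.1 y.2) := by
  rintro ⟨t, x⟩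
  by_cases hx : ∃ i, x ∈ c i '' (Ioc (-ε) 0 ×ˢ univ)
  · obtain ⟨i, hxi⟩ := hx
    obtain ⟨d, hd, hdc⟩ := hc.smooth_inverse i
    have hCo : IsOpen (c i '' (Ioc (-ε) 0 ×ˢ univ)) := hc.isOpen_image i
    have h1 : ContMDiffOn (𝓘(ℝ, ℝ).prod (𝓡∂ 2)) (𝓘(ℝ, ℝ).prod (𝓡 1)) ∞
        (fun y : ℝ × S => d y.2) (univ ×ˢ (c i '' (Ioc (-ε) 0 ×ˢ univ))) :=
      ContMDiffOn.comp (g := d) (f := Prod.snd) hd contMDiffOn_snd fun y hy => hy.2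
    have h2 : ContMDiff (𝓘(ℝ, ℝ).prod (𝓘(ℝ, ℝ).prod (𝓡 1))) (𝓘(ℝ, ℝ).prod (𝓡 1)) ∞
        (fun y : ℝ × ℝ × Circle => (y.2.1, y.2.2 * Circle.exp (y.1 * χ i y.2.1))) := by
      have h3 : ContMDiff (𝓘(ℝ, ℝ).prod (𝓘(ℝ, ℝ).prod (𝓡 1))) 𝓘(ℝ, ℝ) ∞
          (fun y : ℝ × ℝ × Circle => y.2.1) := contMDiff_fst.comp contMDiff_snd
      have h4 : ContMDiff (𝓘(ℝ, ℝ).prod (𝓘(ℝ, ℝ).prod (𝓡 1))) (𝓡 1) ∞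
          (fun y : ℝ × ℝ × Circle => y.2.2) := contMDiff_snd.comp contMDiff_snd
      have h5 : ContMDiff (𝓘(ℝ, ℝ).prod (𝓘(ℝ, ℝ).prod (𝓡 1))) 𝓘(ℝ, ℝ) ∞
          (fun y : ℝ × ℝ × Circle => y.1 * χ i y.2.1) :=
        ContMDiff.smul contMDiff_fst ((hχ i).contDiff.contMDiff.comp h3)
      exact h3.prodMk (h4.mul (contMDiff_circleExp.comp h5))
    have h6 : ContMDiffOn (𝓘(ℝ, ℝ).prod (𝓡∂ 2)) (𝓡∂ 2) ∞ (fun y : ℝ × S =>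
        c i ((d y.2).1, (d y.2).2 * Circle.exp (y.1 * χ i (d y.2).1)))
        (univ ×ˢ (c i '' (Ioc (-ε) 0 ×ˢ univ))) := by
      refine ContMDiffOn.comp (hc.contMDiffOn i)
        (h2.comp_contMDiffOn (contMDiffOn_fst.prodMk h1)) ?_
      rintro ⟨s, _⟩ ⟨-, y, hy, rfl⟩
      simp only [mem_preimage]
      rw [hdc y hy]
      exact ⟨hy.1, mem_univ _⟩
    have hmem : univ ×ˢ (c i '' (Ioc (-ε) 0 ×ˢ univ)) ∈ 𝓝 (t, x) :=
      (isOpen_univ.prod hCo).mem_nhds ⟨mem_univ _, hxi⟩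
    refine (h6.contMDiffAt hmem).congr_of_eventuallyEq ?_
    filter_upwards [hmem]
    rintro ⟨s, _⟩ ⟨-, ⟨τ, w⟩, hy, rfl⟩
    simp only
    rw [hdc _ hy, hc.twistFlow_apply hy.1]
  · -- near the complement of the collars the twist flow is the identity
    choose δ hδ hδχ using fun i => (hχ i).eq_zero
    have hcl : IsClosed (⋃ i, c i '' (Icc (-ε + δ i) 0 ×ˢ univ)) :=
      isClosed_iUnion_of_finite fun i => hc.isClosed_image_Icc i (by linarith [hδ i])
    refine contMDiffAt_snd.congr_of_eventuallyEq ?_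
    have hxm : x ∈ (⋃ i, c i '' (Icc (-ε + δ i) 0 ×ˢ univ))ᶜ := by
      intro hxm
      obtain ⟨i, y, hy, hyx⟩ := mem_iUnion.1 hxm
      exact hx ⟨i, y, ⟨⟨by linarith [hδ i, hy.1.1], hy.1.2⟩, mem_univ _⟩, hyx⟩
    filter_upwards [(isOpen_univ.prod hcl.isOpen_compl).mem_nhds
      (show (t, x) ∈ univ ×ˢ _ from ⟨mem_univ _, hxm⟩)]
    rintro ⟨s, x'⟩ ⟨-, hx'⟩
    by_cases hxc : ∃ i, x' ∈ c i '' (Ioc (-ε) 0 ×ˢ univ)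
    · obtain ⟨i, ⟨τ, w⟩, hy, rfl⟩ := hxc
      have hτ : τ ≤ -ε + δ i := by
        by_contra hτ
        exact hx' (mem_iUnion.2 ⟨i, (τ, w), ⟨⟨(not_le.1 hτ).le, hy.1.2⟩, mem_univ _⟩, rfl⟩)
      simp only
      rw [hc.twistFlow_apply hy.1, hδχ i τ hτ]
      simp
    · exact twistFlow_of_notMem (not_exists.1 hxc) s

theorem IsTwistProfile.apply_zero {h : ℤ} {χ : ℝ → ℝ} (hχ : IsTwistProfile ε h χ) : χ 0 = -(h : ℝ) := by
  obtain ⟨δ, hδ, h1⟩ := hχ.eq_neg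
  exact h1 0 (by linarith)

theorem IsCollar.twistFlow_boundary (hc : IsCollar γ ε c) (hχ : ∀ i, IsTwistProfile ε (h i) (χ i))
    (i : Fin k) (z : Circle) (t : ℝ) :
    twistFlow ε c χ t (γ i z) = γ i (z * Circle.exp (-(h i : ℝ) * t)) := by
  rw [← hc.boundary, hc.twistFlow_apply hc.zero_mem, (hχ i).apply_zero, hc.boundary, mul_comm t]

/-- The maps `twistFlow` with `t ∈ ℝ` form a group of diffeomorphisms. -/
theorem IsCollar.exists_diffeomorph_twistFlow [T2Space S] (hc : IsCollar γ ε c)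
    (hχ : ∀ i, IsTwistProfile ε (h i) (χ i)) (t : ℝ) :
    ∃ d : Diffeomorph (𝓡∂ 2) (𝓡∂ 2) S S ∞, ⇑d = twistFlow ε c χ t := by
  have h1 : ∀ s, ContMDiff (𝓡∂ 2) (𝓡∂ 2) ∞ (twistFlow ε c χ s) := fun s =>
    (hc.contMDiff_twistFlow hχ).comp (contMDiff_const.prodMk contMDiff_id)
  exact ⟨{ toFun := twistFlow ε c χ t
           invFun := twistFlow ε c χ (-t)
           left_inv := fun x => by rw [← hc.twistFlow_add, neg_add_cancel, hc.twistFlow_zero]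
           right_inv := fun x => by rw [← hc.twistFlow_add, add_neg_cancel, hc.twistFlow_zero]
           contMDiff_toFun := h1 t
           contMDiff_invFun := h1 (-t) }, rfl⟩

end Twist

/-! ### A flow with the given monodromy -/

section CutFlow

variable {S : Type u} [TopologicalSpace S] [ChartedSpace (EuclideanHalfSpace 2) S]

/-- The flow `[(x, s)] ↦ [(D_t x, s + t)]` on the cut, where `D_t` is the flow `twistFlow`. It is
defined by a choice of representatives, on which it does not depend (`OpenBookCut.flow_mk`). -/
noncomputable def OpenBookCut.flow (ψ : Diffeomorph (𝓡∂ 2) (𝓡∂ 2) S S ∞) {k : ℕ}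
    (γ : Fin k → Circle → S) (h : Fin k → ℤ) (ε : ℝ) (c : Fin k → ℝ × Circle → S)
    (χ : Fin k → ℝ → ℝ) (t : ℝ) (m : OpenBookCut ψ γ h) : OpenBookCut ψ γ h :=
  OpenBookCut.mk ψ γ h
    (twistFlow ε c χ t (Function.surjInv (OpenBookCut.isQuotientMap_mk (ψ := ψ)).surjective m).1,
      (Function.surjInv (OpenBookCut.isQuotientMap_mk (ψ := ψ)).surjective m).2 + t)

variable {ψ : Diffeomorph (𝓡∂ 2) (𝓡∂ 2) S S ∞} {k : ℕ} {γ : Fin k → Circle → S} {h : Fin k → ℤ}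
  {ε : ℝ} {c : Fin k → ℝ × Circle → S} {χ : Fin k → ℝ → ℝ}

namespace OpenBookCut

section

variable (H : IsCutCollar ψ γ ε c) (hχ : ∀ i, IsTwistProfile ε (h i) (χ i))
include H hχ

/-- The flow is well defined, as the twist flow commutes with `ψ` and is `θ ↦ θ - h_i t` on the
boundary. -/
theorem flow_mk (t : ℝ) (x : S) (s : ℝ) :
    flow ψ γ h ε c χ t (mk ψ γ h (x, s)) = mk ψ γ h (twistFlow ε c χ t x, s + t) := by
  rw [flow]
  have h1 := Function.surjInv_eq (isQuotientMap_mk (ψ := ψ) (γ := γ) (h := h)).surjective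
    (mk ψ γ h (x, s))
  set a := Function.surjInv (isQuotientMap_mk (ψ := ψ) (γ := γ) (h := h)).surjective
    (mk ψ γ h (x, s))
  obtain ⟨x', s'⟩ := a
  rw [mk_eq_mk_iff H] at h1 ⊢
  rcases h1 with ⟨n, h1, h2⟩ | ⟨i, z, h1, h2⟩
  · simp only at h1 h2
    refine Or.inl ⟨n, ?_, ?_⟩
    · simp only
      rw [h1, H.twistFlow_iter]
    · simp only
      rw [h2]; ring
  · simp only at h1 h2
    refine Or.inr ⟨i, z * Circle.exp (-(h i : ℝ) * t), ?_, ?_⟩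
    · simp only
      rw [h1, H.collar.twistFlow_boundary hχ]
    · simp only
      rw [h2, H.collar.twistFlow_boundary hχ, add_sub_add_right_eq_sub]
      congr 1
      rw [mul_assoc, mul_assoc, mul_comm (Circle.exp _)]

theorem flow_zero (m : OpenBookCut ψ γ h) : flow ψ γ h ε c χ 0 m = m := by
  obtain ⟨⟨x, s⟩, rfl⟩ := isQuotientMap_mk.surjective m
  rw [flow_mk H hχ, H.collar.twistFlow_zero, add_zero]

theorem flow_add (s t : ℝ) (m : OpenBookCut ψ γ h) :
    flow ψ γ h ε c χ (s + t) m = flow ψ γ h ε c χ s (flow ψ γ h ε c χ t m) := by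
  obtain ⟨⟨x, r⟩, rfl⟩ := isQuotientMap_mk.surjective m
  rw [flow_mk H hχ, flow_mk H hχ, flow_mk H hχ, H.collar.twistFlow_add]
  congr 2
  ring

/-- Near the core circle `χ_i = -h_i`, so that there the flow is the rotation of the discs. -/
theorem flow_tube (t : ℝ) {i : Fin k} {y : Circle × ℂ} (hy : y.2 ∈ Metric.ball (0 : ℂ) (√ε)) :
    flow ψ γ h ε c χ t (tube ψ γ h c i y) = tube ψ γ h c i
      (y.1 * Circle.exp (t * (χ i (-‖y.2‖ ^ 2) + h i)), Circle.exp t * y.2) := by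
  obtain ⟨b, z⟩ := y
  have hτ := neg_sq_norm_mem hy
  simp only at hτ ⊢
  have hz : z = ‖z‖ * (Circle.exp z.arg : ℂ) := by
    rw [Circle.coe_exp, Complex.norm_mul_exp_arg_mul_I]
  have hz' : (Circle.exp t : ℂ) * z = ‖z‖ * (Circle.exp (z.arg + t) : ℂ) := by
    conv_lhs => rw [hz]
    rw [Circle.exp_add, Circle.coe_mul]; ring
  have hε : ‖z‖ ^ 2 < ε := by linarith [hτ.1]
  rw [hz', tube_eq H (norm_nonneg z) hε]
  conv_lhs => rw [hz]
  rw [tube_eq H (norm_nonneg z) hε, flow_mk H hχ, H.collar.twistFlow_apply hτ]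
  congr 4
  rw [mul_assoc, mul_assoc, ← Circle.exp_add, ← Circle.exp_add]
  ring_nf

/-- The return map of the flow is `ψ` composed with the Dehn twists. -/
theorem flow_page (x : S) : flow ψ γ h ε c χ (2 * π) (page ψ γ h x) =
    page ψ γ h (ψ (boundaryTwist ε c χ x)) := by
  rw [page, flow_mk H hχ, twistFlow_two_pi, page, ← iter_one ψ, mk_iter H]
  simp

end

variable [ChartedSpace (EuclideanSpace ℝ (Fin 3)) (OpenBookCut ψ γ h)]
  [IsManifold (𝓡∂ 2) ∞ S] [T2Space S]
  (H : IsSmoothCut ψ γ h ε c) (hχ : ∀ i, IsTwistProfile ε (h i) (χ i))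
include H hχ

/-- Smoothness is checked in the parametrization by a tube near the binding and in the one by
`S × ℝ` elsewhere. -/
theorem contMDiff_flow : ContMDiff (𝓘(ℝ, ℝ).prod (𝓡 3)) (𝓡 3) ∞
    (fun y : ℝ × OpenBookCut ψ γ h => flow ψ γ h ε c χ y.1 y.2) := by
  rintro ⟨t, m⟩
  have hid : IsLocalDiffeomorphAt 𝓘(ℝ, ℝ) 𝓘(ℝ, ℝ) ∞ (id : ℝ → ℝ) t :=
    (Diffeomorph.refl 𝓘(ℝ, ℝ) ℝ ∞).isLocalDiffeomorph t
  by_cases hm : m ∈ binding ψ γ h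
  · rw [binding_eq H.toIsCutCollar, mem_ofPred_eq] at hm
    obtain ⟨i, b, rfl⟩ := hm
    have hb0 : (0 : ℂ) ∈ Metric.ball (0 : ℂ) (√ε) := by simpa using H.collar.pos
    have h1 := hid.prodMap (H.tube_localDiffeo i ⟨(b, 0), mem_univ _, hb0⟩)
    refine h1.contMDiffAt_of_comp (g := fun y : ℝ × OpenBookCut ψ γ h => flow ψ γ h ε c χ y.1 y.2) ?_
    have h2 : ContMDiff (𝓘(ℝ, ℝ).prod ((𝓡 1).prod 𝓘(ℝ, ℂ))) ((𝓡 1).prod 𝓘(ℝ, ℂ)) ∞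
        (fun y : ℝ × Circle × ℂ =>
          (y.2.1 * Circle.exp (y.1 * (χ i (-‖y.2.2‖ ^ 2) + h i)), Circle.exp y.1 * y.2.2)) := by
      have h3 : ContDiff ℝ ∞ (fun z : ℂ => χ i (-‖z‖ ^ 2) + h i) :=
        ((hχ i).contDiff.comp (contDiff_norm_sq ℝ).neg).add contDiff_const
      have hz : ContMDiff (𝓘(ℝ, ℝ).prod ((𝓡 1).prod 𝓘(ℝ, ℂ))) 𝓘(ℝ, ℂ) ∞
          (fun y : ℝ × Circle × ℂ => y.2.2) := contMDiff_snd.comp contMDiff_snd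
      have hw : ContMDiff (𝓘(ℝ, ℝ).prod ((𝓡 1).prod 𝓘(ℝ, ℂ))) (𝓡 1) ∞
          (fun y : ℝ × Circle × ℂ => y.2.1) := contMDiff_fst.comp contMDiff_snd
      have h4 : ContMDiff (𝓘(ℝ, ℝ).prod ((𝓡 1).prod 𝓘(ℝ, ℂ))) 𝓘(ℝ, ℝ) ∞
          (fun y : ℝ × Circle × ℂ => y.1 * (χ i (-‖y.2.2‖ ^ 2) + h i)) :=
        ContMDiff.smul contMDiff_fst (h3.contMDiff.comp hz)
      have h5 : ContMDiff (𝓘(ℝ, ℝ).prod ((𝓡 1).prod 𝓘(ℝ, ℂ))) 𝓘(ℝ, ℂ) ∞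
          (fun y : ℝ × Circle × ℂ => (Circle.exp y.1 : ℂ)) :=
        Circle.contMDiff_coe.comp (contMDiff_circleExp.comp contMDiff_fst)
      have h6 : ContMDiff (𝓘(ℝ, ℝ).prod ((𝓡 1).prod 𝓘(ℝ, ℂ))) 𝓘(ℝ, ℂ) ∞
          (fun y : ℝ × Circle × ℂ => (Circle.exp y.1 : ℂ) * y.2.2) :=
        ContMDiff.comp (g := fun q : ℂ × ℂ => q.1 * q.2) (I' := 𝓘(ℝ, ℂ × ℂ))
          (contDiff_mul (𝕜 := ℝ) (𝔸 := ℂ)).contMDiff (h5.prodMk_space hz)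
      exact (hw.mul (contMDiff_circleExp.comp h4)).prodMk h6
    have h3 : ContMDiffAt (𝓘(ℝ, ℝ).prod ((𝓡 1).prod 𝓘(ℝ, ℂ))) (𝓡 3) ∞
        (fun y : ℝ × Circle × ℂ => tube ψ γ h c i
          (y.2.1 * Circle.exp (y.1 * (χ i (-‖y.2.2‖ ^ 2) + h i)), Circle.exp y.1 * y.2.2))
        (t, b, 0) :=
      ContMDiffAt.comp (g := tube ψ γ h c i) (t, b, (0 : ℂ))
        (H.tube_localDiffeo i ⟨_, mem_univ _, by simpa using H.collar.pos⟩).contMDiffAt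
        (h2 (t, b, 0))
    refine h3.congr_of_eventuallyEq ?_
    have ho : IsOpen ((univ : Set ℝ) ×ˢ ((univ : Set Circle) ×ˢ Metric.ball (0 : ℂ) (√ε))) :=
      isOpen_univ.prod (isOpen_univ.prod Metric.isOpen_ball)
    filter_upwards [ho.mem_nhds (show (t, b, (0 : ℂ)) ∈ _ from ⟨mem_univ _, mem_univ _, hb0⟩)]
      with y hy
    exact flow_tube H.toIsCutCollar hχ y.1 hy.2.2
  · obtain ⟨x, hx, s, rfl⟩ := exists_mk_of_notMem_binding H.toIsCutCollar hm
    have h1 := hid.prodMap (H.mk_localDiffeo ⟨(x, s), hx, mem_univ _⟩)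
    refine h1.contMDiffAt_of_comp (g := fun y : ℝ × OpenBookCut ψ γ h => flow ψ γ h ε c χ y.1 y.2) ?_
    have h2 : ContMDiff (𝓘(ℝ, ℝ).prod ((𝓡∂ 2).prod 𝓘(ℝ, ℝ))) ((𝓡∂ 2).prod 𝓘(ℝ, ℝ)) ∞
        (fun y : ℝ × S × ℝ => (twistFlow ε c χ y.1 y.2.1, y.2.2 + y.1)) :=
      ((H.collar.contMDiff_twistFlow hχ).comp
        (contMDiff_fst.prodMk (contMDiff_fst.comp contMDiff_snd))).prodMk
        ((contMDiff_snd.comp contMDiff_snd).add contMDiff_fst)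
    have hD : twistFlow ε c χ t x ∈ (𝓡∂ 2).interior S := by
      obtain ⟨d, hd⟩ := H.collar.exists_diffeomorph_twistFlow hχ t
      rw [← hd]
      exact (Set.ext_iff.1 (d.preimage_interior (by simp)) x).2 hx
    have h3 := ContMDiffAt.comp (g := mk ψ γ h) (t, x, s)
      (H.mk_localDiffeo ⟨(twistFlow ε c χ t x, s + t), hD, mem_univ _⟩).contMDiffAt (h2 (t, x, s))
    refine h3.congr_of_eventuallyEq (Eventually.of_forall fun y => ?_)
    exact flow_mk H.toIsCutCollar hχ y.1 y.2.1 y.2.2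

variable [IsManifold (𝓡 3) ∞ (OpenBookCut ψ γ h)]

theorem isMonodromyFlow_flow : IsMonodromyFlow (binding ψ γ h) (angular ψ γ h) (tube ψ γ h c)
    (flow ψ γ h ε c χ) := by
  have hH := H.toIsCutCollar
  have h0 : ∀ m, flow ψ γ h ε c χ 0 m = m := flow_zero hH hχ
  obtain ⟨X, hX, hXi⟩ := exists_contMDiff_field_of_flow (contMDiff_flow H hχ) h0
    (flow_add hH hχ)
  refine ⟨contMDiff_flow H hχ, h0, X, ⟨hX, ?_, ?_⟩, hXi⟩
  · intro m hm
    -- `m` and `flow 0 m` are equal, but not by definition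
    have key : ∀ m', flow ψ γ h ε c χ 0 m = m' → m' ∉ binding ψ γ h →
        mfderiv (𝓡 3) (𝓡 1) (angular ψ γ h) m' (X m') = circleField (angular ψ γ h m') := by
      rintro _ rfl hm'
      refine mfderiv_eq_circleField (hXi m)
        ((contMDiffAt_angular H hm').mdifferentiableAt (by simp)) fun t => ?_
      obtain ⟨x, hx, s, rfl⟩ := exists_mk_of_notMem_binding hH hm
      have hD : twistFlow ε c χ t x ∈ (𝓡∂ 2).interior S := by
        obtain ⟨d, hd⟩ := H.collar.exists_diffeomorph_twistFlow hχ t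
        rw [← hd]
        exact (Set.ext_iff.1 (d.preimage_interior (by simp)) x).2 hx
      rw [h0, flow_mk hH hχ, angular_mk hH hD, angular_mk hH hx, Circle.exp_add]
    exact key m (h0 m) hm
  · -- a radius on which `χ i (-‖z‖ ^ 2) = -h i`
    choose δ hδ hδχ using fun i => (hχ i).eq_neg
    have h1 : ∀ᶠ r in 𝓝[>] (0 : ℝ), 0 < r ∧ r < √ε ∧ ∀ i, r ^ 2 ≤ δ i := by
      have h2 : ∀ i, ∀ᶠ r in 𝓝[>] (0 : ℝ), r ^ 2 ≤ δ i := by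
        intro i
        have h3 : Tendsto (fun r : ℝ => r ^ 2) (𝓝[>] 0) (𝓝 0) := by
          have h4 : Continuous fun r : ℝ => r ^ 2 := by fun_prop
          simpa using (h4.tendsto 0).mono_left nhdsWithin_le_nhds
        exact h3.eventually_le_const (hδ i)
      filter_upwards [self_mem_nhdsWithin, Ioo_mem_nhdsGT (Real.sqrt_pos.2 H.collar.pos),
        eventually_all.2 h2] with r hr1 hr2 hr3
      exact ⟨hr1, hr2.2, hr3⟩
    obtain ⟨r, hr0, hrε, hr⟩ := h1.exists
    refine ⟨r, hr0, fun i b z hz => ?_⟩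
    have hzb : z ∈ Metric.ball (0 : ℂ) (√ε) := by simpa using hz.trans hrε
    have h2 : (fun t : ℝ => tube ψ γ h c i (b, Circle.exp t * z)) =
        fun t => flow ψ γ h ε c χ t (tube ψ γ h c i (b, z)) := by
      ext t
      have h3 : χ i (-‖z‖ ^ 2) = -(h i : ℝ) := by
        refine hδχ i _ ?_
        have := hr i
        nlinarith [norm_nonneg z]
      rw [flow_tube hH hχ t hzb]
      simp only
      rw [h3]
      simp
    rw [h2]
    exact hXi _

end OpenBookCut

end CutFlow

/-! ### Arbitrary flows transverse to the pages -/

section CircleField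

/-- The vector field `∂_s` on the circle in the coordinates of the plane. -/
theorem mfderiv_coe_circleField (w : Circle) :
    mfderiv (𝓡 1) 𝓘(ℝ, ℂ) (fun w : Circle => (w : ℂ)) w (circleField w) =
      (Complex.I * w : ℂ) := by
  have hcoe : ∀ w : Circle, HasMFDerivAt (𝓡 1) 𝓘(ℝ, ℂ) (fun w : Circle => (w : ℂ)) w
      (mfderiv (𝓡 1) 𝓘(ℝ, ℂ) (fun w : Circle => (w : ℂ)) w) :=
    fun w => ((Circle.contMDiff_coe w).mdifferentiableAt (by simp)).hasMFDerivAt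
  have h3 : MDifferentiableAt 𝓘(ℝ, ℝ) (𝓡 1) (fun t : ℝ => w * Circle.exp t) 0 :=
    ((contMDiff_const.mul contMDiff_circleExp).contMDiffAt (n := ∞)).mdifferentiableAt (by simp)
  have h1 := HasMFDerivAt.comp (g := fun w : Circle => (w : ℂ)) (0 : ℝ) (hcoe _) h3.hasMFDerivAt
  have h2 : HasDerivAt (fun t : ℝ => (w : ℂ) * Complex.exp (t * Complex.I))
      (w * (Complex.exp ((0 : ℝ) * Complex.I) * (1 * Complex.I))) 0 :=
    (((Complex.ofRealCLM.hasDerivAt (x := (0 : ℝ))).mul_const Complex.I).cexp).const_mul _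
  have h4 : ((fun w : Circle => (w : ℂ)) ∘ fun t : ℝ => w * Circle.exp t) =
      fun t : ℝ => (w : ℂ) * Complex.exp (t * Complex.I) := by
    ext t
    simp [Circle.coe_exp]
  rw [h4] at h1
  have h5 := hasMFDerivAt_unique h1 h2.hasFDerivAt.hasMFDerivAt
  have h6 := congrArg (fun L : ℝ →L[ℝ] ℂ => L 1) h5
  have key : ∀ w', w * Circle.exp 0 = w' → ∀ v : EuclideanSpace ℝ (Fin 1),
      (mfderiv (𝓡 1) 𝓘(ℝ, ℂ) (fun w : Circle => (w : ℂ)) (w * Circle.exp 0) v : ℂ) =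
        mfderiv (𝓡 1) 𝓘(ℝ, ℂ) (fun w : Circle => (w : ℂ)) w' v := by
    rintro _ rfl v; rfl
  refine ((key w (by simp) (circleField w)).symm.trans h6).trans ?_
  simp [mul_comm]
  rfl

variable {M : Type u} [TopologicalSpace M] [ChartedSpace (EuclideanSpace ℝ (Fin 3)) M]

/-- Along the integral curves of a lift of `∂_s` the projection moves with unit speed. -/
theorem eq_mul_exp_of_lift {p : M → Circle} {X : ∀ x : M, TangentSpace (𝓡 3) x} {g : ℝ → M}
    (hg : IsMIntegralCurve g X) (hp : ∀ t, MDifferentiableAt (𝓡 3) (𝓡 1) p (g t))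
    (hX : ∀ t, mfderiv (𝓡 3) (𝓡 1) p (g t) (X (g t)) = circleField (p (g t))) (t : ℝ) :
    p (g t) = p (g 0) * Circle.exp t := by
  have hq : ∀ t, HasDerivAt (fun t => (p (g t) : ℂ)) (Complex.I * p (g t)) t := by
    intro t
    have h1 := HasMFDerivAt.comp (g := p) t (hp t).hasMFDerivAt (hg t)
    have h2 := HasMFDerivAt.comp (g := fun w : Circle => (w : ℂ)) t
      ((Circle.contMDiff_coe (p (g t))).mdifferentiableAt (by simp)).hasMFDerivAt h1
    obtain ⟨L, hL, hL1⟩ : ∃ L : ℝ →L[ℝ] ℂ, HasFDerivAt (fun t => (p (g t) : ℂ)) L t ∧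
        L 1 = Complex.I * p (g t) := by
      refine ⟨_, h2.hasFDerivAt, ?_⟩
      refine Eq.trans ?_ (mfderiv_coe_circleField (p (g t)))
      rw [← hX t]
      change mfderiv (𝓡 1) 𝓘(ℝ, ℂ) (fun w : Circle => (w : ℂ)) (p (g t))
        (mfderiv (𝓡 3) (𝓡 1) p (g t) ((1 : ℝ) • X (g t))) = _
      rw [one_smul]
    exact hL.hasDerivAt.congr_deriv hL1
  -- `q = p ∘ g` solves `q' = i q`, hence `q e^{-it}` is constant
  have hr : ∀ t, HasDerivAt (fun t : ℝ => (p (g t) : ℂ) * Complex.exp (-(t * Complex.I))) 0 t := by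
    intro t
    have h1 := (hq t).mul (((Complex.ofRealCLM.hasDerivAt (x := t)).mul_const Complex.I).neg.cexp)
    refine h1.congr_deriv ?_
    simp only [Complex.ofRealCLM_apply, Complex.ofReal_one]
    ring
  have hc := is_const_of_deriv_eq_zero (fun t => (hr t).differentiableAt) (fun t => (hr t).deriv) t 0
  apply Circle.ext
  simp only [Complex.ofReal_zero, zero_mul, neg_zero, Complex.exp_zero, mul_one] at hc
  rw [Circle.coe_mul, Circle.coe_exp, ← hc, mul_assoc, ← Complex.exp_add]
  simp

end CircleField

section Monodromy

variable {S : Type u} [TopologicalSpace S] [ChartedSpace (EuclideanHalfSpace 2) S]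
  {ψ : Diffeomorph (𝓡∂ 2) (𝓡∂ 2) S S ∞} {k : ℕ} {γ : Fin k → Circle → S} {h : Fin k → ℤ}
  {ε : ℝ} {c : Fin k → ℝ × Circle → S} {χ : Fin k → ℝ → ℝ}

/-- The smaller collars `(-a, 0] × ∂S` of the boundary. -/
def collarNhd (c : Fin k → ℝ × Circle → S) (a : ℝ) : Set S := ⋃ i, c i '' (Ioc (-a) 0 ×ˢ univ)

theorem IsCutCollar.collarNhd_mem (H : IsCutCollar ψ γ ε c) {a : ℝ} (ha : 0 < a) :
    collarNhd c a ∈ 𝓝ˢ ((𝓡∂ 2).boundary S) := by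
  rw [mem_nhdsSet_iff_forall]
  intro x hx
  obtain ⟨i, z, rfl⟩ := H.coordinates.exists_eq hx
  obtain ⟨d, hd, hdc⟩ := H.collar.smooth_inverse i
  have h0 : ((0 : ℝ), z) ∈ Ioc (-ε) 0 ×ˢ (univ : Set Circle) := ⟨H.collar.zero_mem, mem_univ _⟩
  have hmem : γ i z ∈ c i '' (Ioc (-ε) 0 ×ˢ univ) := ⟨_, h0, H.collar.boundary i z⟩
  have hC : c i '' (Ioc (-ε) 0 ×ˢ univ) ∈ 𝓝 (γ i z) := (H.collar.isOpen_image i).mem_nhds hmem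
  have h1 : ContinuousAt d (γ i z) := hd.continuousOn.continuousAt hC
  have h2 : d (γ i z) = (0, z) := by rw [← H.collar.boundary, hdc _ h0]
  have h3 : ∀ᶠ x in 𝓝 (γ i z), -a < (d x).1 := by
    have h4 : ContinuousAt (fun x => (d x).1) (γ i z) := continuous_fst.continuousAt.comp h1
    refine h4.eventually_const_lt ?_
    change -a < (d (γ i z)).1
    rw [h2]; simpa using ha
  filter_upwards [hC, h3]
  rintro _ ⟨y, hy, rfl⟩ hya
  rw [hdc y hy] at hya
  exact mem_iUnion.2 ⟨i, y, ⟨⟨hya, hy.1.2⟩, mem_univ _⟩, rfl⟩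

theorem IsCutCollar.twistFlow_mem_collarNhd (H : IsCutCollar ψ γ ε c) {a : ℝ} (haε : a ≤ ε) {x : S}
    (hx : x ∈ collarNhd c a) (t : ℝ) : twistFlow ε c χ t x ∈ collarNhd c a := by
  obtain ⟨i, ⟨τ, w⟩, hy, rfl⟩ := mem_iUnion.1 hx
  rw [H.collar.twistFlow_apply ⟨by linarith [hy.1.1], hy.1.2⟩]
  exact mem_iUnion.2 ⟨i, (τ, w * Circle.exp (t * χ i τ)), ⟨hy.1, mem_univ _⟩, rfl⟩

/-- The time `2π` map of the twist flow is the identity near the boundary, as the `h_i` are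
integers. -/
theorem IsCutCollar.twistFlow_two_pi_of_mem (H : IsCutCollar ψ γ ε c) {a : ℝ} (haε : a ≤ ε)
    (ha : ∀ i, ∀ τ ∈ Ioc (-a) 0, χ i τ = -(h i : ℝ)) {x : S} (hx : x ∈ collarNhd c a) :
    twistFlow ε c χ (2 * π) x = x := by
  obtain ⟨i, ⟨τ, w⟩, hy, rfl⟩ := mem_iUnion.1 hx
  rw [H.collar.twistFlow_apply ⟨by linarith [hy.1.1], hy.1.2⟩, ha i τ hy.1]
  have := Circle.exp_int_mul_two_pi (-h i)
  push_cast at this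
  rw [mul_comm (2 * π), this, mul_one]

namespace OpenBookCut

variable [ChartedSpace (EuclideanSpace ℝ (Fin 3)) (OpenBookCut ψ γ h)]
  [IsManifold (𝓡 3) ∞ (OpenBookCut ψ γ h)]
  {Φ : ℝ → OpenBookCut ψ γ h → OpenBookCut ψ γ h}

/-- What is needed from a flow as in `IsMonodromyFlow`: it is a smooth one-parameter group that
moves the pages with unit speed and rotates the discs of the tubular neighbourhood of radius `δ`. -/
structure IsPageFlow (ψ : Diffeomorph (𝓡∂ 2) (𝓡∂ 2) S S ∞) {k : ℕ} (γ : Fin k → Circle → S)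
    (h : Fin k → ℤ) [ChartedSpace (EuclideanSpace ℝ (Fin 3)) (OpenBookCut ψ γ h)]
    (c : Fin k → ℝ × Circle → S) (δ : ℝ)
    (Φ : ℝ → OpenBookCut ψ γ h → OpenBookCut ψ γ h) : Prop where
  contMDiff : ContMDiff (𝓘(ℝ, ℝ).prod (𝓡 3)) (𝓡 3) ∞
    (fun y : ℝ × OpenBookCut ψ γ h => Φ y.1 y.2)
  zero : ∀ m, Φ 0 m = m
  add : ∀ s t m, Φ (s + t) m = Φ s (Φ t m)
  angular : ∀ t, ∀ m ∉ binding ψ γ h, Φ t m ∉ binding ψ γ h ∧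
    OpenBookCut.angular ψ γ h (Φ t m) = OpenBookCut.angular ψ γ h m * Circle.exp t
  pos : 0 < δ
  tube : ∀ t i b z, ‖z‖ < δ →
    Φ t (OpenBookCut.tube ψ γ h c i (b, z)) = OpenBookCut.tube ψ γ h c i (b, Circle.exp t * z)

variable [IsManifold (𝓡∂ 2) ∞ S] [T2Space S]

/-- By uniqueness of integral curves, a flow as in `IsMonodromyFlow` is a one-parameter group, it
rotates the discs near the core circles, and it does not reach the binding from outside. -/
theorem exists_isPageFlow (H : IsSmoothCut ψ γ h ε c)
    (hΦ : IsMonodromyFlow (binding ψ γ h) (angular ψ γ h) (OpenBookCut.tube ψ γ h c) Φ) :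
    ∃ δ, IsPageFlow ψ γ h c δ Φ := by
  have := t2Space (h := h) H.toIsCutCollar
  have hman : IsManifold (𝓡 3) 1 (OpenBookCut ψ γ h) := IsManifold.of_le (n := ∞) (by simp)
  obtain ⟨hsm, h0, X, ⟨hX, hlift, δ, hδ, hang⟩, hint⟩ := hΦ
  have hX1 : ContMDiff (𝓡 3) (𝓡 3).tangent 1
      fun x => (⟨x, X x⟩ : TangentBundle (𝓡 3) (OpenBookCut ψ γ h)) := hX.of_le (by simp)
  have hadd : ∀ s t m, Φ (s + t) m = Φ s (Φ t m) := by
    intro s t m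
    have h1 := isMIntegralCurve_Ioo_eq_of_contMDiff_boundaryless (I := 𝓡 3) (t₀ := 0) hX1
      ((hint m).comp_add t) (hint (Φ t m)) (by simp [h0])
    exact congrFun h1 s
  have htube : ∀ t i b z, ‖z‖ < δ → Φ t (OpenBookCut.tube ψ γ h c i (b, z)) =
      OpenBookCut.tube ψ γ h c i (b, Circle.exp t * z) := by
    intro t i b z hz
    have h1 := isMIntegralCurve_Ioo_eq_of_contMDiff_boundaryless (I := 𝓡 3) (t₀ := 0) hX1
      (hint (OpenBookCut.tube ψ γ h c i (b, z))) (hang i b z hz) (by simp [h0])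
    exact congrFun h1 t
  have hB : ∀ t, ∀ m ∉ binding ψ γ h, Φ t m ∉ binding ψ γ h := by
    intro t m hm hb
    have hb' := hb
    rw [binding_eq H.toIsCutCollar, mem_ofPred_eq] at hb'
    obtain ⟨i, b, hib⟩ := hb'
    have h1 : Φ (-t) (Φ t m) = Φ t m := by
      rw [← hib, htube _ _ _ _ (by simpa using hδ), mul_zero]
    rw [← hadd, neg_add_cancel, h0] at h1
    exact hm (h1 ▸ hb)
  refine ⟨δ, hsm, h0, hadd, fun t m hm => ⟨hB t m hm, ?_⟩, hδ, htube⟩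
  have h1 := eq_mul_exp_of_lift (hint m)
    (fun t => (contMDiffAt_angular H (hB t m hm)).mdifferentiableAt (by simp))
    (fun t => hlift _ (hB t m hm)) t
  simp only [h0] at h1
  exact h1

end OpenBookCut

end Monodromy

/-! ### The monodromy -/

section Return

variable {S : Type u} [TopologicalSpace S] [ChartedSpace (EuclideanHalfSpace 2) S]

open Classical in
/-- The diffeomorphisms `G_{s,t}` of the surface induced by a flow `Φ` transverse to the pages:
`Φ_t [(x, s)] = [(G_{s,t} x, s + t)]`. For a flow as in `IsPageFlow` the image point exists and is
unique, and the value in the other case is irrelevant. -/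
noncomputable def OpenBookCut.pageMap (ψ : Diffeomorph (𝓡∂ 2) (𝓡∂ 2) S S ∞) {k : ℕ}
    (γ : Fin k → Circle → S) (h : Fin k → ℤ) (Φ : ℝ → OpenBookCut ψ γ h → OpenBookCut ψ γ h)
    (s t : ℝ) (x : S) : S :=
  if H : ∃ x', Φ t (OpenBookCut.mk ψ γ h (x, s)) = OpenBookCut.mk ψ γ h (x', s + t) then H.choose
  else x

variable {ψ : Diffeomorph (𝓡∂ 2) (𝓡∂ 2) S S ∞} {k : ℕ} {γ : Fin k → Circle → S} {h : Fin k → ℤ}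
  {ε : ℝ} {c : Fin k → ℝ × Circle → S} {χ : Fin k → ℝ → ℝ}

namespace OpenBookCut

variable [ChartedSpace (EuclideanSpace ℝ (Fin 3)) (OpenBookCut ψ γ h)]
  {δ : ℝ} {Φ : ℝ → OpenBookCut ψ γ h → OpenBookCut ψ γ h}
  (H : IsSmoothCut ψ γ h ε c) (F : IsPageFlow ψ γ h c δ Φ)
include H F

theorem pageFlow_mk_collar {i : Fin k} {τ : ℝ} {w : Circle} (hτ : τ ∈ Ioc (-ε) 0) (hτδ : -τ < δ ^ 2)
    (s t : ℝ) : Φ t (mk ψ γ h (c i (τ, w), s)) =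
      mk ψ γ h (c i (τ, w * Circle.exp (-(h i : ℝ) * t)), s + t) := by
  have hH := H.toIsCutCollar
  rw [mk_collar_eq_tube hH hτ, F.tube, mk_collar_eq_tube hH hτ]
  · congr 2
    · rw [mul_assoc, ← Circle.exp_add]; ring_nf
    · rw [Circle.exp_add, Circle.coe_mul]; ring
  · rw [norm_mul, Circle.norm_coe, mul_one, Complex.norm_real,
      Real.norm_of_nonneg (Real.sqrt_nonneg _)]
    exact (Real.sqrt_lt' F.pos).2 hτδ

variable [IsManifold (𝓡∂ 2) ∞ S]

theorem exists_pageFlow_mk (s t : ℝ) (x : S) :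
    ∃ x', Φ t (mk ψ γ h (x, s)) = mk ψ γ h (x', s + t) := by
  have hH := H.toIsCutCollar
  by_cases hx : x ∈ (𝓡∂ 2).interior S
  · obtain ⟨h1, h2⟩ := F.angular t (mk ψ γ h (x, s))
      fun hb => (mk_mem_binding_iff hH).1 hb hx
    obtain ⟨x', hx', s', heq⟩ := exists_mk_of_notMem_binding hH h1
    rw [← heq, angular_mk hH hx', angular_mk hH hx, ← Circle.exp_add] at h2
    obtain ⟨n, hn⟩ := exists_mk_eq_of_exp (h := h) (x := x') hH h2
    exact ⟨_, heq.symm.trans hn⟩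
  · obtain ⟨i, z, rfl⟩ := H.coordinates.exists_eq (mem_boundary_iff_notMem_interior.2 hx)
    rw [← H.collar.boundary]
    exact ⟨_, pageFlow_mk_collar H F H.collar.zero_mem (by have := F.pos; simpa using by positivity) s t⟩

theorem pageFlow_mk_eq (s t : ℝ) (x : S) :
    Φ t (mk ψ γ h (x, s)) = mk ψ γ h (pageMap ψ γ h Φ s t x, s + t) := by
  rw [pageMap, dif_pos (exists_pageFlow_mk H F s t x)]
  exact (exists_pageFlow_mk H F s t x).choose_spec

theorem pageMap_eq {s t : ℝ} {x x' : S} (heq : Φ t (mk ψ γ h (x, s)) = mk ψ γ h (x', s + t)) :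
    pageMap ψ γ h Φ s t x = x' :=
  mk_page_injective H.toIsCutCollar ((pageFlow_mk_eq H F s t x).symm.trans heq)

theorem pageMap_zero (s : ℝ) (x : S) : pageMap ψ γ h Φ s 0 x = x :=
  pageMap_eq H F (by rw [F.zero, add_zero])

theorem pageMap_add (s t u : ℝ) (x : S) :
    pageMap ψ γ h Φ (s + t) u (pageMap ψ γ h Φ s t x) = pageMap ψ γ h Φ s (u + t) x := by
  refine (pageMap_eq H F ?_).symm
  rw [F.add, pageFlow_mk_eq H F, pageFlow_mk_eq H F, add_assoc, add_comm u t]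

theorem pageMap_mem_interior {x : S} (hx : x ∈ (𝓡∂ 2).interior S) (s t : ℝ) :
    pageMap ψ γ h Φ s t x ∈ (𝓡∂ 2).interior S := by
  have hH := H.toIsCutCollar
  have h1 := (F.angular t (mk ψ γ h (x, s)) fun hb => (mk_mem_binding_iff hH).1 hb hx).1
  rwa [pageFlow_mk_eq H F, mk_mem_binding_iff hH, not_not] at h1

/-- Near the boundary the flow is determined by the condition on the tubular neighbourhoods. -/
theorem pageMap_of_mem {a : ℝ} (haε : a ≤ ε) (haδ : a ≤ δ ^ 2)
    (ha : ∀ i, ∀ τ ∈ Ioc (-a) 0, χ i τ = -(h i : ℝ)) {x : S} (hx : x ∈ collarNhd c a) (s t : ℝ) :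
    pageMap ψ γ h Φ s t x = twistFlow ε c χ t x := by
  obtain ⟨i, ⟨τ, w⟩, hy, rfl⟩ := mem_iUnion.1 hx
  have hτ : τ ∈ Ioc (-ε) 0 := ⟨by linarith [hy.1.1], hy.1.2⟩
  rw [H.collar.twistFlow_apply hτ, ha i τ hy.1, mul_comm t]
  exact pageMap_eq H F (pageFlow_mk_collar H F hτ (by linarith [hy.1.1]) s t)

theorem pageMap_two_pi (x : S) :
    Φ (2 * π) (page ψ γ h x) = page ψ γ h (ψ (pageMap ψ γ h Φ 0 (2 * π) x)) := by
  rw [page, pageFlow_mk_eq H F, page, ← iter_one ψ, mk_iter H.toIsCutCollar]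
  simp

variable [T2Space S]

/-- Over the interior, `G_{s,t}` is read off from `Φ` by a local inverse of the quotient map. Near the
boundary it is the twist flow. -/
theorem contMDiff_pageMap (hχ : ∀ i, IsTwistProfile ε (h i) (χ i)) {a : ℝ} (ha0 : 0 < a)
    (haε : a ≤ ε) (haδ : a ≤ δ ^ 2) (ha : ∀ i, ∀ τ ∈ Ioc (-a) 0, χ i τ = -(h i : ℝ)) (s : ℝ) :
    ContMDiff (𝓘(ℝ, ℝ).prod (𝓡∂ 2)) (𝓡∂ 2) ∞ (fun y : ℝ × S => pageMap ψ γ h Φ s y.1 y.2) := by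
  have hH := H.toIsCutCollar
  rintro ⟨t, x⟩
  by_cases hx : x ∈ (𝓡∂ 2).interior S
  swap
  · refine (H.collar.contMDiff_twistFlow hχ (t, x)).congr_of_eventuallyEq ?_
    have h1 := mem_nhdsSet_iff_forall.1 (hH.collarNhd_mem ha0) x
      (mem_boundary_iff_notMem_interior.2 hx)
    filter_upwards [prod_mem_nhds (univ_mem (f := 𝓝 t)) h1] with y hy
    exact pageMap_of_mem H F haε haδ ha hy.2 s y.1
  · set x' := pageMap ψ γ h Φ s t x with hx'
    have hx'i : x' ∈ (𝓡∂ 2).interior S := pageMap_mem_interior H F hx s t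
    have hl := H.mk_localDiffeo ⟨(x', s + t), hx'i, mem_univ _⟩
    have hl1 : hl.localInverse (mk ψ γ h (x', s + t)) = (x', s + t) :=
      hl.localInverse_left_inv hl.localInverse_mem_target
    have h1 : ContMDiffAt (𝓘(ℝ, ℝ).prod (𝓡∂ 2)) (𝓡 3) ∞
        (fun y : ℝ × S => mk ψ γ h (y.2, s)) (t, x) :=
      ContMDiffAt.comp (g := mk ψ γ h) (f := fun y : ℝ × S => (y.2, s)) (t, x)
        (H.mk_localDiffeo ⟨(x, s), hx, mem_univ _⟩).contMDiffAt
        (contMDiffAt_snd.prodMk contMDiffAt_const)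
    have h2 : ContMDiffAt (𝓘(ℝ, ℝ).prod (𝓡∂ 2)) (𝓡 3) ∞
        (fun y : ℝ × S => Φ y.1 (mk ψ γ h (y.2, s))) (t, x) :=
      ContMDiffAt.comp (g := fun y : ℝ × OpenBookCut ψ γ h => Φ y.1 y.2)
        (f := fun y : ℝ × S => (y.1, mk ψ γ h (y.2, s))) (t, x) (F.contMDiff _)
        (contMDiffAt_fst.prodMk h1)
    have h2x : Φ t (mk ψ γ h (x, s)) = mk ψ γ h (x', s + t) := pageFlow_mk_eq H F s t x
    have h3 : ContMDiffAt (𝓘(ℝ, ℝ).prod (𝓡∂ 2)) ((𝓡∂ 2).prod 𝓘(ℝ, ℝ)) ∞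
        (fun y : ℝ × S => hl.localInverse (Φ y.1 (mk ψ γ h (y.2, s)))) (t, x) := by
      refine ContMDiffAt.comp (g := hl.localInverse)
        (f := fun y : ℝ × S => Φ y.1 (mk ψ γ h (y.2, s))) (t, x) ?_ h2
      simp only [h2x]
      exact hl.localInverse_contMDiffAt
    refine (contMDiffAt_fst.comp (t, x) h3).congr_of_eventuallyEq ?_
    have h4 : ∀ᶠ y : ℝ × S in 𝓝 (t, x),
        mk ψ γ h (hl.localInverse (Φ y.1 (mk ψ γ h (y.2, s)))) = Φ y.1 (mk ψ γ h (y.2, s)) := by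
      have h5 := h2.continuousAt.tendsto
      simp only [h2x] at h5
      exact h5.eventually hl.localInverse_eventuallyEq_right
    have h5 : ∀ᶠ y : ℝ × S in 𝓝 (t, x), hl.localInverse (Φ y.1 (mk ψ γ h (y.2, s))) ∈
        (𝓡∂ 2).interior S ×ˢ Ioo (s + t - π) (s + t + π) := by
      refine h3.continuousAt.eventually_mem ((isOpen_surface_interior.prod isOpen_Ioo).mem_nhds ?_)
      simp only [h2x, hl1]
      exact ⟨hx'i, by linarith [Real.pi_pos], by linarith [Real.pi_pos]⟩
    have h6 : ∀ᶠ y : ℝ × S in 𝓝 (t, x), y ∈ Ioo (t - π) (t + π) ×ˢ (𝓡∂ 2).interior S :=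
      (isOpen_Ioo.prod isOpen_surface_interior).mem_nhds
        ⟨⟨by linarith [Real.pi_pos], by linarith [Real.pi_pos]⟩, hx⟩
    -- both points have `s`-coordinate within `π` of `s + t`, where the quotient map is injective
    filter_upwards [h4, h5, h6] with y hy4 hy5 hy6
    rw [pageFlow_mk_eq H F] at hy4
    have h7 := injOn_mk hH (s + t) hy5 (x₂ := (pageMap ψ γ h Φ s y.1 y.2, s + y.1))
      ⟨pageMap_mem_interior H F hy6.2 s y.1, by linarith [hy6.1.1], by linarith [hy6.1.2]⟩
      (by rw [pageFlow_mk_eq H F]; exact hy4)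
    simp only [Function.comp_apply]
    rw [h7]

theorem exists_diffeomorph_pageMap (hχ : ∀ i, IsTwistProfile ε (h i) (χ i)) {a : ℝ} (ha0 : 0 < a)
    (haε : a ≤ ε) (haδ : a ≤ δ ^ 2) (ha : ∀ i, ∀ τ ∈ Ioc (-a) 0, χ i τ = -(h i : ℝ)) (s t : ℝ) :
    ∃ d : Diffeomorph (𝓡∂ 2) (𝓡∂ 2) S S ∞, ⇑d = pageMap ψ γ h Φ s t := by
  have h1 : ∀ s t, ContMDiff (𝓡∂ 2) (𝓡∂ 2) ∞ (pageMap ψ γ h Φ s t) := fun s t =>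
    (contMDiff_pageMap H F hχ ha0 haε haδ ha s).comp (contMDiff_const.prodMk contMDiff_id)
  exact ⟨{ toFun := pageMap ψ γ h Φ s t
           invFun := pageMap ψ γ h Φ (s + t) (-t)
           left_inv := fun x => by rw [pageMap_add H F, neg_add_cancel, pageMap_zero H F]
           right_inv := fun x => by
             have := pageMap_add H F (s + t) (-t) t x
             rwa [add_neg_cancel_right, add_neg_cancel, pageMap_zero H F] at this
           contMDiff_toFun := h1 s t
           contMDiff_invFun := h1 (s + t) (-t) }, rfl⟩

/-- The time `2π` map of a flow transverse to the pages is isotopic to the one of the flow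
`OpenBookCut.flow`: follow the twist flow for the time `2π (1 - r)`, then `G_{0,t}` up to `t = 2πr`.
Near the boundary both agree, so that nothing changes there. -/
theorem isotopic_pageMap (hχ : ∀ i, IsTwistProfile ε (h i) (χ i)) :
    IsotopicRelBoundary (ψ ∘ boundaryTwist ε c χ) (ψ ∘ pageMap ψ γ h Φ 0 (2 * π)) := by
  have hH := H.toIsCutCollar
  obtain ⟨a, ha0, haε, haδ, ha⟩ : ∃ a > 0, a ≤ ε ∧ a ≤ δ ^ 2 ∧
      ∀ i, ∀ τ ∈ Ioc (-a) 0, χ i τ = -(h i : ℝ) := by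
    choose η hη hηχ using fun i => (hχ i).eq_neg
    have h1 : ∀ᶠ a in 𝓝[>] (0 : ℝ), 0 < a ∧ a < ε ∧ a < δ ^ 2 ∧ ∀ i, a < η i := by
      have h2 : ∀ i, ∀ᶠ a in 𝓝[>] (0 : ℝ), a < η i := fun i =>
        mem_of_superset (Ioo_mem_nhdsGT (hη i)) fun a ha => ha.2
      filter_upwards [self_mem_nhdsWithin, Ioo_mem_nhdsGT H.collar.pos,
        Ioo_mem_nhdsGT (sq_pos_of_pos F.pos), eventually_all.2 h2] with a h3 h4 h5 h6
      exact ⟨h3, h4.2, h5.2, h6⟩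
    obtain ⟨a, h2, h3, h4, h5⟩ := h1.exists
    exact ⟨a, h2, h3.le, h4.le, fun i τ hτ => hηχ i τ (by linarith [h5 i, hτ.1])⟩
  -- the isotopy `ψ ∘ G_{0,2πr} ∘ D_{-2πr} ∘ D_{2π}`
  let P : ℝ → S → S := fun r x => ψ (pageMap ψ γ h Φ 0 (2 * π * r)
    (twistFlow ε c χ (-(2 * π * r)) (twistFlow ε c χ (2 * π) x)))
  have hc := H.collar
  refine ⟨P, ?_, ?_, ?_, ?_, collarNhd c a, hH.collarNhd_mem ha0, ?_⟩
  · have hr : ContMDiff (𝓘(ℝ, ℝ).prod (𝓡∂ 2)) 𝓘(ℝ, ℝ) ∞ (fun y : ℝ × S => 2 * π * y.1) := by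
      have : ContDiff ℝ ∞ fun r : ℝ => 2 * π * r := by fun_prop
      exact this.contMDiff.comp contMDiff_fst
    have hr' : ContMDiff (𝓘(ℝ, ℝ).prod (𝓡∂ 2)) 𝓘(ℝ, ℝ) ∞ (fun y : ℝ × S => -(2 * π * y.1)) := by
      have : ContDiff ℝ ∞ fun r : ℝ => -(2 * π * r) := by fun_prop
      exact this.contMDiff.comp contMDiff_fst
    have h1 : ContMDiff (𝓘(ℝ, ℝ).prod (𝓡∂ 2)) (𝓡∂ 2) ∞
        (fun y : ℝ × S => twistFlow ε c χ (2 * π) y.2) :=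
      (hc.contMDiff_twistFlow hχ).comp (contMDiff_const.prodMk contMDiff_snd)
    have h2 : ContMDiff (𝓘(ℝ, ℝ).prod (𝓡∂ 2)) (𝓡∂ 2) ∞ (fun y : ℝ × S =>
        twistFlow ε c χ (-(2 * π * y.1)) (twistFlow ε c χ (2 * π) y.2)) :=
      (hc.contMDiff_twistFlow hχ).comp (hr'.prodMk h1)
    exact ψ.contMDiff.comp ((contMDiff_pageMap H F hχ ha0 haε haδ ha 0).comp (hr.prodMk h2))
  · intro r
    obtain ⟨d₁, hd₁⟩ := hc.exists_diffeomorph_twistFlow hχ (2 * π)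
    obtain ⟨d₂, hd₂⟩ := hc.exists_diffeomorph_twistFlow hχ (-(2 * π * r))
    obtain ⟨d₃, hd₃⟩ := exists_diffeomorph_pageMap H F hχ ha0 haε haδ ha 0 (2 * π * r)
    refine ⟨((d₁.trans d₂).trans d₃).trans ψ, ?_⟩
    ext x
    simp only [Diffeomorph.coe_trans, Function.comp_apply, hd₁, hd₂, hd₃, P]
  · ext x
    simp only [P, mul_zero, neg_zero, hc.twistFlow_zero, pageMap_zero H F, twistFlow_two_pi,
      Function.comp_apply]
  · ext x
    simp only [P, mul_one, Function.comp_apply]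
    rw [← hc.twistFlow_add, neg_add_cancel, hc.twistFlow_zero]
  · intro r x hx
    simp only [P]
    rw [hH.twistFlow_two_pi_of_mem haε ha hx,
      pageMap_of_mem H F haε haδ ha (hH.twistFlow_mem_collarNhd haε hx _), ← hc.twistFlow_add,
      add_neg_cancel, hc.twistFlow_zero]
    obtain ⟨i, y, hy, rfl⟩ := mem_iUnion.1 hx
    exact H.fix i y ⟨⟨by linarith [hy.1.1], hy.1.2⟩, mem_univ _⟩

end OpenBookCut

end Return

theorem proposition2p1 {S : Type u} [TopologicalSpace S] [ChartedSpace (EuclideanHalfSpace 2) S]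
    [IsManifold (𝓡∂ 2) ∞ S] [CompactSpace S] [T2Space S]
    (ψ : Diffeomorph (𝓡∂ 2) (𝓡∂ 2) S S ∞)
    (hψ : ∃ U ∈ 𝓝ˢ ((𝓡∂ 2).boundary S), ∀ x ∈ U, ψ x = x)
    {k : ℕ} (γ : Fin k → Circle → S) (hγ : IsBoundaryCoordinates γ) (h : Fin k → ℤ) :
    -- collars on which `ψ` is the identity exist, and each choice of them gives a cut:
    (∃ (ε : ℝ) (c : Fin k → ℝ × Circle → S), IsCollar γ ε c ∧
      ∀ i, ∀ y ∈ Ioc (-ε) 0 ×ˢ univ, ψ (c i y) = c i y) ∧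
    ∀ (ε : ℝ) (c : Fin k → ℝ × Circle → S), IsCollar γ ε c →
      (∀ i, ∀ y ∈ Ioc (-ε) 0 ×ˢ univ, ψ (c i y) = c i y) →
      -- the quotient is a smooth closed 3-manifold,
      ∃ (_ : ChartedSpace (EuclideanSpace ℝ (Fin 3)) (OpenBookCut ψ γ h))
        (_ : IsManifold (𝓡 3) ∞ (OpenBookCut ψ γ h)),
        CompactSpace (OpenBookCut ψ γ h) ∧ T2Space (OpenBookCut ψ γ h) ∧
        ∃ (B : Set (OpenBookCut ψ γ h)) (p : OpenBookCut ψ γ h → Circle),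
          -- the binding is the image of `∂V`, and its complement is diffeomorphic to `Int V`,
          B = OpenBookCut.mk ψ γ h '' ((𝓡∂ 2).boundary S ×ˢ univ) ∧
          BijOn (OpenBookCut.proj ψ γ h)
            (MappingTorus.mk ψ '' ((𝓡∂ 2).interior S ×ˢ univ)) Bᶜ ∧
          IsLocalDiffeomorphOn ((𝓡∂ 2).prod 𝓘(ℝ, ℝ)) (𝓡 3) ∞ (OpenBookCut.mk ψ γ h)
            ((𝓡∂ 2).interior S ×ˢ univ) ∧
          -- `p` is given by the `s`-coordinate,
          (∀ x ∈ (𝓡∂ 2).interior S, ∀ s : ℝ, p (OpenBookCut.mk ψ γ h (x, s)) = Circle.exp s) ∧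
          -- this is an open book, adapted to the tubular neighbourhood given by the cut,
          IsOpenBook B p ∧
          IsAdaptedTube B p (OpenBookCut.tube ψ γ h c) (√ε) ∧
          -- the page over `s = 0` is a copy of the surface, whose boundary is the binding,
          IsEmbedding (OpenBookCut.page ψ γ h) ∧
          range (OpenBookCut.page ψ γ h) = closure (Bᶜ ∩ p ⁻¹' {1}) ∧
          OpenBookCut.page ψ γ h '' (𝓡∂ 2).boundary S = B ∧
          -- and the monodromy is `ψ` composed with `h i`-fold right-handed Dehn twists:
          ∀ χ : Fin k → ℝ → ℝ, (∀ i, IsTwistProfile ε (h i) (χ i)) →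
            (∃ Φ, IsMonodromyFlow B p (OpenBookCut.tube ψ γ h c) Φ ∧
              ∀ x, Φ (2 * π) (OpenBookCut.page ψ γ h x) =
                OpenBookCut.page ψ γ h (ψ (boundaryTwist ε c χ x))) ∧
            ∀ Φ, IsMonodromyFlow B p (OpenBookCut.tube ψ γ h c) Φ →
              ∃ f : S → S,
                (∀ x, Φ (2 * π) (OpenBookCut.page ψ γ h x) = OpenBookCut.page ψ γ h (f x)) ∧
                IsotopicRelBoundary (ψ ∘ boundaryTwist ε c χ) f := by
  obtain ⟨U, hU, hψU⟩ := hψ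
  refine ⟨?_, fun ε c hc hcψ => ?_⟩
  · obtain ⟨ε, c, hc, hcU⟩ := exists_isCollar hγ hU
    exact ⟨ε, c, hc, fun i y hy => hψU _ (hcU i y hy)⟩
  have hH : IsCutCollar ψ γ ε c := ⟨hγ, hc, hcψ⟩
  obtain ⟨C, hC, hmk, htube⟩ := OpenBookCut.exists_isManifold (h := h) hH
  have H : IsSmoothCut ψ γ h ε c := ⟨hH, hmk, htube⟩
  refine ⟨C, hC, OpenBookCut.compactSpace hH, OpenBookCut.t2Space hH, OpenBookCut.binding ψ γ h,
    OpenBookCut.angular ψ γ h, rfl, OpenBookCut.bijOn_proj hH, hmk,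
    fun x hx s => OpenBookCut.angular_mk hH hx s, OpenBookCut.isOpenBook H,
    OpenBookCut.isAdaptedTube H, (OpenBookCut.isClosedEmbedding_page hH).isEmbedding,
    OpenBookCut.range_page hH, OpenBookCut.page_boundary hH, fun χ hχ => ⟨?_, fun Φ hΦ => ?_⟩⟩
  · exact ⟨_, OpenBookCut.isMonodromyFlow_flow H hχ, OpenBookCut.flow_page hH hχ⟩
  · obtain ⟨δ, F⟩ := OpenBookCut.exists_isPageFlow H hΦ
    exact ⟨_, OpenBookCut.pageMap_two_pi H F, OpenBookCut.isotopic_pageMap H F hχ⟩
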